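/- Let $k$ be an algebraically closed field and let $D$ be a $k$-linear triangulated category (suspension $\Sigma$) that is Hom-finite ($\dim_k\mathrm{Hom}(X,Y)<\infty$ for all $X,Y$), has a Serre functor $S$ (an autoequivalence with isomorphisms $\mathrm{Hom}(X,Y)\cong\mathrm{Hom}(Y,SX)^*$ natural in $X,Y$), is indecomposable (whenever $D=D_1\oplus D_2$ for triangulated subcategories $D_1,D_2$, one of them is zero) and is algebraic: there is a $k$-linear pretriangulated dg category $C$ and an equivalence $H^0(C)\simeq D$ of $k$-linear triangulated categories. Fix such a $C$. Write $\mathrm{Hom}^m(X,Y)=\mathrm{Hom}(X,\Sigma^mY)$ and $\mathrm{Hom}^\bullet(X,Y)=\bigoplus_{m\in\mathbb Z}\Sigma^{-m}\mathrm{Hom}^m(X,Y)$. A sequence $E_*=(E_1,\dots,E_n)$ of objects of $D$ with $n\ge 2$ is an exceptional $n$-cycle if 1. every $E_i$ is exceptional, i.e. $\mathrm{Hom}^\bullet(E_i,E_i)=k\cdot\mathrm{id}\neq 0$; 2. there are integers $k_i$ with $S(E_i)\cong\Sigma^{k_i}E_{i+1}$ for all $i$, where $E_{n+1}:=E_1$;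 3. $\mathrm{Hom}^\bullet(E_i,E_j)=0$ unless $j=i$ or $j=i+1$ (indices modulo $n$). An exceptional $1$-cycle is a single spherical object $E$: for some integer $l$ one has $S(E)\cong\Sigma^lE$ and $\mathrm{Hom}^\bullet(E,E)\cong k\oplus\Sigma^{-l}k$ as graded vector spaces. Let $n\ge1$ and let $E_*$ be an exceptional $n$-cycle in $D$ such that $\mathrm{Hom}^\bullet(E_i,X)$ is finite-dimensional for all $i$ and all $X\in D$, so that the functor $F_{E_*}=\bigoplus_i\mathrm{Hom}^\bullet(E_i,-)\otimes E_i\colon D\to D$ is defined. The twist functor $T_{E_*}\colon D\to D$ is the cone of the evaluation morphism $F_{E_*}\to\mathrm{id}$, formed with the dg category $C$; that is, choosing objects of $C$ corresponding to the $E_i$, it is the functor characterised, up to isomorphism, by isomorphisms $$\mathrm{Hom}_D(W,T_{E_*}X)\;\cong\;H^0\Bigl(\mathrm{cone}\bigl(\textstyle\bigoplus_i \mathrm{Hom}_C(E_i,X)\otimes_k\mathrm{Hom}_C(W,E_i)\xrightarrow{\ \circ\ }\mathrm{Hom}_C(W,X)\bigr)\Bigr)$$ natural in $W$ and $X$. Theorem.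 The twist functor $T_{E_*}$ exists, and it is a $k$-linear exact autoequivalence of $D$. -/

import Mathlib

open CategoryTheory CategoryTheory.Limits CategoryTheory.Pretriangulated
open scoped TensorProduct DirectSum

universe w v v₁ v₂ u u₁ u₂

/-! ## Differential graded categories -/

/-- A `k`-linear differential graded category with objects `C`: cochain complexes `Hom X Y` of
`k`-modules, and bilinear associative unital compositions satisfying the graded Leibniz rule.
Composition is written diagrammatically, `comp f g` is `g ∘ f`, so that the Leibniz rule
`d (g ∘ f) = (d g) ∘ f + (-1)^|g| g ∘ (d f)` takes the form `d_comp`.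
(The index arguments `p + q = n`, `n + 1 = m` avoid transport along equalities of integers.) -/
class DGCategory (k : Type v) [CommRing k] (C : Type u) where
  Hom : C → C → ℤ → Type w
  [addCommGroup : ∀ X Y n, AddCommGroup (Hom X Y n)]
  [module : ∀ X Y n, Module k (Hom X Y n)]
  d : ∀ {X Y : C} {n m : ℤ}, n + 1 = m → (Hom X Y n →ₗ[k] Hom X Y m)
  one : ∀ X : C, Hom X X 0
  comp : ∀ {X Y Z : C} {p q n : ℤ}, p + q = n → (Hom X Y p →ₗ[k] Hom Y Z q →ₗ[k] Hom X Z n)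
  d_d : ∀ {X Y : C} {n m l : ℤ} (h : n + 1 = m) (h' : m + 1 = l) (f : Hom X Y n), d h' (d h f) = 0
  d_one : ∀ (X : C) {m : ℤ} (h : 0 + 1 = m), d h (one X) = 0
  d_comp : ∀ {X Y Z : C} {p q n p' q' m : ℤ} (h : p + q = n) (hp : p + 1 = p') (hq : q + 1 = q')
    (hn : n + 1 = m) (f : Hom X Y p) (g : Hom Y Z q),
    d hn (comp h f g) =
      comp (show p + q' = m by omega) f (d hq g) +
        q.negOnePow • comp (show p' + q = m by omega) (d hp f) g
  one_comp : ∀ {X Y : C} {n : ℤ} (f : Hom X Y n), comp (zero_add n) (one X) f = f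
  comp_one : ∀ {X Y : C} {n : ℤ} (f : Hom X Y n), comp (add_zero n) f (one Y) = f
  assoc : ∀ {W X Y Z : C} {p q r pq qr n : ℤ} (h₁ : p + q = pq) (h₂ : q + r = qr)
    (h : p + q + r = n) (f : Hom W X p) (g : Hom X Y q) (e : Hom Y Z r),
    comp (show pq + r = n by omega) (comp h₁ f g) e =
      comp (show p + qr = n by omega) f (comp h₂ g e)

attribute [reducible, instance] DGCategory.addCommGroup DGCategory.module

namespace DGCategory

section

variable (k : Type v) [CommRing k] {C : Type u} [DGCategory.{w} k C]

/-- The closed (cocycle) morphisms of degree `n`. -/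
def cocycles (X Y : C) (n : ℤ) : Submodule k (Hom k X Y n) :=
  LinearMap.ker (d (k := k) (X := X) (Y := Y) (rfl : n + 1 = n + 1))

/-- The exact (coboundary) morphisms of degree `n`. -/
def coboundaries (X Y : C) (n : ℤ) : Submodule k (Hom k X Y n) :=
  LinearMap.range (d (k := k) (X := X) (Y := Y) (sub_add_cancel n 1))

variable {k}

lemma mem_cocycles_iff {X Y : C} {n m : ℤ} (h : n + 1 = m) (f : Hom k X Y n) :
    f ∈ cocycles k X Y n ↔ d h f = 0 := by
  subst h; rfl

lemma one_mem_cocycles (X : C) : one X ∈ cocycles k X X 0 := d_one X _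

lemma comp_mem_cocycles {X Y Z : C} {p q n : ℤ} (h : p + q = n) {f : Hom k X Y p}
    {g : Hom k Y Z q} (hf : f ∈ cocycles k X Y p) (hg : g ∈ cocycles k Y Z q) :
    comp h f g ∈ cocycles k X Z n := by
  rw [mem_cocycles_iff rfl] at hf hg ⊢
  rw [d_comp h rfl rfl rfl, hf, hg]
  simp

/-- `IsCone f i p` says that `X --f--> Y --i--> Z --p--> X` (with `f`, `i` of degree `0` and `p`
of degree `1`) is a homotopy cone triangle of the closed morphism `f`: there are a nullhomotopy
`j` of `i ∘ f`, a nullhomotopy `t` of `p ∘ i`, such that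
* for all `W` the morphism `(a, b) ↦ j ∘ a + i ∘ b` from the cone of
  `Hom(W, X) → Hom(W, Y)` (degree `n` part `Hom(W, X)^(n+1) × Hom(W, Y)^n`, differential
  `(a, b) ↦ (-da, f ∘ a + db)`) to `Hom(W, Z)` is a quasi-isomorphism, and
* under this identification `p` is, up to homotopy, minus the projection to `X`.
The sign is that of the standard triangles in the homotopy category of complexes. -/
structure IsCone {X Y Z : C} (f : Hom k X Y 0) (i : Hom k Y Z 0) (p : Hom k Z X 1) : Prop where
  closed_f : f ∈ cocycles k X Y 0
  closed_i : i ∈ cocycles k Y Z 0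
  closed_p : p ∈ cocycles k Z X 1
  exists_homotopies : ∃ (j : Hom k X Z (-1)) (t : Hom k Y X 0),
    d (by omega) j = comp (zero_add 0) f i ∧
    d (zero_add 1) t = comp (zero_add 1) i p ∧
    comp (by omega) j p + comp (zero_add 0) f t + one X ∈ coboundaries k X X 0 ∧
    (∀ (W : C) (n : ℤ) (z : Hom k W Z n), z ∈ cocycles k W Z n →
      ∃ (a : Hom k W X (n + 1)) (b : Hom k W Y n),
        d rfl a = 0 ∧ comp (add_zero _) a f + d rfl b = 0 ∧
        z - (comp (by omega) a j + comp (add_zero _) b i) ∈ coboundaries k W Z n) ∧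
    (∀ (W : C) (n : ℤ) (a : Hom k W X (n + 1)) (b : Hom k W Y n),
      d rfl a = 0 → comp (add_zero _) a f + d rfl b = 0 →
      comp (by omega) a j + comp (add_zero _) b i ∈ coboundaries k W Z n →
      ∃ (a' : Hom k W X n) (b' : Hom k W Y (n - 1)),
        a = -d rfl a' ∧ b = comp (add_zero _) a' f + d (sub_add_cancel n 1) b')

end

/-! ### The cone of the evaluation map -/

section Twist

variable {k : Type v} [CommRing k] {C : Type u} [DGCategory.{w} k C]
  {ι : Type*} [DecidableEq ι] (E : ι → C)

/-- The degree `n` part of the complex `⨁ i, Hom(E i, X) ⊗ Hom(W, E i)`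
(the tensor factors are written in diagrammatic order). -/
abbrev EvalSource (W X : C) (n : ℤ) : Type _ :=
  ⨁ a : ι × {pq : ℤ × ℤ // pq.1 + pq.2 = n},
    Hom k W (E a.1) a.2.1.1 ⊗[k] Hom k (E a.1) X a.2.1.2

/-- The inclusion of `Hom(W, E i)^p ⊗ Hom(E i, X)^q`. -/
def evalSourceIncl (W X : C) {n : ℤ} (i : ι) (p q : ℤ) (h : p + q = n) :
    Hom k W (E i) p ⊗[k] Hom k (E i) X q →ₗ[k] EvalSource (k := k) E W X n :=
  DirectSum.lof k (ι × {pq : ℤ × ℤ // pq.1 + pq.2 = n})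
    (fun a ↦ Hom k W (E a.1) a.2.1.1 ⊗[k] Hom k (E a.1) X a.2.1.2) (i, ⟨(p, q), h⟩)

/-- The differential `w ⊗ e ↦ w ⊗ de + (-1)^|e| dw ⊗ e`. -/
def evalSourceD (W X : C) {n m : ℤ} (h : n + 1 = m) :
    EvalSource (k := k) E W X n →ₗ[k] EvalSource (k := k) E W X m :=
  DirectSum.toModule k _ _ fun a ↦
    evalSourceIncl E W X a.1 a.2.1.1 (a.2.1.2 + 1) (by have := a.2.2; omega) ∘ₗ
        (d rfl).lTensor (Hom k W (E a.1) a.2.1.1) +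
      a.2.1.2.negOnePow • (evalSourceIncl E W X a.1 (a.2.1.1 + 1) a.2.1.2
          (by have := a.2.2; omega) ∘ₗ
        (d rfl).rTensor (Hom k (E a.1) X a.2.1.2))

/-- The evaluation map `⨁ i, Hom(E i, X) ⊗ Hom(W, E i) → Hom(W, X)`, given by composition. -/
def evalMap (W X : C) {n m : ℤ} (h : n = m) :
    EvalSource (k := k) E W X n →ₗ[k] Hom k W X m :=
  DirectSum.toModule k _ _ fun a ↦ TensorProduct.lift (comp (a.2.2.trans h))

/-- The degree `n` part of the cone of the evaluation map. -/
abbrev TwistCone (k : Type v) [CommRing k] [DGCategory.{w} k C] (W X : C) (n : ℤ) : Type _ :=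
  EvalSource (k := k) E W X (n + 1) × Hom k W X n

/-- The differential `(u, x) ↦ (-du, ev u + dx)` of the cone of the evaluation map. -/
def twistConeD (W X : C) {n m : ℤ} (h : n + 1 = m) :
    TwistCone E k W X n →ₗ[k] TwistCone E k W X m :=
  LinearMap.prod
    (-(evalSourceD E W X (show n + 1 + 1 = m + 1 by omega) ∘ₗ LinearMap.fst k _ _))
    (evalMap E W X h ∘ₗ LinearMap.fst k _ _ + d h ∘ₗ LinearMap.snd k _ _)

/-- Precomposition with a degree `0` morphism `g : W' ⟶ W`. -/
def evalSourcePull {W' W : C} (X : C) (g : Hom k W' W 0) (n : ℤ) :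
    EvalSource (k := k) E W X n →ₗ[k] EvalSource (k := k) E W' X n :=
  DirectSum.toModule k _ _ fun a ↦
    evalSourceIncl E W' X a.1 a.2.1.1 a.2.1.2 a.2.2 ∘ₗ
      (comp (zero_add _) g).rTensor (Hom k (E a.1) X a.2.1.2)

/-- Postcomposition with a degree `0` morphism `f : X ⟶ X'`. -/
def evalSourcePush (W : C) {X X' : C} (f : Hom k X X' 0) (n : ℤ) :
    EvalSource (k := k) E W X n →ₗ[k] EvalSource (k := k) E W X' n :=
  DirectSum.toModule k _ _ fun a ↦
    evalSourceIncl E W X' a.1 a.2.1.1 a.2.1.2 a.2.2 ∘ₗ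
      ((comp (add_zero _)).flip f).lTensor (Hom k W (E a.1) a.2.1.1)

/-- The cone of the evaluation map is contravariant in `W`. -/
def twistConePull {W' W : C} (X : C) (g : Hom k W' W 0) (n : ℤ) :
    TwistCone E k W X n →ₗ[k] TwistCone E k W' X n :=
  LinearMap.prodMap (evalSourcePull E X g (n + 1)) (comp (zero_add n) g)

/-- The cone of the evaluation map is covariant in `X`. -/
def twistConePush (W : C) {X X' : C} (f : Hom k X X' 0) (n : ℤ) :
    TwistCone E k W X n →ₗ[k] TwistCone E k W X' n :=
  LinearMap.prodMap (evalSourcePush E W f (n + 1)) ((comp (add_zero n)).flip f)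

variable (k) in
/-- The `0`-cocycles of the cone of the evaluation map. -/
def twistCocycles (W X : C) : Submodule k (TwistCone E k W X 0) :=
  LinearMap.ker (twistConeD E W X (zero_add 1))

variable (k) in
/-- The `0`-coboundaries of the cone of the evaluation map. -/
def twistCoboundaries (W X : C) : Submodule k (TwistCone E k W X 0) :=
  LinearMap.range (twistConeD E W X (show (-1 : ℤ) + 1 = 0 by omega))

@[simp] lemma evalSourceD_incl (W X : C) {n m : ℤ} (hn : n + 1 = m) (i : ι) (p q : ℤ)
    (h : p + q = n) (x : Hom k W (E i) p) (y : Hom k (E i) X q) :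
    evalSourceD E W X hn (evalSourceIncl E W X i p q h (x ⊗ₜ y)) =
      evalSourceIncl E W X i p (q + 1) (by omega) (x ⊗ₜ d rfl y) +
      q.negOnePow • evalSourceIncl E W X i (p + 1) q (by omega) (d rfl x ⊗ₜ y) := by
  simp [evalSourceD, evalSourceIncl]

@[simp] lemma evalMap_incl (W X : C) {n m : ℤ} (hn : n = m) (i : ι) (p q : ℤ)
    (h : p + q = n) (x : Hom k W (E i) p) (y : Hom k (E i) X q) :
    evalMap E W X hn (evalSourceIncl E W X i p q h (x ⊗ₜ y)) = comp (h.trans hn) x y := by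
  simp [evalMap, evalSourceIncl]

@[simp] lemma evalSourcePull_incl {W' W : C} (X : C) (g : Hom k W' W 0) {n : ℤ} (i : ι) (p q : ℤ)
    (h : p + q = n) (x : Hom k W (E i) p) (y : Hom k (E i) X q) :
    evalSourcePull E X g n (evalSourceIncl E W X i p q h (x ⊗ₜ y)) =
      evalSourceIncl E W' X i p q h (comp (zero_add p) g x ⊗ₜ y) := by
  simp [evalSourcePull, evalSourceIncl]

@[simp] lemma evalSourcePush_incl (W : C) {X X' : C} (f : Hom k X X' 0) {n : ℤ} (i : ι) (p q : ℤ)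
    (h : p + q = n) (x : Hom k W (E i) p) (y : Hom k (E i) X q) :
    evalSourcePush E W f n (evalSourceIncl E W X i p q h (x ⊗ₜ y)) =
      evalSourceIncl E W X' i p q h (x ⊗ₜ comp (add_zero q) y f) := by
  simp [evalSourcePush, evalSourceIncl]

lemma evalSource_hom_ext {W X : C} {n : ℤ} {M : Type*} [AddCommGroup M] [Module k M]
    {φ ψ : EvalSource (k := k) E W X n →ₗ[k] M}
    (h : ∀ (i : ι) (p q : ℤ) (hpq : p + q = n) (x : Hom k W (E i) p) (y : Hom k (E i) X q),
      φ (evalSourceIncl E W X i p q hpq (x ⊗ₜ y)) = ψ (evalSourceIncl E W X i p q hpq (x ⊗ₜ y))) :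
    φ = ψ := by
  refine DirectSum.linearMap_ext k fun a ↦ TensorProduct.ext' fun x y ↦ ?_
  obtain ⟨i, ⟨⟨p, q⟩, hpq⟩⟩ := a
  exact h i p q hpq x y

lemma evalSourceD_comp_evalSourceD (W X : C) {n m l : ℤ} (h : n + 1 = m) (h' : m + 1 = l) :
    evalSourceD E W X h' ∘ₗ evalSourceD (k := k) E W X h = 0 := by
  refine evalSource_hom_ext E fun i p q hpq x y ↦ ?_
  simp [d_d, Int.negOnePow_succ, map_zsmul_unit]

lemma evalMap_comp_evalSourceD (W X : C) {n m : ℤ} (h : n + 1 = m) :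
    evalMap E W X rfl ∘ₗ evalSourceD (k := k) E W X h = d h ∘ₗ evalMap E W X rfl := by
  refine evalSource_hom_ext E fun i p q hpq x y ↦ ?_
  simp [d_comp hpq rfl rfl h, map_zsmul_unit]

lemma twistConeD_comp_twistConeD (W X : C) {n m l : ℤ} (h : n + 1 = m) (h' : m + 1 = l) :
    twistConeD E W X h' ∘ₗ twistConeD (k := k) E W X h = 0 := by
  subst h h'
  refine LinearMap.ext fun ⟨u, x⟩ ↦ Prod.ext ?_ ?_
  · have := LinearMap.congr_fun (evalSourceD_comp_evalSourceD (k := k) E W X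
      (n := n + 1) rfl rfl) u
    simpa [twistConeD] using this
  · have := LinearMap.congr_fun (evalMap_comp_evalSourceD (k := k) E W X (n := n + 1) rfl) u
    simp only [LinearMap.comp_apply] at this
    simp [twistConeD, d_d, this]

lemma twistCoboundaries_le_twistCocycles (W X : C) :
    twistCoboundaries k E W X ≤ twistCocycles k E W X := by
  rintro _ ⟨y, rfl⟩
  exact LinearMap.congr_fun (twistConeD_comp_twistConeD E W X _ _) y

lemma mem_twistCocycles_iff (W X : C) (u : EvalSource (k := k) E W X (0 + 1))
    (x : Hom k W X 0) :
    ((u, x) : TwistCone E k W X 0) ∈ twistCocycles k E W X ↔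
      evalSourceD E W X (show (0 : ℤ) + 1 + 1 = 1 + 1 by omega) u = 0 ∧
        evalMap E W X (zero_add 1) u + d (zero_add 1) x = 0 := by
  simp [twistCocycles, twistConeD, -zero_add, -Int.reduceAdd]

lemma twistConePull_mem_twistCocycles {W' W X : C} {g : Hom k W' W 0}
    (hg : g ∈ cocycles k W' W 0) {z : TwistCone E k W X 0} (hz : z ∈ twistCocycles k E W X) :
    twistConePull E X g 0 z ∈ twistCocycles k E W' X := by
  have hg' : d rfl g = 0 := hg
  have key : ∀ {n m : ℤ} (h : n + 1 = m) (u : EvalSource (k := k) E W X n),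
      evalSourceD E W' X h (evalSourcePull E X g n u) =
        evalSourcePull E X g m (evalSourceD E W X h u) := fun {n m} h u ↦ by
    refine LinearMap.congr_fun (f := evalSourceD E W' X h ∘ₗ evalSourcePull E X g n)
      (g := evalSourcePull E X g m ∘ₗ evalSourceD E W X h) ?_ u
    refine evalSource_hom_ext E fun i p q hpq x y ↦ ?_
    simp [d_comp (zero_add p) rfl rfl rfl, hg', map_zsmul_unit]
  have ev : ∀ {n m : ℤ} (h : n = m) (u : EvalSource (k := k) E W X n),
      evalMap E W' X h (evalSourcePull E X g n u) =
        comp (zero_add m) g (evalMap E W X h u) := fun {n m} h u ↦ by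
    refine LinearMap.congr_fun (f := evalMap E W' X h ∘ₗ evalSourcePull E X g n)
      (g := comp (zero_add m) g ∘ₗ evalMap E W X h) ?_ u
    refine evalSource_hom_ext E fun i p q hpq x y ↦ ?_
    simpa using assoc (zero_add p) (hpq.trans h) (by omega) g x y
  obtain ⟨u, x⟩ := z
  rw [mem_twistCocycles_iff] at hz
  refine (mem_twistCocycles_iff E _ _ _ _).2 ⟨(key _ u).trans (by rw [hz.1, map_zero]), ?_⟩
  change evalMap E W' X _ (evalSourcePull E X g (0 + 1) u) + d _ (comp (zero_add 0) g x) = 0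
  rw [ev, d_comp (zero_add 0) rfl (zero_add 1) (zero_add 1), hg', map_zero,
    LinearMap.zero_apply, smul_zero, add_zero, ← map_add, hz.2, map_zero]

lemma twistConePush_mem_twistCocycles {W X X' : C} {f : Hom k X X' 0}
    (hf : f ∈ cocycles k X X' 0) {z : TwistCone E k W X 0} (hz : z ∈ twistCocycles k E W X) :
    twistConePush E W f 0 z ∈ twistCocycles k E W X' := by
  have hf' : d rfl f = 0 := hf
  have key : ∀ {n m : ℤ} (h : n + 1 = m) (u : EvalSource (k := k) E W X n),
      evalSourceD E W X' h (evalSourcePush E W f n u) =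
        evalSourcePush E W f m (evalSourceD E W X h u) := fun {n m} h u ↦ by
    refine LinearMap.congr_fun (f := evalSourceD E W X' h ∘ₗ evalSourcePush E W f n)
      (g := evalSourcePush E W f m ∘ₗ evalSourceD E W X h) ?_ u
    refine evalSource_hom_ext E fun i p q hpq x y ↦ ?_
    simp [d_comp (add_zero q) rfl rfl rfl, hf', map_zsmul_unit]
  have ev : ∀ {n m : ℤ} (h : n = m) (u : EvalSource (k := k) E W X n),
      evalMap E W X' h (evalSourcePush E W f n u) =
        comp (add_zero m) (evalMap E W X h u) f := fun {n m} h u ↦ by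
    refine LinearMap.congr_fun (f := evalMap E W X' h ∘ₗ evalSourcePush E W f n)
      (g := (comp (add_zero m)).flip f ∘ₗ evalMap E W X h) ?_ u
    refine evalSource_hom_ext E fun i p q hpq x y ↦ ?_
    simpa using (assoc (hpq.trans h) (add_zero q) (by omega) x y f).symm
  obtain ⟨u, x⟩ := z
  rw [mem_twistCocycles_iff] at hz
  refine (mem_twistCocycles_iff E _ _ _ _).2 ⟨(key _ u).trans (by rw [hz.1, map_zero]), ?_⟩
  change evalMap E W X' _ (evalSourcePush E W f (0 + 1) u) + d _ (comp (add_zero 0) x f) = 0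
  rw [ev, d_comp (add_zero 0) (zero_add 1) rfl (zero_add 1), hf', map_zero, zero_add (_ • _),
    Int.negOnePow_zero, one_smul, ← LinearMap.add_apply, ← map_add, hz.2, map_zero,
    LinearMap.zero_apply]

end Twist

end DGCategory

/-! ## Triangulated categories: enhancements, Serre functors, indecomposability -/

section Triangulated

variable (k : Type v) [Field k]
  (D : Type u₁) [Category.{v₁} D] [Preadditive D] [Linear k D] [HasZeroObject D] [HasShift D ℤ]
  [∀ n : ℤ, (shiftFunctor D n).Additive] [Pretriangulated D]

/-- `D` is Hom-finite: all morphism spaces are finite-dimensional. -/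
def IsHomFinite : Prop := ∀ X Y : D, Module.Finite k (X ⟶ Y)

/-- A presentation of the triangulated category `D` as the homotopy category of the dg category
`C`: an essentially surjective map on objects and identifications
`Hⁿ(Hom_C(X, Y)) ≃ Hom_D(X, Y⟦n⟧)`, compatible with identities and compositions, such that every
closed degree `0` morphism of `C` has a homotopy cone in `C` and the homotopy cone triangles of
`C` become distinguished triangles in `D`. (So `C` is pretriangulated and `D` is equivalent, as a
`k`-linear triangulated category, to `H⁰(C)`.) -/
structure DGEnhancement (C : Type u₂) [DGCategory.{w} k C] where
  obj : C → D
  essSurj : ∀ A : D, ∃ X : C, Nonempty (obj X ≅ A)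
  cl : ∀ {X Y : C} (n : ℤ), DGCategory.cocycles k X Y n →ₗ[k] ShiftedHom (obj X) (obj Y) n
  cl_surjective : ∀ (X Y : C) (n : ℤ), Function.Surjective (cl (X := X) (Y := Y) n)
  cl_eq_zero_iff : ∀ {X Y : C} {n : ℤ} (f : DGCategory.cocycles k X Y n),
    cl n f = 0 ↔ f.1 ∈ DGCategory.coboundaries k X Y n
  cl_one : ∀ X : C, cl 0 ⟨DGCategory.one X, DGCategory.one_mem_cocycles X⟩ =
    ShiftedHom.mk₀ 0 rfl (𝟙 (obj X))
  cl_comp : ∀ {X Y Z : C} {p q n : ℤ} (h : p + q = n) (f : DGCategory.cocycles k X Y p)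
    (g : DGCategory.cocycles k Y Z q),
    cl n ⟨DGCategory.comp h f.1 g.1, DGCategory.comp_mem_cocycles h f.2 g.2⟩ =
      (cl p f).comp (cl q g) (show q + p = n by omega)
  exists_isCone : ∀ {X Y : C} (f : DGCategory.cocycles k X Y 0),
    ∃ (Z : C) (i : DGCategory.Hom k Y Z 0) (p : DGCategory.Hom k Z X 1), DGCategory.IsCone f.1 i p
  distinguished : ∀ {X Y Z : C} (f : DGCategory.cocycles k X Y 0)
    (i : DGCategory.cocycles k Y Z 0) (p : DGCategory.cocycles k Z X 1),
    DGCategory.IsCone f.1 i.1 p.1 →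
    Triangle.mk ((ShiftedHom.homEquiv (0 : ℤ) rfl).symm (cl 0 f))
      ((ShiftedHom.homEquiv (0 : ℤ) rfl).symm (cl 0 i)) (cl 1 p) ∈ distTriang D

/-- A Serre functor: an autoequivalence `S` with isomorphisms `Hom(X, Y) ≃ Hom(Y, S X)^*`,
natural in both variables. -/
structure SerreFunctor where
  S : D ⥤ D
  isEquivalence : S.IsEquivalence
  duality : ∀ X Y : D, (X ⟶ Y) ≃ₗ[k] Module.Dual k (Y ⟶ S.obj X)
  duality_natural : ∀ {X' X Y Y' : D} (f : X' ⟶ X) (u : X ⟶ Y) (g : Y ⟶ Y')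
    (e : Y' ⟶ S.obj X'),
    duality X' Y' (f ≫ u ≫ g) e = duality X Y u (g ≫ e ≫ S.map f)

/-- `D` is indecomposable: if `D` is the direct sum of two mutually orthogonal full triangulated
subcategories `P` and `Q`, then one of them is zero. -/
def IsIndecomposable : Prop :=
  ∀ P Q : ObjectProperty D, P.IsClosedUnderIsomorphisms → Q.IsClosedUnderIsomorphisms →
    P.IsTriangulated → Q.IsTriangulated →
    (∀ A B : D, P A → Q B → (∀ f : A ⟶ B, f = 0) ∧ (∀ f : B ⟶ A, f = 0)) →
    (∀ X : D, ∃ A B : D, P A ∧ Q B ∧ Nonempty (X ≅ A ⊞ B)) →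
    (∀ A, P A → IsZero A) ∨ (∀ B, Q B → IsZero B)

variable {D}

/-- A `k`-linear exact autoequivalence of `D`. -/
def IsAutoequivalence (T : D ⥤ D) : Prop :=
  T.IsEquivalence ∧ T.Linear k ∧ ∃ _ : T.CommShift ℤ, T.IsTriangulated

/-- `E` is exceptional: `Hom^•(E, E) = k · id`. -/
def IsExceptional (E : D) : Prop :=
  𝟙 E ≠ 0 ∧ (∀ f : E ⟶ E, ∃ c : k, f = c • 𝟙 E) ∧
    ∀ l : ℤ, l ≠ 0 → ∀ f : E ⟶ E⟦l⟧, f = 0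

variable {k}

/-- `E` is spherical: for some `l`, `S E ≅ Σ^l E` and `Hom^•(E, E) = k ⊕ Σ^(-l) k`. -/
def IsSpherical (S : SerreFunctor k D) (E : D) : Prop :=
  ∃ l : ℤ, Nonempty (S.S.obj E ≅ E⟦l⟧) ∧
    ∀ m : ℤ, Module.finrank k (E ⟶ E⟦m⟧) = (if m = 0 then 1 else 0) + (if m = l then 1 else 0)

/-- Exceptional `n`-cycles `(E_1, …, E_n)`. For `n = 1` this means a single spherical object.
Addition in `Fin n` is cyclic, so that `i + 1` is the successor in the cycle. -/
def IsExceptionalCycle (S : SerreFunctor k D) {n : ℕ} [NeZero n] (E : Fin n → D) : Prop :=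
  (n = 1 ∧ ∀ i, IsSpherical S (E i)) ∨
  (2 ≤ n ∧ (∀ i, IsExceptional k (E i)) ∧
    (∀ i, ∃ l : ℤ, Nonempty (S.S.obj (E i) ≅ (E (i + 1))⟦l⟧)) ∧
    (∀ i j, j ≠ i → j ≠ i + 1 → ∀ (l : ℤ) (f : E i ⟶ (E j)⟦l⟧), f = 0))

section Twist

variable {C : Type u₂} [DGCategory.{w} k C] (Φ : DGEnhancement k D C)

/-- The morphism of `D` given by a closed morphism of degree `0`. -/
noncomputable def DGEnhancement.map {X Y : C} (f : DGCategory.cocycles k X Y 0) :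
    Φ.obj X ⟶ Φ.obj Y :=
  (ShiftedHom.homEquiv (0 : ℤ) rfl).symm (Φ.cl 0 f)

/-- An identification of `T` with the cone of the evaluation morphism
`⨁ i, Hom(E i, -) ⊗ E i ⟶ id` of bimodules over the dg category `C`, on the homotopy category:
isomorphisms, natural in both variables,
`Hom_D(W, T X) ≃ H⁰(cone(⨁ i, Hom_C(E i, X) ⊗ Hom_C(W, E i) ⟶ Hom_C(W, X)))`. -/
structure TwistIdentification {ι : Type*} [DecidableEq ι] (E : ι → C) (T : D ⥤ D) where
  rep : ∀ W X : C, DGCategory.twistCocycles k E W X →ₗ[k] (Φ.obj W ⟶ T.obj (Φ.obj X))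
  rep_surjective : ∀ W X : C, Function.Surjective (rep W X)
  rep_eq_zero_iff : ∀ {W X : C} (z : DGCategory.twistCocycles k E W X),
    rep W X z = 0 ↔ z.1 ∈ DGCategory.twistCoboundaries k E W X
  rep_pull : ∀ {W' W : C} (X : C) (g : DGCategory.cocycles k W' W 0)
    (z : DGCategory.twistCocycles k E W X),
    rep W' X ⟨DGCategory.twistConePull E X g.1 0 z.1,
      DGCategory.twistConePull_mem_twistCocycles E g.2 z.2⟩ = Φ.map g ≫ rep W X z
  rep_push : ∀ (W : C) {X X' : C} (f : DGCategory.cocycles k X X' 0)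
    (z : DGCategory.twistCocycles k E W X),
    rep W X' ⟨DGCategory.twistConePush E W f.1 0 z.1,
      DGCategory.twistConePush_mem_twistCocycles E f.2 z.2⟩ = rep W X z ≫ T.map (Φ.map f)

/-- `T` is the twist functor of the family `E` of objects of `D`, formed with the enhancement `Φ`.
By the Yoneda lemma this determines `T` up to isomorphism of functors. -/
def IsTwistFunctor {ι : Type*} [DecidableEq ι] (E : ι → D) (T : D ⥤ D) : Prop :=
  ∃ E' : ι → C, (∀ i, Nonempty (Φ.obj (E' i) ≅ E i)) ∧ Nonempty (TwistIdentification Φ E' T)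

end Twist

end Triangulated

/-! Let T be the twist, with values `Z X`, and let `HH` denote graded homotopy classes in `C`. The
cone of the evaluation map is a dg bimodule, so it fits into the corner of a triangular dg category
`TwistGlue` made of two copies of `C`: the classes from `src W` to `tgt X` are the cohomology of the
cone at `(W, X)`. The twist of X is an object representing these classes as a functor of W
(`IsUniversal`); an object corepresenting them as a functor of X (`IsCouniversal`) is the value at W
of a left adjoint L of T.

Existence. Over a field, a Künneth argument (`mem_of_evalSourceD_eq_zero`) shows that the cohomology
of the source is spanned by products of classes. As the total spaces of morphisms from the E_i to X
are finite-dimensional, the source is represented by a finite sum G of shifts of the E_i, and the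
cone of G → X is the twist (`exists_isUniversal`). Serre duality along the cycle gives the
finiteness of the morphisms W → E_i, and the dual construction yields L (`exists_isCouniversal`).
Then S L S⁻¹ is a right adjoint of T (`exists_twistMap_comp_bijective`).

Full faithfulness (`bijective_twistMap`). A generator g of the morphisms from E_j to E_{j+1} (for a
single spherical object, a second generator of its endomorphisms) gives the cocycle 1 ⊗ g - g ⊗ 1,
which is both universal and couniversal; hence T sends E_{j+1} to a shift of E_j and is bijective on
all morphisms out of E_{j+1}. Let ξ be the unit X → R of the adjunction, where R = S L S⁻¹(T X), and
let Q be its cone. Bijectivity of T on morphisms A → X amounts to bijectivity of composition with ξ.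
With A = E_j this shows that Q is right orthogonal to the cycle, hence also left orthogonal by Serre
duality. The twist fixes such a Q, and is bijective on morphisms out of it. So all morphisms Q → Q
vanish, Q = 0 and ξ is invertible.

Essential surjectivity (`exists_iso_twist`). The cone Q of the counit T R → Y receives no nonzero
morphism from the image of T. The image contains shifts of all E_j, so Q is orthogonal to the cycle
and is its own twist; again Q = 0.

Exactness. The universal classes map the dg cone of T f to the twist of the cone of f. Both
triangles give long exact sequences, so the five lemma makes this map an isomorphism
(`distinguished_twistMap`). Yoneda gives uniqueness of the twist functor for given lifts of the E_i,
and so transports the conclusion to every twist functor. -/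

namespace DGCategory

/-! ### The graded homotopy category of a dg category -/

section HomotopyClasses

variable {k : Type v} [CommRing k] {C : Type u} [DGCategory.{w} k C]

lemma mem_coboundaries_iff {X Y : C} {n m : ℤ} (h : n + 1 = m) (f : Hom k X Y m) :
    f ∈ coboundaries k X Y m ↔ ∃ g : Hom k X Y n, d h g = f := by
  obtain rfl : n = m - 1 := by omega
  exact Iff.rfl

lemma d_mem_coboundaries {X Y : C} {n m : ℤ} (h : n + 1 = m) (g : Hom k X Y n) :
    d h g ∈ coboundaries k X Y m := (mem_coboundaries_iff h _).2 ⟨g, rfl⟩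

lemma coboundaries_le_cocycles (X Y : C) (n : ℤ) : coboundaries k X Y n ≤ cocycles k X Y n := by
  rintro _ ⟨g, rfl⟩
  exact d_d _ _ _

lemma d_comp_closed_left {X Y Z : C} {p q n q' m : ℤ} (h : p + q = n) (hq : q + 1 = q')
    (hn : n + 1 = m) {f : Hom k X Y p} (hf : f ∈ cocycles k X Y p) (g : Hom k Y Z q) :
    d hn (comp h f g) = comp (show p + q' = m by omega) f (d hq g) := by
  rw [d_comp h rfl hq hn, (mem_cocycles_iff rfl f).1 hf]
  simp

lemma d_comp_closed_right {X Y Z : C} {p q n p' m : ℤ} (h : p + q = n) (hp : p + 1 = p')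
    (hn : n + 1 = m) (f : Hom k X Y p) {g : Hom k Y Z q} (hg : g ∈ cocycles k Y Z q) :
    d hn (comp h f g) = q.negOnePow • comp (show p' + q = m by omega) (d hp f) g := by
  rw [d_comp h hp rfl hn, (mem_cocycles_iff rfl g).1 hg]
  simp

lemma comp_mem_coboundaries_right {X Y Z : C} {p q n : ℤ} (h : p + q = n) {f : Hom k X Y p}
    {g : Hom k Y Z q} (hf : f ∈ cocycles k X Y p) (hg : g ∈ coboundaries k Y Z q) :
    comp h f g ∈ coboundaries k X Z n := by
  obtain ⟨e, rfl⟩ := hg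
  exact (mem_coboundaries_iff (sub_add_cancel n 1) _).2
    ⟨comp (by omega) f e, d_comp_closed_left _ _ _ hf e⟩

lemma comp_mem_coboundaries_left {X Y Z : C} {p q n : ℤ} (h : p + q = n) {f : Hom k X Y p}
    {g : Hom k Y Z q} (hf : f ∈ coboundaries k X Y p) (hg : g ∈ cocycles k Y Z q) :
    comp h f g ∈ coboundaries k X Z n := by
  obtain ⟨e, rfl⟩ := hf
  refine (mem_coboundaries_iff (sub_add_cancel n 1) _).2
    -- In diagrammatic order the Leibniz sign falls on the term that differentiates the left factor,
    -- so the primitive carries `(-1)^q`.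
    ⟨q.negOnePow • comp (by omega) e g, ?_⟩
  rw [map_zsmul_unit, d_comp_closed_right _ (sub_add_cancel p 1) _ e hg, smul_smul]
  simp

variable (k) in
/-- The homotopy classes of closed morphisms of degree `n`. -/
abbrev HH (X Y : C) (n : ℤ) : Type _ :=
  cocycles k X Y n ⧸ (coboundaries k X Y n).submoduleOf (cocycles k X Y n)

namespace HH

/-- The homotopy class of a closed morphism. -/
def mk {X Y : C} {n : ℤ} : cocycles k X Y n →ₗ[k] HH k X Y n := Submodule.mkQ _

lemma mk_surjective {X Y : C} {n : ℤ} : Function.Surjective (mk (k := k) (X := X) (Y := Y) (n := n)) :=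
  Submodule.mkQ_surjective _

lemma mk_eq_zero_iff {X Y : C} {n : ℤ} (f : cocycles k X Y n) :
    mk f = 0 ↔ f.1 ∈ coboundaries k X Y n := by
  exact Submodule.Quotient.mk_eq_zero _

lemma mk_eq_mk_iff {X Y : C} {n : ℤ} (f g : cocycles k X Y n) :
    mk f = mk g ↔ f.1 - g.1 ∈ coboundaries k X Y n := by
  rw [← sub_eq_zero, ← map_sub, mk_eq_zero_iff]; rfl

/-- The composition of closed morphisms, as a bilinear map to homotopy classes. -/
def compAux {X Y Z : C} {p q n : ℤ} (h : p + q = n) :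
    cocycles k X Y p →ₗ[k] cocycles k Y Z q →ₗ[k] HH k X Z n :=
  LinearMap.mk₂ k (fun f g ↦ mk ⟨DGCategory.comp h f.1 g.1, comp_mem_cocycles h f.2 g.2⟩)
    (fun f f' g ↦ by rw [← map_add]; congr 1; ext; simp)
    (fun c f g ↦ by rw [← map_smul]; congr 1; ext; simp)
    (fun f f' g ↦ by rw [← map_add]; congr 1; ext; simp)
    (fun c f g ↦ by rw [← map_smul]; congr 1; ext; simp)

/-- The composition of homotopy classes. -/
def comp {X Y Z : C} {p q n : ℤ} (h : p + q = n) :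
    HH k X Y p →ₗ[k] HH k Y Z q →ₗ[k] HH k X Z n :=
  Submodule.liftQ _ (LinearMap.flip (Submodule.liftQ _ (compAux h).flip fun g hg ↦ by
      ext f
      exact (mk_eq_zero_iff _).2 (comp_mem_coboundaries_right h f.2 hg))) fun f hf ↦ by
    refine LinearMap.ext fun g ↦ ?_
    obtain ⟨g, rfl⟩ := mk_surjective g
    exact (mk_eq_zero_iff _).2 (comp_mem_coboundaries_left h hf g.2)

@[simp] lemma comp_mk {X Y Z : C} {p q n : ℤ} (h : p + q = n) (f : cocycles k X Y p)
    (g : cocycles k Y Z q) :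
    comp h (mk f) (mk g) = mk ⟨DGCategory.comp h f.1 g.1, comp_mem_cocycles h f.2 g.2⟩ := rfl

variable (k) in
/-- The class of the identity. -/
def one (X : C) : HH k X X 0 := mk ⟨DGCategory.one X, one_mem_cocycles X⟩

@[simp] lemma one_comp {X Y : C} {n : ℤ} (f : HH k X Y n) : comp (zero_add n) (one k X) f = f := by
  obtain ⟨f, rfl⟩ := mk_surjective f
  exact congrArg mk (Subtype.ext (DGCategory.one_comp f.1))

@[simp] lemma comp_one {X Y : C} {n : ℤ} (f : HH k X Y n) : comp (add_zero n) f (one k Y) = f := by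
  obtain ⟨f, rfl⟩ := mk_surjective f
  exact congrArg mk (Subtype.ext (DGCategory.comp_one f.1))

lemma comp_assoc {W X Y Z : C} {p q r pq qr n : ℤ} (h₁ : p + q = pq) (h₂ : q + r = qr)
    (h : p + q + r = n) (f : HH k W X p) (g : HH k X Y q) (e : HH k Y Z r) :
    comp (show pq + r = n by omega) (comp h₁ f g) e =
      comp (show p + qr = n by omega) f (comp h₂ g e) := by
  obtain ⟨f, rfl⟩ := mk_surjective f
  obtain ⟨g, rfl⟩ := mk_surjective g
  obtain ⟨e, rfl⟩ := mk_surjective e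
  exact congrArg mk (Subtype.ext (DGCategory.assoc h₁ h₂ h f.1 g.1 e.1))

end HH

end HomotopyClasses

end DGCategory

/-! ### The graded bimodule structure on the source of the evaluation map -/

namespace DGCategory

section EvalBimodule

variable {k : Type v} [CommRing k] {C : Type u} [DGCategory.{w} k C]
  {ι : Type} [DecidableEq ι] (E : ι → C)

/-- The generator `x ⊗ y` of the source of the evaluation map. -/
def esTmul {W X : C} {n : ℤ} (i : ι) {a b : ℤ} (h : a + b = n) :
    Hom k W (E i) a →ₗ[k] Hom k (E i) X b →ₗ[k] EvalSource (k := k) E W X n :=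
  (TensorProduct.mk k _ _).compr₂ (evalSourceIncl E W X i a b h)

lemma es_hom_ext {W X : C} {n : ℤ} {M : Type*} [AddCommGroup M] [Module k M]
    {φ ψ : EvalSource (k := k) E W X n →ₗ[k] M}
    (h : ∀ (i : ι) (p q : ℤ) (hpq : p + q = n) (x : Hom k W (E i) p) (y : Hom k (E i) X q),
      φ (esTmul E i hpq x y) = ψ (esTmul E i hpq x y)) :
    φ = ψ :=
  evalSource_hom_ext E h

lemma es_induction {W X : C} {n : ℤ} {P : EvalSource (k := k) E W X n → Prop}
    (zero : P 0) (add : ∀ u v, P u → P v → P (u + v))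
    (tmul : ∀ (i : ι) (p q : ℤ) (hpq : p + q = n) (x : Hom k W (E i) p) (y : Hom k (E i) X q),
      P (esTmul E i hpq x y)) (u : EvalSource (k := k) E W X n) : P u := by
  induction u using DirectSum.induction_on with
  | zero => exact zero
  | add u v hu hv => exact add u v hu hv
  | of a t =>
    obtain ⟨i, ⟨⟨p, q⟩, hpq⟩⟩ := a
    induction t using TensorProduct.induction_on with
    | zero => rw [map_zero]; exact zero
    | tmul x y => exact tmul i p q hpq x y
    | add s t hs ht => rw [map_add]; exact add _ _ hs ht

lemma evalSourceD_tmul {W X : C} {n m : ℤ} (hn : n + 1 = m) (i : ι) {p q p' q' : ℤ}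
    (h : p + q = n) (hp : p + 1 = p') (hq : q + 1 = q')
    (x : Hom k W (E i) p) (y : Hom k (E i) X q) :
    evalSourceD E W X hn (esTmul E i h x y) =
      esTmul E i (by omega) x (d hq y) + q.negOnePow • esTmul E i (by omega) (d hp x) y := by
  subst hp hq
  exact evalSourceD_incl E W X hn i p q h x y

lemma evalMap_tmul {W X : C} {n m : ℤ} (hn : n = m) (i : ι) {p q : ℤ}
    (h : p + q = n) (x : Hom k W (E i) p) (y : Hom k (E i) X q) :
    evalMap E W X hn (esTmul E i h x y) = comp (h.trans hn) x y :=
  evalMap_incl E W X hn i p q h x y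


lemma toModule_esTmul {W X : C} {n : ℤ} {M : Type*} [AddCommGroup M] [Module k M]
    (φ : ∀ a : ι × {pq : ℤ × ℤ // pq.1 + pq.2 = n},
      Hom k W (E a.1) a.2.1.1 →ₗ[k] Hom k (E a.1) X a.2.1.2 →ₗ[k] M)
    (i : ι) {p q : ℤ} (h : p + q = n) (x : Hom k W (E i) p) (y : Hom k (E i) X q) :
    DirectSum.toModule k _ M (fun a ↦ TensorProduct.lift (φ a)) (esTmul E i h x y) =
      φ (i, ⟨(p, q), h⟩) x y := by
  simp [esTmul, evalSourceIncl]

/-- Precomposition with a morphism of degree `p`. -/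
def esPull {W' W X : C} {p q n : ℤ} (h : p + q = n) :
    Hom k W' W p →ₗ[k] EvalSource (k := k) E W X q →ₗ[k] EvalSource (k := k) E W' X n where
  toFun g := DirectSum.toModule k _ _ fun a ↦ TensorProduct.lift
    (esTmul E a.1 (show p + a.2.1.1 + a.2.1.2 = n by have := a.2.2; omega) ∘ₗ comp rfl g)
  map_add' g g' := es_hom_ext E fun i p q h x y ↦ by simp [toModule_esTmul]
  map_smul' c g := es_hom_ext E fun i p q h x y ↦ by simp [toModule_esTmul]

/-- Postcomposition with a morphism of degree `q`. -/
def esPush {W X X' : C} {p q n : ℤ} (h : p + q = n) :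
    EvalSource (k := k) E W X p →ₗ[k] Hom k X X' q →ₗ[k] EvalSource (k := k) E W X' n :=
  LinearMap.flip
  { toFun f := DirectSum.toModule k _ _ fun a ↦ TensorProduct.lift
      ((esTmul E a.1 (show a.2.1.1 + (a.2.1.2 + q) = n by have := a.2.2; omega)).compl₂
        ((comp rfl).flip f))
    map_add' g g' := es_hom_ext E fun i p q h x y ↦ by simp [toModule_esTmul]
    map_smul' c g := es_hom_ext E fun i p q h x y ↦ by simp [toModule_esTmul] }

lemma esPull_tmul {W' W X : C} {p q n : ℤ} (h : p + q = n) (g : Hom k W' W p)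
    (i : ι) {a b c : ℤ} (hab : a + b = q) (hc : p + a = c)
    (x : Hom k W (E i) a) (y : Hom k (E i) X b) :
    esPull E h g (esTmul E i hab x y) = esTmul E i (by omega) (comp hc g x) y := by
  subst hc
  simp [esPull, toModule_esTmul]

lemma esPush_tmul {W X X' : C} {p q n : ℤ} (h : p + q = n) (f : Hom k X X' q)
    (i : ι) {a b c : ℤ} (hab : a + b = p) (hc : b + q = c)
    (x : Hom k W (E i) a) (y : Hom k (E i) X b) :
    esPush E h (esTmul E i hab x y) f = esTmul E i (by omega) x (comp hc y f) := by
  subst hc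
  simp [esPush, toModule_esTmul]

/-- The sign rule is that of `d_comp`. Together with its counterpart for `esPush`, this supplies the
mixed cases of the Leibniz rule in the glued category. -/
lemma evalSourceD_esPull {W' W X : C} {p q n p' q' m : ℤ} (h : p + q = n) (hp : p + 1 = p')
    (hq : q + 1 = q') (hn : n + 1 = m) (g : Hom k W' W p) (u : EvalSource (k := k) E W X q) :
    evalSourceD E W' X hn (esPull E h g u) =
      esPull E (by omega) g (evalSourceD E W X hq u) +
        q.negOnePow • esPull E (by omega) (d hp g) u := by
  induction u using es_induction with
  | zero => simp
  | add u v hu hv => simp only [map_add, hu, hv, smul_add]; abel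
  | tmul i a b hab x y =>
    have hs : q.negOnePow = b.negOnePow * a.negOnePow := by
      rw [← hab, Int.negOnePow_add, mul_comm]
    rw [esPull_tmul E h g i hab rfl, evalSourceD_tmul E hn i _ rfl rfl, d_comp rfl hp rfl rfl,
      evalSourceD_tmul E hq i hab rfl rfl]
    simp only [map_add, LinearMap.add_apply, map_zsmul_unit, LinearMap.smul_apply]
    rw [esPull_tmul E _ _ i _ rfl, esPull_tmul E _ _ i _ (by omega : p + (a + 1) = p + a + 1),
      esPull_tmul E _ _ i _ (by omega : p' + a = p + a + 1), hs, mul_smul]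
    simp only [smul_add, add_assoc]

lemma evalSourceD_esPush {W X X' : C} {p q n p' q' m : ℤ} (h : p + q = n) (hp : p + 1 = p')
    (hq : q + 1 = q') (hn : n + 1 = m) (u : EvalSource (k := k) E W X p) (f : Hom k X X' q) :
    evalSourceD E W X' hn (esPush E h u f) =
      esPush E (by omega) u (d hq f) +
        q.negOnePow • esPush E (by omega) (evalSourceD E W X hp u) f := by
  induction u using es_induction with
  | zero => simp
  | add u v hu hv => simp only [map_add, LinearMap.add_apply, hu, hv, smul_add]; abel
  | tmul i a b hab x y =>
    have hs : (b + q).negOnePow = q.negOnePow * b.negOnePow := by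
      rw [Int.negOnePow_add, mul_comm]
    rw [esPush_tmul E h f i hab rfl, evalSourceD_tmul E hn i _ rfl rfl, d_comp rfl rfl hq rfl,
      evalSourceD_tmul E hp i hab rfl rfl]
    simp only [map_add, LinearMap.add_apply, map_zsmul_unit, LinearMap.smul_apply]
    rw [esPush_tmul E _ _ i _ (by omega : b + q' = b + q + 1),
      esPush_tmul E _ _ i _ (by omega : b + 1 + q = b + q + 1), esPush_tmul E _ _ i _ rfl, hs, mul_smul]
    simp only [smul_add, add_assoc]

lemma evalMap_esPull {W' W X : C} {p q n q' n' : ℤ} (h : p + q = n) (hq : q = q') (hn : n = n')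
    (g : Hom k W' W p) (u : EvalSource (k := k) E W X q) :
    evalMap E W' X hn (esPull E h g u) = comp (by omega) g (evalMap E W X hq u) := by
  subst hq hn
  induction u using es_induction with
  | zero => simp
  | add u v hu hv => simp only [map_add, hu, hv]
  | tmul i a b hab x y =>
    rw [esPull_tmul E h g i hab rfl, evalMap_tmul, evalMap_tmul, assoc rfl (by omega) (by omega)]

lemma evalMap_esPush {W X X' : C} {p q n p' n' : ℤ} (h : p + q = n) (hp : p = p') (hn : n = n')
    (u : EvalSource (k := k) E W X p) (f : Hom k X X' q) :
    evalMap E W X' hn (esPush E h u f) = comp (by omega) (evalMap E W X hp u) f := by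
  subst hp hn
  induction u using es_induction with
  | zero => simp
  | add u v hu hv => simp only [map_add, LinearMap.add_apply, hu, hv]
  | tmul i a b hab x y =>
    rw [esPush_tmul E h f i hab rfl, evalMap_tmul, evalMap_tmul, assoc (by omega) rfl (by omega)]

lemma esPull_esPull {W'' W' W X : C} {p q r pq qr n : ℤ} (h₁ : p + q = pq) (h₂ : q + r = qr)
    (h : p + q + r = n) (g : Hom k W'' W' p) (f : Hom k W' W q)
    (u : EvalSource (k := k) E W X r) :
    esPull E (show pq + r = n by omega) (comp h₁ g f) u =
      esPull E (by omega) g (esPull E h₂ f u) := by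
  induction u using es_induction with
  | zero => simp
  | add u v hu hv => simp only [map_add, hu, hv]
  | tmul i a b hab x y =>
    rw [esPull_tmul E _ _ i hab rfl, esPull_tmul E _ _ i hab rfl,
      esPull_tmul E _ _ i _ (by omega : p + (q + a) = pq + a), assoc h₁ rfl (by omega)]

lemma esPush_esPush {W X X' X'' : C} {p q r pq qr n : ℤ} (h₁ : p + q = pq) (h₂ : q + r = qr)
    (h : p + q + r = n) (u : EvalSource (k := k) E W X p) (f : Hom k X X' q)
    (g : Hom k X' X'' r) :
    esPush E (show pq + r = n by omega) (esPush E h₁ u f) g =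
      esPush E (by omega) u (comp h₂ f g) := by
  induction u using es_induction with
  | zero => simp
  | add u v hu hv => simp only [map_add, LinearMap.add_apply, hu, hv]
  | tmul i a b hab x y =>
    rw [esPush_tmul E _ _ i hab rfl, esPush_tmul E _ _ i hab rfl,
      esPush_tmul E _ _ i _ (by omega : b + q + r = b + qr), assoc rfl h₂ (by omega)]

lemma esPush_esPull {W' W X X' : C} {p q r pq qr n : ℤ} (h₁ : p + q = pq) (h₂ : q + r = qr)
    (h : p + q + r = n) (g : Hom k W' W p) (u : EvalSource (k := k) E W X q)
    (f : Hom k X X' r) :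
    esPush E (show pq + r = n by omega) (esPull E h₁ g u) f =
      esPull E (by omega) g (esPush E h₂ u f) := by
  induction u using es_induction with
  | zero => simp
  | add u v hu hv => simp only [map_add, LinearMap.add_apply, hu, hv]
  | tmul i a b hab x y =>
    rw [esPull_tmul E _ _ i hab rfl, esPush_tmul E _ _ i _ rfl, esPush_tmul E _ _ i hab rfl,
      esPull_tmul E _ _ i _ rfl]

lemma esPull_one {W X : C} {n : ℤ} (u : EvalSource (k := k) E W X n) :
    esPull E (zero_add n) (one W) u = u := by
  induction u using es_induction with
  | zero => simp
  | add u v hu hv => simp only [map_add, hu, hv]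
  | tmul i a b hab x y => rw [esPull_tmul E _ _ i hab (zero_add a), one_comp]

lemma esPush_one {W X : C} {n : ℤ} (u : EvalSource (k := k) E W X n) :
    esPush E (add_zero n) u (one X) = u := by
  induction u using es_induction with
  | zero => simp
  | add u v hu hv => simp only [map_add, LinearMap.add_apply, hu, hv]
  | tmul i a b hab x y => rw [esPush_tmul E _ _ i hab (add_zero b), comp_one]

/-- Links the graded action to the degree zero action in terms of which twist functors are
characterised. -/
lemma esPull_eq_evalSourcePull {W' W X : C} (g : Hom k W' W 0) {n : ℤ}
    (u : EvalSource (k := k) E W X n) : esPull E (zero_add n) g u = evalSourcePull E X g n u := by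
  induction u using es_induction with
  | zero => simp
  | add u v hu hv => simp only [map_add, hu, hv]
  | tmul i a b hab x y =>
    rw [esPull_tmul E _ _ i hab (zero_add a)]
    exact (evalSourcePull_incl E X g i a b hab x y).symm

lemma esPush_eq_evalSourcePush {W X X' : C} (f : Hom k X X' 0) {n : ℤ}
    (u : EvalSource (k := k) E W X n) : esPush E (add_zero n) u f = evalSourcePush E W f n u := by
  induction u using es_induction with
  | zero => simp
  | add u v hu hv => simp only [map_add, LinearMap.add_apply, hu, hv]
  | tmul i a b hab x y =>
    rw [esPush_tmul E _ _ i hab (add_zero b)]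
    exact (evalSourcePush_incl E W f i a b hab x y).symm

lemma evalSourceD_evalSourceD {W X : C} {n m l : ℤ} (h : n + 1 = m) (h' : m + 1 = l)
    (u : EvalSource (k := k) E W X n) :
    evalSourceD E W X h' (evalSourceD E W X h u) = 0 :=
  LinearMap.congr_fun (evalSourceD_comp_evalSourceD E W X h h') u

lemma evalMap_evalSourceD {W X : C} {n m n' m' : ℤ} (h : n + 1 = m) (hn : n = n') (hm : m = m')
    (u : EvalSource (k := k) E W X n) :
    evalMap E W X hm (evalSourceD E W X h u) = d (by omega) (evalMap E W X hn u) := by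
  subst hn hm
  exact LinearMap.congr_fun (evalMap_comp_evalSourceD E W X h) u

end EvalBimodule

end DGCategory

/-! ### The cone of evaluation as a bimodule, and the triangular dg category -/

namespace DGCategory

section TwistBimodule

variable {k : Type v} [CommRing k] {C : Type u} [DGCategory.{w} k C]
  {ι : Type} [DecidableEq ι] (E : ι → C)

/-- The left action of the dg category on the cone of the evaluation map. -/
def tcPull {W' W X : C} {p q n : ℤ} (h : p + q = n) :
    Hom k W' W p →ₗ[k] TwistCone E k W X q →ₗ[k] TwistCone E k W' X n :=
  LinearMap.mk₂ k (fun g z ↦ (esPull E (by omega) g z.1, comp h g z.2))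
    (fun _ _ _ ↦ by simp) (fun _ _ _ ↦ by simp) (fun _ _ _ ↦ by simp) (fun _ _ _ ↦ by simp)

/-- The right action of the dg category on the cone of the evaluation map. -/
def tcPush {W X X' : C} {p q n : ℤ} (h : p + q = n) :
    TwistCone E k W X p →ₗ[k] Hom k X X' q →ₗ[k] TwistCone E k W X' n :=
  LinearMap.mk₂ k (fun z f ↦ (q.negOnePow • esPush E (by omega) z.1 f, comp h z.2 f))
    (fun _ _ _ ↦ by simp)
    (fun c z f ↦ Prod.ext (by
      simp only [Prod.smul_fst, map_smul, LinearMap.smul_apply]; exact smul_comm _ _ _) (by simp))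
    (fun _ _ _ ↦ by simp)
    (fun c z f ↦ Prod.ext (by
      simp only [Prod.smul_fst, map_smul]; exact smul_comm _ _ _) (by simp))

lemma tcPull_apply {W' W X : C} {p q n : ℤ} (h : p + q = n) (g : Hom k W' W p)
    (u : EvalSource (k := k) E W X (q + 1)) (x : Hom k W X q) :
    tcPull E h g ((u, x) : TwistCone E k W X q) = (esPull E (by omega) g u, comp h g x) := rfl

lemma tcPush_apply {W X X' : C} {p q n : ℤ} (h : p + q = n)
    (u : EvalSource (k := k) E W X (p + 1)) (x : Hom k W X p) (f : Hom k X X' q) :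
    tcPush E h ((u, x) : TwistCone E k W X p) f =
      (q.negOnePow • esPush E (by omega) u f, comp h x f) := rfl

lemma twistConeD_apply {W X : C} {n m : ℤ} (h : n + 1 = m)
    (u : EvalSource (k := k) E W X (n + 1)) (x : Hom k W X n) :
    twistConeD E W X h ((u, x) : TwistCone E k W X n) =
      (-evalSourceD E W X (by omega) u, evalMap E W X h u + d h x) := rfl

lemma twistConeD_tcPull {W' W X : C} {p q n p' q' m : ℤ} (h : p + q = n) (hp : p + 1 = p')
    (hq : q + 1 = q') (hn : n + 1 = m) (g : Hom k W' W p) (z : TwistCone E k W X q) :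
    twistConeD E W' X hn (tcPull E h g z) =
      tcPull E (by omega) g (twistConeD E W X hq z) +
        q.negOnePow • tcPull E (by omega) (d hp g) z := by
  obtain ⟨u, x⟩ := z
  simp only [tcPull_apply, twistConeD_apply]
  refine Prod.ext ?_ ?_
  · simp only [Prod.smul_mk, Prod.mk_add_mk, map_neg]
    rw [evalSourceD_esPull E (by omega) hp (by omega : q + 1 + 1 = q' + 1)
      (by omega : n + 1 + 1 = m + 1), Int.negOnePow_succ, Units.neg_smul]
    abel
  · simp only [Prod.smul_mk, Prod.mk_add_mk, map_add, d_comp h hp hq hn,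
      evalMap_esPull E _ hq]
    abel

/-- The source enters the cone shifted by one, with differential `-d`. This identity forces the sign
`(-1)^q` in `tcPush`; the left action needs no sign. -/
lemma twistConeD_tcPush {W X X' : C} {p q n p' q' m : ℤ} (h : p + q = n) (hp : p + 1 = p')
    (hq : q + 1 = q') (hn : n + 1 = m) (z : TwistCone E k W X p) (f : Hom k X X' q) :
    twistConeD E W X' hn (tcPush E h z f) =
      tcPush E (by omega) z (d hq f) +
        q.negOnePow • tcPush E (by omega) (twistConeD E W X hp z) f := by
  obtain ⟨u, x⟩ := z
  simp only [tcPush_apply, twistConeD_apply]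
  refine Prod.ext ?_ ?_
  · subst hq
    simp only [Prod.smul_mk, Prod.mk_add_mk, map_neg, LinearMap.neg_apply, map_zsmul_unit]
    rw [evalSourceD_esPush E (by omega) (by omega : p + 1 + 1 = p' + 1) rfl
      (by omega : n + 1 + 1 = m + 1), Int.negOnePow_succ, Units.neg_smul]
    simp only [smul_add, smul_neg]
    abel
  · simp only [Prod.smul_mk, Prod.mk_add_mk, map_add, d_comp h hp hq hn, map_zsmul_unit,
      evalMap_esPush E _ hp, LinearMap.add_apply, smul_add]
    abel

/-- Two copies of the objects of a dg category, glued along the cone of the evaluation map. -/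
inductive TwistGlue (E : ι → C)
  | src (X : C)
  | tgt (X : C)

namespace TwistGlue

variable {E}

variable (k) in
/-- The morphisms of the glued dg category. -/
abbrev hom : TwistGlue E → TwistGlue E → ℤ → Type w
  | src W, src X, n => Hom k W X n
  | src W, tgt X, n => TwistCone E k W X n
  | tgt _, src _, _ => PUnit
  | tgt W, tgt X, n => Hom k W X n

@[reducible]
instance (A B : TwistGlue E) (n : ℤ) : AddCommGroup (hom k A B n) :=
  match A, B with
  | src W, src X => inferInstanceAs (AddCommGroup (Hom k W X n))
  | src W, tgt X => inferInstanceAs (AddCommGroup (TwistCone E k W X n))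
  | tgt _, src _ => inferInstanceAs (AddCommGroup PUnit)
  | tgt W, tgt X => inferInstanceAs (AddCommGroup (Hom k W X n))

@[reducible]
instance (A B : TwistGlue E) (n : ℤ) : Module k (hom k A B n) :=
  match A, B with
  | src W, src X => inferInstanceAs (Module k (Hom k W X n))
  | src W, tgt X => inferInstanceAs (Module k (TwistCone E k W X n))
  | tgt _, src _ =>
    { smul := fun _ _ ↦ PUnit.unit
      one_smul := fun _ ↦ rfl
      mul_smul := fun _ _ _ ↦ rfl
      smul_zero := fun _ ↦ rfl
      smul_add := fun _ _ _ ↦ rfl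
      add_smul := fun _ _ _ ↦ rfl
      zero_smul := fun _ ↦ rfl }
  | tgt W, tgt X => inferInstanceAs (Module k (Hom k W X n))

/-- The differential of the glued dg category. -/
def diff : ∀ {A B : TwistGlue E} {n m : ℤ}, n + 1 = m → (hom k A B n →ₗ[k] hom k A B m)
  | src W, src X, _, _, h => d (k := k) (X := W) (Y := X) h
  | src W, tgt X, _, _, h => twistConeD E W X h
  | tgt _, src _, _, _, _ => 0
  | tgt W, tgt X, _, _, h => d (k := k) (X := W) (Y := X) h

/-- The composition of the glued dg category. -/
def mul : ∀ {A B D : TwistGlue E} {p q n : ℤ}, p + q = n →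
    (hom k A B p →ₗ[k] hom k B D q →ₗ[k] hom k A D n)
  | src W, src X, src Y, _, _, _, h => comp (k := k) (X := W) (Y := X) (Z := Y) h
  | src _, src _, tgt _, _, _, _, h => tcPull E h
  | src _, tgt _, tgt _, _, _, _, h => tcPush E h
  | src _, tgt _, src _, _, _, _, _ => 0
  | tgt _, src _, _, _, _, _, _ => 0
  | tgt _, tgt _, src _, _, _, _, _ => 0
  | tgt W, tgt X, tgt Y, _, _, _, h => comp (k := k) (X := W) (Y := X) (Z := Y) h

/-- The axioms with one object in each copy are exactly those of a dg bimodule. Once they hold,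
homotopy classes, their compositions and associativity are available for the two actions on the cone
without separate treatment. -/
instance : DGCategory.{w} k (TwistGlue E) where
  Hom := hom k
  d := diff
  one A := match A with
    | src X => one X
    | tgt X => one X
  comp := mul
  d_d {A B n m l} h h' f := by
    match A, B with
    | src W, src X => exact d_d (k := k) (X := W) (Y := X) h h' f
    | src W, tgt X => exact LinearMap.congr_fun (twistConeD_comp_twistConeD E W X h h') f
    | tgt W, src X => rfl
    | tgt W, tgt X => exact d_d (k := k) (X := W) (Y := X) h h' f
  d_one A m h := by
    match A with
    | src X => exact d_one X h
    | tgt X => exact d_one X h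
  d_comp {A B D p q n p' q' m} h hp hq hn f g := by
    match A, B, D with
    | src W, src X, src Y => exact d_comp (k := k) (X := W) (Y := X) (Z := Y) h hp hq hn f g
    | src W, src X, tgt Y => exact twistConeD_tcPull E h hp hq hn f g
    | src W, tgt X, tgt Y => exact twistConeD_tcPush E h hp hq hn f g
    | src W, tgt X, src Y => simp [mul]
    | tgt W, src X, Y => simp [mul]
    | tgt W, tgt X, src Y => rfl
    | tgt W, tgt X, tgt Y => exact d_comp (k := k) (X := W) (Y := X) (Z := Y) h hp hq hn f g
  one_comp {A B n} f := by
    match A, B with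
    | src W, src X => exact one_comp (k := k) (X := W) (Y := X) f
    | src W, tgt X => exact Prod.ext (esPull_one E f.1) (one_comp f.2)
    | tgt W, src X => rfl
    | tgt W, tgt X => exact one_comp (k := k) (X := W) (Y := X) f
  comp_one {A B n} f := by
    match A, B with
    | src W, src X => exact comp_one (k := k) (X := W) (Y := X) f
    | src W, tgt X =>
      refine Prod.ext ?_ (comp_one f.2)
      exact (one_smul _ _).trans (esPush_one E f.1)
    | tgt W, src X => rfl
    | tgt W, tgt X => exact comp_one (k := k) (X := W) (Y := X) f
  assoc {A B D F p q r pq qr n} h₁ h₂ h f g e := by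
    match A, B, D, F with
    | src W, src X, src Y, src Z =>
      exact assoc (k := k) (W := W) (X := X) (Y := Y) (Z := Z) h₁ h₂ h f g e
    | src W, src X, src Y, tgt Z =>
      exact Prod.ext (esPull_esPull E h₁ (by omega) (by omega) f g e.1) (assoc h₁ h₂ h f g e.2)
    | src W, src X, tgt Y, tgt Z =>
      refine Prod.ext ?_ (assoc h₁ h₂ h f g.2 e)
      change r.negOnePow • esPush E _ (esPull E _ f g.1) e =
        esPull E _ f (r.negOnePow • esPush E _ g.1 e)
      rw [esPush_esPull E (by omega) (by omega : q + 1 + r = qr + 1) (by omega), map_zsmul_unit]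
    | src W, tgt X, tgt Y, tgt Z =>
      refine Prod.ext ?_ (assoc h₁ h₂ h f.2 g e)
      change r.negOnePow • esPush E _ (q.negOnePow • esPush E _ f.1 g) e =
        qr.negOnePow • esPush E _ f.1 (comp h₂ g e)
      subst h₂
      rw [map_zsmul_unit, LinearMap.smul_apply, esPush_esPush E (by omega) rfl (by omega),
        smul_smul, Int.negOnePow_add, mul_comm]
    | tgt W, tgt X, tgt Y, tgt Z =>
      exact assoc (k := k) (W := W) (X := X) (Y := Y) (Z := Z) h₁ h₂ h f g e
    | src W, src X, tgt Y, src Z => simp [mul]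
    | src W, tgt X, src Y, src Z => simp [mul]
    | src W, tgt X, src Y, tgt Z => simp [mul]
    | src W, tgt X, tgt Y, src Z => simp [mul]
    | tgt W, src X, D, F => cases D <;> cases F <;> simp [mul]
    | tgt W, tgt X, src Y, F => cases F <;> simp [mul]
    | tgt W, tgt X, tgt Y, src Z => simp [mul]

end TwistGlue

end TwistBimodule

end DGCategory

/-! ### The Künneth argument over a field -/

lemma LinearMap.exists_generalized_inverse {k V V' : Type*} [Field k] [AddCommGroup V]
    [Module k V] [AddCommGroup V'] [Module k V'] (f : V →ₗ[k] V') :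
    ∃ r : V' →ₗ[k] V, ∀ v, f (r (f v)) = f v := by
  -- The field hypothesis enters here: the surjection onto the range splits, and the splitting
  -- extends to the whole target.
  obtain ⟨s, hs⟩ := f.rangeRestrict.exists_rightInverse_of_surjective f.range_rangeRestrict
  obtain ⟨r, hr⟩ := LinearMap.exists_extend s
  refine ⟨r, fun v ↦ ?_⟩
  have h₁ : r (f v) = s (f.rangeRestrict v) := LinearMap.congr_fun hr (f.rangeRestrict v)
  have h₂ := congrArg Subtype.val (LinearMap.congr_fun hs (f.rangeRestrict v))
  rw [h₁]
  exact h₂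

namespace DGCategory

section Kunneth

variable {k : Type v} [Field k] {C : Type u} [DGCategory.{w} k C]

/-- A generalized inverse of the differential. -/
noncomputable def dInv {X Y : C} {n m : ℤ} (h : n + 1 = m) : Hom k X Y m →ₗ[k] Hom k X Y n :=
  (LinearMap.exists_generalized_inverse (d (k := k) (X := X) (Y := Y) h)).choose

lemma d_dInv_d {X Y : C} {n m : ℤ} (h : n + 1 = m) (f : Hom k X Y n) :
    d h (dInv h (d h f)) = d h f :=
  (LinearMap.exists_generalized_inverse (d (k := k) (X := X) (Y := Y) h)).choose_spec f

/-- A projection onto closed morphisms, homotopic to the identity. -/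
noncomputable def harm (X Y : C) (n : ℤ) : Hom k X Y n →ₗ[k] cocycles k X Y n :=
  LinearMap.codRestrict _
    (LinearMap.id - d (sub_add_cancel n 1) ∘ₗ dInv (sub_add_cancel n 1) - dInv rfl ∘ₗ d rfl)
    fun f ↦ by
      rw [mem_cocycles_iff rfl]
      simp [d_d, d_dInv_d]

lemma harm_apply {X Y : C} {n l m : ℤ} (h : l + 1 = n) (h' : n + 1 = m) (f : Hom k X Y n) :
    (harm X Y n f).1 = f - d h (dInv h f) - dInv h' (d h' f) := by
  obtain rfl : l = n - 1 := by omega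
  subst h'
  rfl

/-- Since `harm` kills coboundaries and preserves the class of a closed morphism, `HH.mk ∘ harm`
extends the class map to all morphisms. Functionals on classes can thus be applied to one factor of
an arbitrary tensor. -/
lemma harm_d {X Y : C} {n m : ℤ} (h : n + 1 = m) (f : Hom k X Y n) : harm X Y m (d h f) = 0 := by
  ext
  rw [harm_apply h rfl, d_dInv_d, d_d]
  simp

lemma harm_closed (X Y : C) {n : ℤ} (f : cocycles k X Y n) :
    HH.mk (harm X Y n f.1) = HH.mk f := by
  rw [HH.mk_eq_mk_iff, harm_apply (sub_add_cancel n 1) rfl, (mem_cocycles_iff rfl _).1 f.2,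
    map_zero, sub_zero, sub_sub_cancel_left]
  exact neg_mem (d_mem_coboundaries _ _)

variable {ι : Type} [DecidableEq ι] (E : ι → C)

variable (k) in
/-- The coboundaries in the source of the evaluation map. -/
def esCoboundaries (W X : C) (n : ℤ) : Submodule k (EvalSource (k := k) E W X n) :=
  LinearMap.range (evalSourceD E W X (sub_add_cancel n 1))

variable {E}

lemma mem_esCoboundaries_iff {W X : C} {n m : ℤ} (h : n + 1 = m)
    (u : EvalSource (k := k) E W X m) :
    u ∈ esCoboundaries k E W X m ↔ ∃ v, evalSourceD E W X h v = u := by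
  obtain rfl : n = m - 1 := by omega
  exact Iff.rfl

/-- If a subspace contains the coboundaries and the products of closed morphisms, then it
contains all closed elements. -/
lemma mem_of_evalSourceD_eq_zero {W X : C} {n m : ℤ} (h : n + 1 = m)
    (P : Submodule k (EvalSource (k := k) E W X n)) (hP : esCoboundaries k E W X n ≤ P)
    (tmul : ∀ (i : ι) (p q : ℤ) (hpq : p + q = n) (x : cocycles k W (E i) p)
      (y : cocycles k (E i) X q), esTmul E i hpq x.1 y.1 ∈ P)
    (u : EvalSource (k := k) E W X n) (hu : evalSourceD E W X h u = 0) : u ∈ P := by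
  -- `PL` and `PR` apply `harm` to one factor; `SL` and `SR` are the homotopies from them to the
  -- identity, given by `dInv` on that factor. The sign in `SL` matches the sign of `dw ⊗ e` in the
  -- differential. Hence a closed `u` equals `PR (PL u)` up to coboundaries, and the latter is a sum
  -- of products of closed morphisms.
  let PL : EvalSource (k := k) E W X n →ₗ[k] EvalSource (k := k) E W X n :=
    DirectSum.toModule k _ _ fun a ↦ TensorProduct.lift
      (esTmul E a.1 a.2.2 ∘ₗ (Submodule.subtype _ ∘ₗ harm _ _ _))
  let PR : EvalSource (k := k) E W X n →ₗ[k] EvalSource (k := k) E W X n :=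
    DirectSum.toModule k _ _ fun a ↦ TensorProduct.lift
      ((esTmul E a.1 a.2.2).compl₂ (Submodule.subtype _ ∘ₗ harm _ _ _))
  let SL : ∀ {n l : ℤ}, l + 1 = n →
      (EvalSource (k := k) E W X n →ₗ[k] EvalSource (k := k) E W X l) := fun {n l} h ↦
    DirectSum.toModule k _ _ fun a ↦ TensorProduct.lift
      (a.2.1.2.negOnePow • (esTmul E a.1 (show (a.2.1.1 - 1) + a.2.1.2 = l by
        have := a.2.2; omega) ∘ₗ dInv (sub_add_cancel _ 1)))
  let SR : ∀ {n l : ℤ}, l + 1 = n →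
      (EvalSource (k := k) E W X n →ₗ[k] EvalSource (k := k) E W X l) := fun {n l} h ↦
    DirectSum.toModule k _ _ fun a ↦ TensorProduct.lift
      ((esTmul E a.1 (show a.2.1.1 + (a.2.1.2 - 1) = l by
        have := a.2.2; omega)).compl₂ (dInv (sub_add_cancel _ 1)))
  have hPL : ∀ (i : ι) {p q : ℤ} (hpq : p + q = n) (x : Hom k W (E i) p) (y : Hom k (E i) X q),
      PL (esTmul E i hpq x y) = esTmul E i hpq (harm _ _ _ x).1 y := fun i p q hpq x y ↦
    toModule_esTmul E _ i hpq x y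
  have hPR : ∀ (i : ι) {p q : ℤ} (hpq : p + q = n) (x : Hom k W (E i) p) (y : Hom k (E i) X q),
      PR (esTmul E i hpq x y) = esTmul E i hpq x (harm _ _ _ y).1 := fun i p q hpq x y ↦
    toModule_esTmul E _ i hpq x y
  have hSL : ∀ {n l : ℤ} (h : l + 1 = n) (i : ι) {p q p' : ℤ} (hpq : p + q = n) (hp : p' + 1 = p)
      (x : Hom k W (E i) p) (y : Hom k (E i) X q),
      SL h (esTmul E i hpq x y) = q.negOnePow • esTmul E i (by omega) (dInv hp x) y :=
    fun {n l} h i p q p' hpq hp x y ↦ by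
      obtain rfl : p' = p - 1 := by omega
      exact toModule_esTmul E _ i hpq x y
  have hSR : ∀ {n l : ℤ} (h : l + 1 = n) (i : ι) {p q q' : ℤ} (hpq : p + q = n) (hq : q' + 1 = q)
      (x : Hom k W (E i) p) (y : Hom k (E i) X q),
      SR h (esTmul E i hpq x y) = esTmul E i (by omega) x (dInv hq y) :=
    fun {n l} h i p q q' hpq hq x y ↦ by
      obtain rfl : q' = q - 1 := by omega
      exact toModule_esTmul E _ i hpq x y
  have hL : ∀ u, u - PL u =
      evalSourceD E W X (sub_add_cancel n 1) (SL (sub_add_cancel n 1) u) +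
        SL h (evalSourceD E W X h u) := fun u ↦ by
    induction u using es_induction with
    | zero => simp
    | add u v hu hv => simp only [map_add, add_sub_add_comm, hu, hv]; abel
    | tmul i p q hpq x y =>
      rw [hPL, hSL (sub_add_cancel n 1) i hpq (sub_add_cancel p 1), map_zsmul_unit,
        evalSourceD_tmul E (sub_add_cancel n 1) i _ (sub_add_cancel p 1) rfl,
        evalSourceD_tmul E h i hpq rfl rfl, map_add, map_zsmul_unit,
        hSL h i _ (sub_add_cancel p 1), hSL h i _ rfl,
        harm_apply (sub_add_cancel p 1) rfl]
      simp only [map_sub, LinearMap.sub_apply, smul_add, smul_smul, Int.units_mul_self,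
        one_smul, Int.negOnePow_succ, Units.neg_smul]
      abel
  have hR : ∀ u, u - PR u =
      evalSourceD E W X (sub_add_cancel n 1) (SR (sub_add_cancel n 1) u) +
        SR h (evalSourceD E W X h u) := fun u ↦ by
    induction u using es_induction with
    | zero => simp
    | add u v hu hv => simp only [map_add, add_sub_add_comm, hu, hv]; abel
    | tmul i p q hpq x y =>
      rw [hPR, hSR (sub_add_cancel n 1) i hpq (sub_add_cancel q 1),
        evalSourceD_tmul E (sub_add_cancel n 1) i _ rfl (sub_add_cancel q 1),
        evalSourceD_tmul E h i hpq rfl rfl, map_add, map_zsmul_unit,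
        hSR h i _ (sub_add_cancel q 1), hSR h i _ rfl,
        harm_apply (sub_add_cancel q 1) rfl]
      obtain ⟨q, rfl⟩ : ∃ q', q = q' + 1 := ⟨q - 1, by omega⟩
      simp only [map_sub, Int.negOnePow_succ, Units.neg_smul, Int.negOnePow_sub,
        Int.negOnePow_one, mul_neg, mul_one, neg_neg]
      abel
  have hLR : ∀ u, PR (PL u) ∈ P := fun u ↦ by
    induction u using es_induction with
    | zero => simp
    | add u v hu hv => simpa only [map_add] using P.add_mem hu hv
    | tmul i p q hpq x y =>
      rw [hPL, hPR]
      exact tmul i p q hpq _ _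
  have h₁ := hL u
  rw [hu, map_zero, add_zero] at h₁
  -- `PL u` differs from `u` by a coboundary, so it is closed and the second homotopy applies to it.
  have hu' : evalSourceD E W X h (PL u) = 0 := by
    have := congrArg (evalSourceD E W X h) h₁
    rwa [map_sub, hu, evalSourceD_evalSourceD, zero_sub, neg_eq_zero] at this
  have h₂ := hR (PL u)
  rw [hu', map_zero, add_zero] at h₂
  have key : u = evalSourceD E W X (sub_add_cancel n 1) (SL (sub_add_cancel n 1) u) +
      (evalSourceD E W X (sub_add_cancel n 1) (SR (sub_add_cancel n 1) (PL u)) + PR (PL u)) := by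
    rw [← h₁, ← h₂]; abel
  rw [key]
  exact P.add_mem (hP ⟨_, rfl⟩) (P.add_mem (hP ⟨_, rfl⟩) (hLR u))

/-- Contraction of the right factor with a functional on homotopy classes. -/
noncomputable def contractRight {W X : C} {i : ι} {m q n : ℤ} (h : m + q = n)
    (φ : HH k (E i) X q →ₗ[k] k) : EvalSource (k := k) E W X n →ₗ[k] Hom k W (E i) m :=
  (TensorProduct.rid k _).toLinearMap ∘ₗ (φ ∘ₗ HH.mk ∘ₗ harm (E i) X q).lTensor _ ∘ₗ
    DirectSum.component k (ι × {pq : ℤ × ℤ // pq.1 + pq.2 = n}) _ (i, ⟨(m, q), h⟩)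

/-- Contraction of the left factor with a functional on homotopy classes. -/
noncomputable def contractLeft {W X : C} {i : ι} {m p n : ℤ} (h : p + m = n)
    (φ : HH k W (E i) p →ₗ[k] k) : EvalSource (k := k) E W X n →ₗ[k] Hom k (E i) X m :=
  (TensorProduct.lid k _).toLinearMap ∘ₗ (φ ∘ₗ HH.mk ∘ₗ harm W (E i) p).rTensor _ ∘ₗ
    DirectSum.component k (ι × {pq : ℤ × ℤ // pq.1 + pq.2 = n}) _ (i, ⟨(p, m), h⟩)

lemma contractRight_tmul {W X : C} {i : ι} {m q n : ℤ} (h : m + q = n)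
    (φ : HH k (E i) X q →ₗ[k] k) (x : Hom k W (E i) m) (y : Hom k (E i) X q) :
    contractRight h φ (esTmul E i h x y) = φ (HH.mk (harm _ _ _ y)) • x := by
  simp [contractRight, esTmul, evalSourceIncl, DirectSum.component.lof_self]

lemma contractLeft_tmul {W X : C} {i : ι} {m p n : ℤ} (h : p + m = n)
    (φ : HH k W (E i) p →ₗ[k] k) (x : Hom k W (E i) p) (y : Hom k (E i) X m) :
    contractLeft h φ (esTmul E i h x y) = φ (HH.mk (harm _ _ _ x)) • y := by
  simp [contractLeft, esTmul, evalSourceIncl, DirectSum.component.lof_self]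

lemma contractRight_tmul_of_ne {W X : C} {i : ι} {m q n : ℤ} (h : m + q = n)
    (φ : HH k (E i) X q →ₗ[k] k) {j : ι} {a b : ℤ} (hab : a + b = n) (hne : ¬(j = i ∧ b = q))
    (x : Hom k W (E j) a) (y : Hom k (E j) X b) :
    contractRight h φ (esTmul E j hab x y) = 0 := by
  have : (j, (⟨(a, b), hab⟩ : {pq : ℤ × ℤ // pq.1 + pq.2 = n})) ≠ (i, ⟨(m, q), h⟩) := by
    simp only [ne_eq, Prod.mk.injEq, Subtype.mk.injEq]
    tauto
  simp [contractRight, esTmul, evalSourceIncl, DirectSum.component.of, this]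

lemma contractLeft_tmul_of_ne {W X : C} {i : ι} {m p n : ℤ} (h : p + m = n)
    (φ : HH k W (E i) p →ₗ[k] k) {j : ι} {a b : ℤ} (hab : a + b = n) (hne : ¬(j = i ∧ a = p))
    (x : Hom k W (E j) a) (y : Hom k (E j) X b) :
    contractLeft h φ (esTmul E j hab x y) = 0 := by
  have : (j, (⟨(a, b), hab⟩ : {pq : ℤ × ℤ // pq.1 + pq.2 = n})) ≠ (i, ⟨(p, m), h⟩) := by
    simp only [ne_eq, Prod.mk.injEq, Subtype.mk.injEq]
    tauto
  simp [contractLeft, esTmul, evalSourceIncl, DirectSum.component.of, this]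

/-- The boundary of `x ⊗ y` has two terms: `harm` annihilates `dy` in the first, and the second
contracts to a multiple of the exact morphism `dx`. -/
lemma contractRight_mem_coboundaries {W X : C} {i : ι} {m q n : ℤ} (h : m + q = n)
    (φ : HH k (E i) X q →ₗ[k] k) {u : EvalSource (k := k) E W X n}
    (hu : u ∈ esCoboundaries k E W X n) : contractRight h φ u ∈ coboundaries k W (E i) m := by
  obtain ⟨v, rfl⟩ := hu
  induction v using es_induction with
  | zero => simp
  | add u v hu hv => simpa only [map_add] using add_mem hu hv
  | tmul j a b hab x y =>
    rw [evalSourceD_tmul E _ j hab rfl rfl, map_add, map_zsmul_unit]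
    refine add_mem ?_ (Submodule.smul_of_tower_mem _ _ ?_)
    · by_cases hne : j = i ∧ b + 1 = q
      · obtain ⟨rfl, rfl⟩ := hne
        obtain rfl : a = m := by omega
        rw [contractRight_tmul, harm_d]
        simp
      · rw [contractRight_tmul_of_ne h φ _ hne]
        exact zero_mem _
    · by_cases hne : j = i ∧ b = q
      · obtain ⟨rfl, rfl⟩ := hne
        obtain rfl : a + 1 = m := by omega
        rw [contractRight_tmul]
        exact Submodule.smul_mem _ _ (d_mem_coboundaries _ _)
      · rw [contractRight_tmul_of_ne h φ _ hne]
        exact zero_mem _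

lemma contractLeft_mem_coboundaries {W X : C} {i : ι} {m p n : ℤ} (h : p + m = n)
    (φ : HH k W (E i) p →ₗ[k] k) {u : EvalSource (k := k) E W X n}
    (hu : u ∈ esCoboundaries k E W X n) : contractLeft h φ u ∈ coboundaries k (E i) X m := by
  obtain ⟨v, rfl⟩ := hu
  induction v using es_induction with
  | zero => simp
  | add u v hu hv => simpa only [map_add] using add_mem hu hv
  | tmul j a b hab x y =>
    rw [evalSourceD_tmul E _ j hab rfl rfl, map_add, map_zsmul_unit]
    refine add_mem ?_ (Submodule.smul_of_tower_mem _ _ ?_)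
    · by_cases hne : j = i ∧ a = p
      · obtain ⟨rfl, rfl⟩ := hne
        obtain rfl : b + 1 = m := by omega
        rw [contractLeft_tmul]
        exact Submodule.smul_mem _ _ (d_mem_coboundaries _ _)
      · rw [contractLeft_tmul_of_ne h φ _ hne]
        exact zero_mem _
    · by_cases hne : j = i ∧ a + 1 = p
      · obtain ⟨rfl, rfl⟩ := hne
        obtain rfl : b = m := by omega
        rw [contractLeft_tmul, harm_d]
        simp
      · rw [contractLeft_tmul_of_ne h φ _ hne]
        exact zero_mem _

lemma esTmul_mem_esCoboundaries_left {W X : C} {n : ℤ} (i : ι) {p q : ℤ} (h : p + q = n)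
    {x : Hom k W (E i) p} {y : Hom k (E i) X q} (hx : x ∈ coboundaries k W (E i) p)
    (hy : y ∈ cocycles k (E i) X q) : esTmul E i h x y ∈ esCoboundaries k E W X n := by
  obtain ⟨x, rfl⟩ := hx
  rw [mem_cocycles_iff rfl] at hy
  refine ⟨q.negOnePow • esTmul E i (by omega) x y, ?_⟩
  rw [map_zsmul_unit, evalSourceD_tmul E _ i _ (sub_add_cancel p 1) rfl, hy, map_zero, zero_add,
    smul_smul, Int.units_mul_self, one_smul]

lemma esTmul_mem_esCoboundaries_right {W X : C} {n : ℤ} (i : ι) {p q : ℤ} (h : p + q = n)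
    {x : Hom k W (E i) p} {y : Hom k (E i) X q} (hx : x ∈ cocycles k W (E i) p)
    (hy : y ∈ coboundaries k (E i) X q) : esTmul E i h x y ∈ esCoboundaries k E W X n := by
  obtain ⟨y, rfl⟩ := hy
  rw [mem_cocycles_iff rfl] at hx
  refine ⟨esTmul E i (by omega) x y, ?_⟩
  rw [evalSourceD_tmul E _ i _ rfl (sub_add_cancel q 1), hx, map_zero, LinearMap.zero_apply,
    smul_zero, add_zero]

end Kunneth

end DGCategory

/-! ### Classes in the source of evaluation, and objects representing them -/

namespace DGCategory

section EvalClasses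

variable {k : Type v} [Field k] {C : Type u} [DGCategory.{w} k C]
  {ι : Type} [DecidableEq ι] {E : ι → C}

/-- The inclusion of homotopy classes into morphisms modulo coboundaries. -/
def HH.incl (X Y : C) (n : ℤ) : HH k X Y n →ₗ[k] Hom k X Y n ⧸ coboundaries k X Y n :=
  Submodule.mapQ _ _ (Submodule.subtype _) le_rfl

/-- Contracting an element that need not be closed only yields a morphism modulo coboundaries;
injectivity brings identities obtained there back to homotopy classes. -/
lemma HH.incl_injective (X Y : C) (n : ℤ) : Function.Injective (HH.incl (k := k) X Y n) := by
  rw [injective_iff_map_eq_zero]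
  intro f hf
  obtain ⟨f, rfl⟩ := HH.mk_surjective f
  rw [HH.mk_eq_zero_iff]
  exact (Submodule.Quotient.mk_eq_zero _).1 hf

variable (k E) in
/-- The elements of the source of the evaluation map, modulo coboundaries. -/
abbrev EvalClasses (W X : C) (n : ℤ) : Type _ :=
  EvalSource (k := k) E W X n ⧸ esCoboundaries k E W X n

/-- The class of `x ⊗ y`, for homotopy classes `x` and `y`. -/
def classTmul {W X : C} {n : ℤ} (i : ι) {p q : ℤ} (h : p + q = n) :
    HH k W (E i) p →ₗ[k] HH k (E i) X q →ₗ[k] EvalClasses k E W X n :=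
  Submodule.liftQ _ (LinearMap.flip (Submodule.liftQ _
      (LinearMap.flip (((esTmul E i h).compl₁₂ (cocycles k W (E i) p).subtype
        (cocycles k (E i) X q).subtype).compr₂ (esCoboundaries k E W X n).mkQ)) fun y hy ↦ by
      ext x
      exact (Submodule.Quotient.mk_eq_zero _).2
        (esTmul_mem_esCoboundaries_right i h x.2 hy))) fun x hx ↦ by
    refine LinearMap.ext fun y ↦ ?_
    obtain ⟨y, rfl⟩ := HH.mk_surjective y
    exact (Submodule.Quotient.mk_eq_zero _).2 (esTmul_mem_esCoboundaries_left i h hx y.2)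

lemma classTmul_mk {W X : C} {n : ℤ} (i : ι) {p q : ℤ} (h : p + q = n)
    (x : cocycles k W (E i) p) (y : cocycles k (E i) X q) :
    classTmul i h (HH.mk x) (HH.mk y) =
      (Submodule.Quotient.mk (esTmul E i h x.1 y.1) : EvalClasses k E W X n) := rfl

/-- The contraction of the right factor, on classes. -/
noncomputable def classContractRight {W X : C} {i : ι} {m q n : ℤ} (h : m + q = n)
    (φ : HH k (E i) X q →ₗ[k] k) :
    EvalClasses k E W X n →ₗ[k] Hom k W (E i) m ⧸ coboundaries k W (E i) m :=
  Submodule.mapQ _ _ (contractRight h φ) fun _ ↦ contractRight_mem_coboundaries h φ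

/-- The contraction of the left factor, on classes. -/
noncomputable def classContractLeft {W X : C} {i : ι} {m p n : ℤ} (h : p + m = n)
    (φ : HH k W (E i) p →ₗ[k] k) :
    EvalClasses k E W X n →ₗ[k] Hom k (E i) X m ⧸ coboundaries k (E i) X m :=
  Submodule.mapQ _ _ (contractLeft h φ) fun _ ↦ contractLeft_mem_coboundaries h φ

lemma classContractRight_tmul {W X : C} {i : ι} {m q n : ℤ} (h : m + q = n)
    (φ : HH k (E i) X q →ₗ[k] k) (x : HH k W (E i) m) (y : HH k (E i) X q) :
    classContractRight h φ (classTmul i h x y) = φ y • HH.incl _ _ _ x := by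
  obtain ⟨x, rfl⟩ := HH.mk_surjective x
  obtain ⟨y, rfl⟩ := HH.mk_surjective y
  refine (congrArg (Submodule.Quotient.mk) (contractRight_tmul h φ x.1 y.1)).trans ?_
  rw [harm_closed]
  rfl

lemma classContractLeft_tmul {W X : C} {i : ι} {m p n : ℤ} (h : p + m = n)
    (φ : HH k W (E i) p →ₗ[k] k) (x : HH k W (E i) p) (y : HH k (E i) X m) :
    classContractLeft h φ (classTmul i h x y) = φ x • HH.incl _ _ _ y := by
  obtain ⟨x, rfl⟩ := HH.mk_surjective x
  obtain ⟨y, rfl⟩ := HH.mk_surjective y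
  refine (congrArg (Submodule.Quotient.mk) (contractLeft_tmul h φ x.1 y.1)).trans ?_
  rw [harm_closed]
  rfl

lemma classContractRight_tmul_of_ne {W X : C} {i : ι} {m q n : ℤ} (h : m + q = n)
    (φ : HH k (E i) X q →ₗ[k] k) {j : ι} {a b : ℤ} (hab : a + b = n) (hne : ¬(j = i ∧ b = q))
    (x : HH k W (E j) a) (y : HH k (E j) X b) :
    classContractRight h φ (classTmul j hab x y) = 0 := by
  obtain ⟨x, rfl⟩ := HH.mk_surjective x
  obtain ⟨y, rfl⟩ := HH.mk_surjective y
  exact congrArg (Submodule.Quotient.mk) (contractRight_tmul_of_ne h φ hab hne x.1 y.1)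

lemma classContractLeft_tmul_of_ne {W X : C} {i : ι} {m p n : ℤ} (h : p + m = n)
    (φ : HH k W (E i) p →ₗ[k] k) {j : ι} {a b : ℤ} (hab : a + b = n) (hne : ¬(j = i ∧ a = p))
    (x : HH k W (E j) a) (y : HH k (E j) X b) :
    classContractLeft h φ (classTmul j hab x y) = 0 := by
  obtain ⟨x, rfl⟩ := HH.mk_surjective x
  obtain ⟨y, rfl⟩ := HH.mk_surjective y
  exact congrArg (Submodule.Quotient.mk) (contractLeft_tmul_of_ne h φ hab hne x.1 y.1)

/-- The classes of closed elements are spanned by the products of homotopy classes. -/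
lemma mk_mem_of_evalSourceD_eq_zero {W X : C} {n m : ℤ} (h : n + 1 = m)
    (P : Submodule k (EvalClasses k E W X n))
    (tmul : ∀ (i : ι) (p q : ℤ) (hpq : p + q = n) (x : HH k W (E i) p)
      (y : HH k (E i) X q), classTmul i hpq x y ∈ P)
    (u : EvalSource (k := k) E W X n) (hu : evalSourceD E W X h u = 0) :
    (Submodule.Quotient.mk u : EvalClasses k E W X n) ∈ P := by
  refine mem_of_evalSourceD_eq_zero h (P.comap (Submodule.mkQ _)) (fun v hv ↦ ?_)
    (fun i p q hpq x y ↦ tmul i p q hpq (HH.mk x) (HH.mk y)) u hu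
  rw [Submodule.mem_comap, Submodule.mkQ_apply, (Submodule.Quotient.mk_eq_zero _).2 hv]
  exact P.zero_mem

/-- `v` exhibits `G` as representing the cohomology of the complexes
`⨁ i, Hom(E i, X) ⊗ Hom(-, E i)`. -/
structure RepresentsRight {G X : C} (v : EvalSource (k := k) E G X 0) : Prop where
  closed : evalSourceD E G X (zero_add 1) v = 0
  surj : ∀ (W : C) (n : ℤ) (u : EvalSource (k := k) E W X n),
    evalSourceD E W X rfl u = 0 → ∃ g : cocycles k W G n,
      u - esPull E (add_zero n) g.1 v ∈ esCoboundaries k E W X n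
  inj : ∀ (W : C) (n : ℤ) (g : cocycles k W G n),
    esPull E (add_zero n) g.1 v ∈ esCoboundaries k E W X n → g.1 ∈ coboundaries k W G n

/-- `v` exhibits `G` as corepresenting the cohomology of the complexes
`⨁ i, Hom(E i, -) ⊗ Hom(W, E i)`. -/
structure RepresentsLeft {W G : C} (v : EvalSource (k := k) E W G 0) : Prop where
  closed : evalSourceD E W G (zero_add 1) v = 0
  surj : ∀ (X : C) (n : ℤ) (u : EvalSource (k := k) E W X n),
    evalSourceD E W X rfl u = 0 → ∃ g : cocycles k G X n,
      u - esPush E (zero_add n) v g.1 ∈ esCoboundaries k E W X n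
  inj : ∀ (X : C) (n : ℤ) (g : cocycles k G X n),
    esPush E (zero_add n) v g.1 ∈ esCoboundaries k E W X n → g.1 ∈ coboundaries k G X n

variable (E) in
/-- `G` is the direct sum of the shifts `Σ^(-q b) E (i b)`, in the homotopy category. -/
structure IsShiftedSum {β : Type} [Fintype β] (i : β → ι) (q : β → ℤ) (G : C)
    (κ : ∀ b, HH k (E (i b)) G (q b)) (ρ : ∀ b, HH k G (E (i b)) (-q b)) : Prop where
  comp_self : ∀ b, HH.comp (add_neg_cancel (q b)) (κ b) (ρ b) = HH.one k (E (i b))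
  comp_of_ne : ∀ b c n (h : q b + -q c = n), b ≠ c → HH.comp h (κ b) (ρ c) = 0
  sum_comp : ∑ b, HH.comp (neg_add_cancel (q b)) (ρ b) (κ b) = HH.one k G

section

variable {β : Type} [Fintype β] {i : β → ι} {q : β → ℤ} {G : C}
  {κ : ∀ b, HH k (E (i b)) G (q b)} {ρ : ∀ b, HH k G (E (i b)) (-q b)}

lemma IsShiftedSum.comp_eq_sum (hG : IsShiftedSum E i q G κ ρ) {W : C} {n : ℤ}
    (g : HH k W G n) :
    g = ∑ b, HH.comp (sub_add_cancel n (q b)) (HH.comp (sub_eq_add_neg n (q b)).symm g (ρ b))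
      (κ b) := by
  conv_lhs => rw [← HH.comp_one g, ← hG.sum_comp, map_sum]
  exact Finset.sum_congr rfl fun b _ ↦ (HH.comp_assoc _ _ (by omega) _ _ _).symm

lemma IsShiftedSum.comp_eq_sum' (hG : IsShiftedSum E i q G κ ρ) {X : C} {n : ℤ}
    (g : HH k G X n) :
    g = ∑ b, HH.comp (show -q b + (q b + n) = n by omega) (ρ b) (HH.comp rfl (κ b) g) := by
  conv_lhs => rw [← HH.one_comp g, ← hG.sum_comp, map_sum, LinearMap.sum_apply]
  exact Finset.sum_congr rfl fun b _ ↦ (HH.comp_assoc _ _ (by omega) _ _ _)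

end

end EvalClasses

end DGCategory

/-! ### Finite sums of shifts of the `E i` represent and corepresent the source -/

namespace DGCategory

section Representing

variable {k : Type v} [Field k] {C : Type u} [DGCategory.{w} k C]
  {ι : Type} [DecidableEq ι] {E : ι → C}

/-- A total basis of the graded vector spaces `HH(E i, X)` and the corresponding sum of shifts
of the objects `E i` represent the source of the evaluation map. -/
lemma representsRight_of_basis {X G : C} {β : Type} [Fintype β] {i : β → ι} {q : β → ℤ}
    {κ : ∀ b, HH k (E (i b)) G (q b)} {ρ : ∀ b, HH k G (E (i b)) (-q b)}
    (hG : IsShiftedSum E i q G κ ρ) (y : ∀ b, HH k (E (i b)) X (q b))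
    (hspan : ∀ (W : C) (n : ℤ) (P : Submodule k (EvalClasses k E W X n)),
      (∀ b p (h : p + q b = n) (x : HH k W (E (i b)) p), classTmul (i b) h x (y b) ∈ P) →
      ∀ j p r (h : p + r = n) (x : HH k W (E j) p) (z : HH k (E j) X r), classTmul j h x z ∈ P)
    (hdual : ∀ b, ∃ φ : HH k (E (i b)) X (q b) →ₗ[k] k, φ (y b) = 1 ∧
      ∀ c, c ≠ b → ∀ (W : C) (n m p : ℤ) (hb : m + q b = n) (hc : p + q c = n)
        (x : HH k W (E (i c)) p),
        classContractRight hb φ (classTmul (i c) hc x (y c)) = 0) :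
    ∃ v : EvalSource (k := k) E G X 0, RepresentsRight v := by
  choose ρ' hρ' using fun b ↦ HH.mk_surjective (ρ b)
  choose y' hy' using fun b ↦ HH.mk_surjective (y b)
  -- `Θ` is the action on classes of `v = ∑ ρ_b ⊗ y_b`, the element that corresponds to the identity
  -- of `G`. It has to be injective with image the closed classes.
  let Θ : ∀ (W : C) (n : ℤ), HH k W G n →ₗ[k] EvalClasses k E W X n := fun W n ↦
    ∑ b, (classTmul (i b) (sub_add_cancel n (q b))).flip (y b) ∘ₗ
      (HH.comp (sub_eq_add_neg n (q b)).symm).flip (ρ b)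
  have hΘ : ∀ W n (g : HH k W G n), Θ W n g = ∑ b, classTmul (i b) (sub_add_cancel n (q b))
      (HH.comp (sub_eq_add_neg n (q b)).symm g (ρ b)) (y b) := fun W n g ↦ by
    simp [Θ, LinearMap.sum_apply]
  let v : EvalSource (k := k) E G X 0 :=
    ∑ b, esTmul E (i b) (neg_add_cancel (q b)) (ρ' b).1 (y' b).1
  have hv : ∀ W n (g : cocycles k W G n),
      (Submodule.Quotient.mk (esPull E (add_zero n) g.1 v) : EvalClasses k E W X n) =
        Θ W n (HH.mk g) := fun W n g ↦ by
    rw [hΘ, map_sum, ← Submodule.mkQ_apply, map_sum]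
    refine Finset.sum_congr rfl fun b _ ↦ ?_
    rw [esPull_tmul E _ _ (i b) _ (sub_eq_add_neg n (q b)).symm, ← hρ', ← hy', HH.comp_mk,
      classTmul_mk]
    rfl
  clear_value Θ
  refine ⟨v, ?_, fun W n u hu ↦ ?_, fun W n g hg ↦ ?_⟩
  · rw [map_sum]
    refine Finset.sum_eq_zero fun b _ ↦ ?_
    rw [evalSourceD_tmul E _ (i b) _ rfl rfl, (mem_cocycles_iff rfl _).1 (ρ' b).2,
      (mem_cocycles_iff rfl _).1 (y' b).2]
    simp
  · obtain ⟨g, hg⟩ := mk_mem_of_evalSourceD_eq_zero rfl (LinearMap.range (Θ W n))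
      (hspan W n _ fun b p h x ↦ by
        -- By the orthogonality relations of `κ` and `ρ`, the class `x` followed by `κ b` is sent to
        -- `x ⊗ y_b`.
        refine ⟨HH.comp h x (κ b), ?_⟩
        obtain rfl : p = n - q b := by omega
        rw [hΘ, Finset.sum_eq_single b]
        · rw [HH.comp_assoc _ (add_neg_cancel (q b)) (by omega), hG.comp_self, HH.comp_one]
        · intro c _ hc
          rw [HH.comp_assoc _ rfl (by omega), hG.comp_of_ne b c _ _ hc.symm]
          simp
        · simp) u hu
    obtain ⟨g, rfl⟩ := HH.mk_surjective g
    refine ⟨g, ?_⟩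
    rw [← Submodule.Quotient.mk_eq_zero, Submodule.Quotient.mk_sub, hv, hg, sub_self]
  · have h0 : Θ W n (HH.mk g) = 0 := by
      rw [← hv]
      exact (Submodule.Quotient.mk_eq_zero _).2 hg
    rw [hΘ] at h0
    -- `g` is determined by its components along the `ρ b`; contracting `Θ g = 0` with the
    -- functional dual to `y b` isolates each of them.
    rw [← HH.mk_eq_zero_iff, hG.comp_eq_sum (HH.mk g)]
    refine Finset.sum_eq_zero fun b _ ↦ ?_
    suffices HH.comp (sub_eq_add_neg n (q b)).symm (HH.mk g) (ρ b) = 0 by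
      rw [this, map_zero, LinearMap.zero_apply]
    apply HH.incl_injective
    rw [map_zero]
    obtain ⟨φ, hφ, hφ'⟩ := hdual b
    have h1 := congrArg (classContractRight (sub_add_cancel n (q b)) φ) h0
    rw [map_sum, map_zero, Finset.sum_eq_single b] at h1
    · rwa [classContractRight_tmul, hφ, one_smul] at h1
    · exact fun c _ hc ↦ hφ' c hc _ _ _ _ _ _ _
    · simp

/-- A total basis of the graded vector spaces `HH(W, E i)` and the corresponding sum of shifts
of the objects `E i` corepresent the source of the evaluation map. -/
lemma representsLeft_of_basis {W G : C} {β : Type} [Fintype β] {i : β → ι} {q : β → ℤ}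
    {κ : ∀ b, HH k (E (i b)) G (q b)} {ρ : ∀ b, HH k G (E (i b)) (-q b)}
    (hG : IsShiftedSum E i q G κ ρ) (x : ∀ b, HH k W (E (i b)) (-q b))
    (hspan : ∀ (X : C) (n : ℤ) (P : Submodule k (EvalClasses k E W X n)),
      (∀ b p (h : -q b + p = n) (z : HH k (E (i b)) X p), classTmul (i b) h (x b) z ∈ P) →
      ∀ j p r (h : p + r = n) (y : HH k W (E j) p) (z : HH k (E j) X r), classTmul j h y z ∈ P)
    (hdual : ∀ b, ∃ φ : HH k W (E (i b)) (-q b) →ₗ[k] k, φ (x b) = 1 ∧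
      ∀ c, c ≠ b → ∀ (X : C) (n m p : ℤ) (hb : -q b + m = n) (hc : -q c + p = n)
        (z : HH k (E (i c)) X p),
        classContractLeft hb φ (classTmul (i c) hc (x c) z) = 0) :
    ∃ v : EvalSource (k := k) E W G 0, RepresentsLeft v := by
  choose κ' hκ' using fun b ↦ HH.mk_surjective (κ b)
  choose x' hx' using fun b ↦ HH.mk_surjective (x b)
  let Θ : ∀ (X : C) (n : ℤ), HH k G X n →ₗ[k] EvalClasses k E W X n := fun X n ↦
    ∑ b, classTmul (i b) (show -q b + (q b + n) = n by omega) (x b) ∘ₗ HH.comp rfl (κ b)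
  have hΘ : ∀ X n (g : HH k G X n), Θ X n g =
      ∑ b, classTmul (i b) (show -q b + (q b + n) = n by omega) (x b) (HH.comp rfl (κ b) g) :=
    fun X n g ↦ by simp [Θ, LinearMap.sum_apply]
  -- The roles of the factors are exchanged: the basis is now on the left, and the inclusions `κ b`
  -- into `G` are on the right.
  let v : EvalSource (k := k) E W G 0 :=
    ∑ b, esTmul E (i b) (neg_add_cancel (q b)) (x' b).1 (κ' b).1
  have hv : ∀ X n (g : cocycles k G X n),
      (Submodule.Quotient.mk (esPush E (zero_add n) v g.1) : EvalClasses k E W X n) =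
        Θ X n (HH.mk g) := fun X n g ↦ by
    rw [hΘ, map_sum, LinearMap.sum_apply, ← Submodule.mkQ_apply, map_sum]
    refine Finset.sum_congr rfl fun b _ ↦ ?_
    rw [esPush_tmul E _ _ (i b) _ rfl, ← hκ', ← hx', HH.comp_mk, classTmul_mk]
    rfl
  clear_value Θ
  refine ⟨v, ?_, fun X n u hu ↦ ?_, fun X n g hg ↦ ?_⟩
  · rw [map_sum]
    refine Finset.sum_eq_zero fun b _ ↦ ?_
    rw [evalSourceD_tmul E _ (i b) _ rfl rfl, (mem_cocycles_iff rfl _).1 (x' b).2,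
      (mem_cocycles_iff rfl _).1 (κ' b).2]
    simp
  · obtain ⟨g, hg⟩ := mk_mem_of_evalSourceD_eq_zero rfl (LinearMap.range (Θ X n))
      (hspan X n _ fun b p h z ↦ by
        obtain rfl : p = q b + n := by omega
        refine ⟨HH.comp (show -q b + (q b + n) = n by omega) (ρ b) z, ?_⟩
        rw [hΘ, Finset.sum_eq_single b]
        · rw [← HH.comp_assoc (add_neg_cancel (q b)) _ (by omega), hG.comp_self, HH.one_comp]
        · intro c _ hc
          rw [← HH.comp_assoc rfl _ (by omega), hG.comp_of_ne c b _ _ hc]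
          simp
        · simp) u hu
    obtain ⟨g, rfl⟩ := HH.mk_surjective g
    refine ⟨g, ?_⟩
    rw [← Submodule.Quotient.mk_eq_zero, Submodule.Quotient.mk_sub, hv, hg, sub_self]
  · have h0 : Θ X n (HH.mk g) = 0 := by
      rw [← hv]
      exact (Submodule.Quotient.mk_eq_zero _).2 hg
    rw [hΘ] at h0
    rw [← HH.mk_eq_zero_iff, hG.comp_eq_sum' (HH.mk g)]
    refine Finset.sum_eq_zero fun b _ ↦ ?_
    suffices HH.comp rfl (κ b) (HH.mk g) = 0 by rw [this, map_zero]
    apply HH.incl_injective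
    rw [map_zero]
    obtain ⟨φ, hφ, hφ'⟩ := hdual b
    have h1 := congrArg (classContractLeft (show -q b + (q b + n) = n by omega) φ) h0
    rw [map_sum, map_zero, Finset.sum_eq_single b] at h1
    · rwa [classContractLeft_tmul, hφ, one_smul] at h1
    · exact fun c _ hc ↦ hφ' c hc _ _ _ _ _ _ _
    · simp

variable (k E) in
/-- All finite direct sums of shifts of the objects `E i` exist in the homotopy category. -/
def HasShiftedSums : Prop :=
  ∀ (β : Type) [Fintype β] (i : β → ι) (q : β → ℤ), ∃ G κ ρ, IsShiftedSum (k := k) E i q G κ ρ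

lemma classContractRight_basis {X : C} {j : ι} {r : ℤ} {σ : Type*}
    (b : Module.Basis σ k (HH k (E j) X r)) {l l' : σ} (hl : l' ≠ l) {W : C} {n m p : ℤ}
    (h : m + r = n) (h' : p + r = n) (x : HH k W (E j) p) :
    classContractRight h (b.coord l) (classTmul j h' x (b l')) = 0 := by
  obtain rfl : m = p := by omega
  rw [classContractRight_tmul, Module.Basis.coord_apply, Module.Basis.repr_self,
    Finsupp.single_eq_of_ne hl.symm, zero_smul]

lemma classContractLeft_basis {W : C} {j : ι} {r : ℤ} {σ : Type*}
    (b : Module.Basis σ k (HH k W (E j) r)) {l l' : σ} (hl : l' ≠ l) {X : C} {n m p : ℤ}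
    (h : r + m = n) (h' : r + p = n) (z : HH k (E j) X p) :
    classContractLeft h (b.coord l) (classTmul j h' (b l') z) = 0 := by
  obtain rfl : m = p := by omega
  rw [classContractLeft_tmul, Module.Basis.coord_apply, Module.Basis.repr_self,
    Finsupp.single_eq_of_ne hl.symm, zero_smul]

theorem exists_representsRight {X : C} (hfin : ∀ i q, Module.Finite k (HH k (E i) X q))
    (F : Finset (ι × ℤ)) (hF : ∀ i q, (i, q) ∉ F → ∀ y : HH k (E i) X q, y = 0)
    (hsum : HasShiftedSums k E) :
    ∃ (G : C) (v : EvalSource (k := k) E G X 0), RepresentsRight v := by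
  -- The summands are indexed by the union of bases of the finitely many graded pieces that can be
  -- nonzero.
  obtain ⟨G, κ, ρ, hG⟩ := hsum (Σ s : F, Fin (Module.finrank k (HH k (E s.1.1) X s.1.2)))
    (fun b ↦ b.1.1.1) (fun b ↦ b.1.1.2)
  refine ⟨G, representsRight_of_basis hG (fun b ↦ Module.finBasis k _ b.2)
    (fun W n P hP j p r h x z ↦ ?_) (fun b ↦ ?_)⟩
  · by_cases hjr : (j, r) ∈ F
    · have hz : z ∈ Submodule.span k (Set.range (Module.finBasis k (HH k (E j) X r))) := by
        rw [Module.Basis.span_eq]; trivial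
      induction hz using Submodule.span_induction with
      | zero => simp
      | add z z' _ _ hz hz' => rw [map_add]; exact add_mem hz hz'
      | smul c z _ hz => rw [map_smul]; exact Submodule.smul_mem _ _ hz
      | mem z hz =>
        obtain ⟨l, rfl⟩ := hz
        exact hP ⟨⟨(j, r), hjr⟩, l⟩ p h x
    · rw [hF j r hjr z, map_zero]
      exact zero_mem _
  · obtain ⟨s, l⟩ := b
    refine ⟨(Module.finBasis k (HH k (E s.1.1) X s.1.2)).coord l, by simp, ?_⟩
    rintro ⟨s', l'⟩ hc W n m p hb hc' x
    by_cases hne : s'.1.1 = s.1.1 ∧ s'.1.2 = s.1.2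
    · obtain rfl : s' = s := Subtype.ext (Prod.ext hne.1 hne.2)
      exact classContractRight_basis (Module.finBasis k (HH k (E s'.1.1) X s'.1.2))
        (fun h ↦ hc (congrArg (Sigma.mk s') h)) hb hc' x
    · exact classContractRight_tmul_of_ne _ _ _ hne _ _

theorem exists_representsLeft {W : C} (hfin : ∀ i q, Module.Finite k (HH k W (E i) q))
    (F : Finset (ι × ℤ)) (hF : ∀ i q, (i, q) ∉ F → ∀ y : HH k W (E i) (-q), y = 0)
    (hsum : HasShiftedSums k E) :
    ∃ (G : C) (v : EvalSource (k := k) E W G 0), RepresentsLeft v := by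
  obtain ⟨G, κ, ρ, hG⟩ := hsum (Σ s : F, Fin (Module.finrank k (HH k W (E s.1.1) (-s.1.2))))
    (fun b ↦ b.1.1.1) (fun b ↦ b.1.1.2)
  refine ⟨G, representsLeft_of_basis hG (fun b ↦ Module.finBasis k _ b.2)
    (fun X n P hP j p r h x z ↦ ?_) (fun b ↦ ?_)⟩
  · obtain ⟨p, rfl⟩ : ∃ p', p = -p' := ⟨-p, by omega⟩
    by_cases hjr : (j, p) ∈ F
    · have hx : x ∈ Submodule.span k (Set.range (Module.finBasis k (HH k W (E j) (-p)))) := by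
        rw [Module.Basis.span_eq]; trivial
      induction hx using Submodule.span_induction with
      | zero => simp
      | add z z' _ _ hz hz' => rw [map_add, LinearMap.add_apply]; exact add_mem hz hz'
      | smul c z _ hz => rw [map_smul, LinearMap.smul_apply]; exact Submodule.smul_mem _ _ hz
      | mem x hx =>
        obtain ⟨l, rfl⟩ := hx
        exact hP ⟨⟨(j, p), hjr⟩, l⟩ r h z
    · rw [hF j p hjr x, map_zero, LinearMap.zero_apply]
      exact zero_mem _
  · obtain ⟨s, l⟩ := b
    refine ⟨(Module.finBasis k (HH k W (E s.1.1) (-s.1.2))).coord l, by simp, ?_⟩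
    rintro ⟨s', l'⟩ hc X n m p hb hc' x
    by_cases hne : s'.1.1 = s.1.1 ∧ -s'.1.2 = -s.1.2
    · obtain rfl : s' = s := Subtype.ext (Prod.ext hne.1 (neg_injective hne.2))
      exact classContractLeft_basis (Module.finBasis k (HH k W (E s'.1.1) (-s'.1.2)))
        (fun h ↦ hc (congrArg (Sigma.mk s') h)) hb hc' x
    · exact classContractLeft_tmul_of_ne _ _ _ hne _ _

end Representing

end DGCategory

/-! ### Universal classes, and representability of the twist -/

namespace DGCategory

namespace TwistGlue

section

variable {k : Type v} [CommRing k] {C : Type u} [DGCategory.{w} k C]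
  {ι : Type} [DecidableEq ι] {E : ι → C}

variable (E) in
/-- The morphisms between objects of the first copy. -/
def srcHom {W X : C} {n : ℤ} : Hom k W X n ≃ₗ[k] Hom k (src W : TwistGlue E) (src X) n :=
  LinearEquiv.refl _ _

variable (E) in
/-- The morphisms between objects of the second copy. -/
def tgtHom {W X : C} {n : ℤ} : Hom k W X n ≃ₗ[k] Hom k (tgt W : TwistGlue E) (tgt X) n :=
  LinearEquiv.refl _ _

/-- The morphisms from the first copy to the second one. -/
def pair {W X : C} {n : ℤ} (u : EvalSource (k := k) E W X (n + 1)) (x : Hom k W X n) :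
    Hom k (src W : TwistGlue E) (tgt X) n :=
  ((u, x) : TwistCone E k W X n)

lemma exists_eq_pair {W X : C} {n : ℤ} (z : Hom k (src W : TwistGlue E) (tgt X) n) :
    ∃ u x, z = pair u x := ⟨_, _, rfl⟩

lemma pair_add {W X : C} {n : ℤ} (u u' : EvalSource (k := k) E W X (n + 1)) (x x' : Hom k W X n) :
    pair u x + pair u' x' = pair (u + u') (x + x') := rfl

lemma pair_sub {W X : C} {n : ℤ} (u u' : EvalSource (k := k) E W X (n + 1)) (x x' : Hom k W X n) :
    pair u x - pair u' x' = pair (u - u') (x - x') := rfl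

lemma pair_inj {W X : C} {n : ℤ} {u u' : EvalSource (k := k) E W X (n + 1)} {x x' : Hom k W X n} :
    pair u x = pair u' x' ↔ u = u' ∧ x = x' := Prod.mk_inj

lemma d_pair {W X : C} {n m : ℤ} (h : n + 1 = m) (u : EvalSource (k := k) E W X (n + 1))
    (x : Hom k W X n) :
    d h (pair u x) = pair (-evalSourceD E W X (by omega) u) (evalMap E W X h u + d h x) := rfl

lemma comp_tgtHom {W X Y : C} {p q n : ℤ} (h : p + q = n) (f : Hom k W X p) (g : Hom k X Y q) :
    comp (Z := tgt Y) h (tgtHom E f) (tgtHom E g) = tgtHom E (comp h f g) := rfl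

lemma srcHom_comp_pair {W' W X : C} {p q n : ℤ} (h : p + q = n) (g : Hom k W' W p)
    (u : EvalSource (k := k) E W X (q + 1)) (x : Hom k W X q) :
    comp (Z := tgt X) h (srcHom E g) (pair u x) = pair (esPull E (by omega) g u) (comp h g x) := rfl

lemma pair_comp_tgtHom {W X X' : C} {p q n : ℤ} (h : p + q = n)
    (u : EvalSource (k := k) E W X (p + 1)) (x : Hom k W X p) (f : Hom k X X' q) :
    comp (Z := tgt X') h (pair u x) (tgtHom E f) = pair (q.negOnePow • esPush E (by omega) u f) (comp h x f) :=
  rfl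

lemma pair_mem_cocycles_iff {W X : C} {n m : ℤ} (h : n + 1 = m)
    (u : EvalSource (k := k) E W X (n + 1)) (x : Hom k W X n) :
    pair u x ∈ cocycles k _ _ n ↔
      evalSourceD E W X (show n + 1 + 1 = m + 1 by omega) u = 0 ∧ evalMap E W X h u + d h x = 0 := by
  rw [mem_cocycles_iff h, d_pair]
  exact Prod.mk_eq_zero.trans (and_congr_left' neg_eq_zero)

lemma pair_mem_coboundaries_iff {W X : C} {n m : ℤ} (h : n + 1 = m)
    (u : EvalSource (k := k) E W X (m + 1)) (x : Hom k W X m) :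
    pair u x ∈ coboundaries k _ _ m ↔ ∃ (u' : EvalSource (k := k) E W X m) (x' : Hom k W X n),
      u = -evalSourceD E W X rfl u' ∧ x = evalMap E W X rfl u' + d h x' := by
  subst h
  rw [mem_coboundaries_iff rfl]
  constructor
  · rintro ⟨z, hz⟩
    obtain ⟨u', x', rfl⟩ := exists_eq_pair z
    rw [d_pair, pair_inj] at hz
    exact ⟨u', x', hz.1.symm, hz.2.symm⟩
  · rintro ⟨u', x', rfl, rfl⟩
    exact ⟨pair u' x', d_pair _ _ _⟩

lemma srcHom_mem_cocycles {W X : C} {n : ℤ} (f : cocycles k W X n) :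
    srcHom E f.1 ∈ cocycles k (src W) (src X) n := f.2

lemma tgtHom_mem_cocycles {W X : C} {n : ℤ} (f : cocycles k W X n) :
    tgtHom E f.1 ∈ cocycles k (tgt W) (tgt X) n := f.2

variable (E) in
/-- The homotopy classes of morphisms between objects of the first copy. -/
def srcHH {W X : C} {n : ℤ} : HH k W X n ≃ₗ[k] HH k (src W : TwistGlue E) (src X) n :=
  LinearEquiv.refl _ _

variable (E) in
/-- The homotopy classes of morphisms between objects of the second copy. -/
def tgtHH {W X : C} {n : ℤ} : HH k W X n ≃ₗ[k] HH k (tgt W : TwistGlue E) (tgt X) n :=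
  LinearEquiv.refl _ _

lemma srcHH_mk {W X : C} {n : ℤ} (f : cocycles k W X n) :
    srcHH E (HH.mk f) = HH.mk ⟨srcHom E f.1, srcHom_mem_cocycles f⟩ := rfl

lemma tgtHH_mk {W X : C} {n : ℤ} (f : cocycles k W X n) :
    tgtHH E (HH.mk f) = HH.mk ⟨tgtHom E f.1, tgtHom_mem_cocycles f⟩ := rfl

lemma srcHH_comp {W X Y : C} {p q n : ℤ} (h : p + q = n) (f : HH k W X p) (g : HH k X Y q) :
    srcHH E (HH.comp h f g) = HH.comp h (srcHH E f) (srcHH E g) := rfl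

lemma tgtHH_comp {W X Y : C} {p q n : ℤ} (h : p + q = n) (f : HH k W X p) (g : HH k X Y q) :
    tgtHH E (HH.comp h f g) = HH.comp h (tgtHH E f) (tgtHH E g) := rfl

lemma srcHH_one (W : C) : srcHH E (HH.one k W) = HH.one k (src W) := rfl

lemma tgtHH_one (W : C) : tgtHH E (HH.one k W) = HH.one k (tgt W) := rfl

/-- Composition with `μ` identifies the functors represented by `Z` and the twist of `X`. -/
def IsUniversal {Z X : C} {m : ℤ} (μ : HH k (src Z : TwistGlue E) (tgt X) m) : Prop :=
  ∀ (W : C) (n l : ℤ) (h : n + m = l), Function.Bijective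
    fun w : HH k W Z n ↦ HH.comp h (srcHH E w) μ

/-- Composition with `ν` identifies the functors corepresented by `Z` and the values of the
twist at `W`. -/
def IsCouniversal {W Z : C} {m : ℤ} (ν : HH k (src W : TwistGlue E) (tgt Z) m) : Prop :=
  ∀ (X : C) (n l : ℤ) (h : m + n = l), Function.Bijective
    fun f : HH k Z X n ↦ HH.comp h ν (tgtHH E f)

lemma isUniversal_of {Z X : C} {m : ℤ} (μ : cocycles k (src Z : TwistGlue E) (tgt X) m)
    (inj : ∀ (W : C) (n l : ℤ) (h : n + m = l) (w : cocycles k W Z n),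
      comp (Z := tgt X) h (srcHom E w.1) μ.1 ∈ coboundaries k _ _ l → w.1 ∈ coboundaries k W Z n)
    (surj : ∀ (W : C) (n l : ℤ) (h : n + m = l) (u : EvalSource (k := k) E W X (l + 1))
      (x : Hom k W X l), pair u x ∈ cocycles k _ _ l → ∃ w : cocycles k W Z n,
        pair u x - comp (Z := tgt X) h (srcHom E w.1) μ.1 ∈ coboundaries k _ _ l) :
    IsUniversal (HH.mk μ) := by
  refine fun W n l h ↦ ⟨?_, ?_⟩
  · refine (injective_iff_map_eq_zero ((HH.comp h).flip (HH.mk μ) ∘ₗ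
      (srcHH E).toLinearMap)).2 fun w hw ↦ ?_
    obtain ⟨w, rfl⟩ := HH.mk_surjective w
    have hw' := (HH.mk_eq_zero_iff (X := (src W : TwistGlue E)) (Y := tgt X)
      ⟨_, comp_mem_cocycles h (srcHom_mem_cocycles w) μ.2⟩).1 hw
    exact (HH.mk_eq_zero_iff w).2 (inj W n l h w hw')
  · intro z
    obtain ⟨⟨z, hz⟩, rfl⟩ := HH.mk_surjective z
    obtain ⟨u, x, rfl⟩ := exists_eq_pair z
    obtain ⟨w, hw⟩ := surj W n l h u x hz
    exact ⟨HH.mk w, ((HH.mk_eq_mk_iff (X := (src W : TwistGlue E)) (Y := tgt X) ⟨_, hz⟩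
      ⟨_, comp_mem_cocycles h (srcHom_mem_cocycles w) μ.2⟩).2 hw).symm⟩

lemma isCouniversal_of {W Z : C} {m : ℤ} (ν : cocycles k (src W : TwistGlue E) (tgt Z) m)
    (inj : ∀ (X : C) (n l : ℤ) (h : m + n = l) (f : cocycles k Z X n),
      comp (Z := tgt X) h ν.1 (tgtHom E f.1) ∈ coboundaries k _ _ l → f.1 ∈ coboundaries k Z X n)
    (surj : ∀ (X : C) (n l : ℤ) (h : m + n = l) (u : EvalSource (k := k) E W X (l + 1))
      (x : Hom k W X l), pair u x ∈ cocycles k _ _ l → ∃ f : cocycles k Z X n,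
        pair u x - comp (Z := tgt X) h ν.1 (tgtHom E f.1) ∈ coboundaries k _ _ l) :
    IsCouniversal (HH.mk ν) := by
  refine fun X n l h ↦ ⟨?_, ?_⟩
  · refine (injective_iff_map_eq_zero (HH.comp h (HH.mk ν) ∘ₗ
      (tgtHH E).toLinearMap)).2 fun f hf ↦ ?_
    obtain ⟨f, rfl⟩ := HH.mk_surjective f
    have hf' := (HH.mk_eq_zero_iff (X := (src W : TwistGlue E)) (Y := tgt X)
      ⟨_, comp_mem_cocycles h ν.2 (tgtHom_mem_cocycles f)⟩).1 hf
    exact (HH.mk_eq_zero_iff f).2 (inj X n l h f hf')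
  · intro z
    obtain ⟨⟨z, hz⟩, rfl⟩ := HH.mk_surjective z
    obtain ⟨u, x, rfl⟩ := exists_eq_pair z
    obtain ⟨f, hf⟩ := surj X n l h u x hz
    exact ⟨HH.mk f, ((HH.mk_eq_mk_iff (X := (src W : TwistGlue E)) (Y := tgt X) ⟨_, hz⟩
      ⟨_, comp_mem_cocycles h ν.2 (tgtHom_mem_cocycles f)⟩).2 hf).symm⟩

end

section

variable {k : Type v} [Field k] {C : Type u} [DGCategory.{w} k C]
  {ι : Type} [DecidableEq ι] {E : ι → C}

/-- Up to coboundaries the first entry of a cocycle of the cone at `(W, X)` is `g` acting on `v`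
with `g : W ⟶ G` closed. Evaluation turns `v` into `γ : G ⟶ X`, so such cocycles amount to cocycles
of the cone of `Hom(W, G) → Hom(W, X)`, which the cone `Z` of `γ` represents. -/
theorem exists_isUniversal {G X : C} {v : EvalSource (k := k) E G X 0} (hv : RepresentsRight v)
    {Z : C} {i : Hom k X Z 0} {p : Hom k Z G 1} (hc : IsCone (evalMap E G X rfl v) i p) :
    ∃ μ : HH k (src Z : TwistGlue E) (tgt X) 0, IsUniversal μ := by
  obtain ⟨j, t, hj, -, -, hsurj, hinj⟩ := hc.exists_homotopies
  set γ := evalMap E G X rfl v with hγ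
  have hγc : γ ∈ cocycles k G X 0 := hc.closed_f
  -- `(α, β)` is the cocycle of the cone of `γ` that corresponds to the identity of `Z`; letting `α`
  -- act on `v` turns it into the universal class.
  obtain ⟨α, β, hα, hαβ, hone⟩ := hsurj Z 0 (one Z) (one_mem_cocycles Z)
  have hev : ∀ {W : C} {n m : ℤ} (h : n = m) (g : Hom k W G n),
      evalMap E W X h (esPull E (add_zero n) g v) = comp (by omega) g γ := fun h g ↦
    evalMap_esPull E _ rfl h g v
  have hDv : ∀ {W : C} {n m : ℤ} (h : n + 1 = m) (g : Hom k W G n),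
      evalSourceD E W X h (esPull E (add_zero n) g v) = esPull E (add_zero m) (d h g) v :=
    fun h g ↦ by
      rw [evalSourceD_esPull E _ h (zero_add 1) h, hv.closed]
      simp
  have hw1 : ∀ {W : C} {n : ℤ} (w : cocycles k W Z n),
      w.1 - (comp (by omega) (comp (show n + (0 + 1) = n + 1 by omega) w.1 α) j +
        comp (add_zero n) (comp (add_zero n) w.1 β) i) ∈ coboundaries k W Z n := fun {W n} w ↦ by
    have := comp_mem_coboundaries_right (add_zero n) w.2 hone
    rwa [map_sub, comp_one, map_add, ← assoc _ _ (by omega), ← assoc (add_zero n) _ (by omega)]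
      at this
  have hwα : ∀ {W : C} {n : ℤ} (w : cocycles k W Z n),
      comp (show n + (0 + 1) = n + 1 by omega) w.1 α ∈ cocycles k W G (n + 1) := fun w ↦
    comp_mem_cocycles _ w.2 ((mem_cocycles_iff rfl _).2 hα)
  have hpull : ∀ {W : C} {n : ℤ} (w : Hom k W Z n),
      esPull E (show n + (0 + 1) = n + 1 by omega) w (esPull E (add_zero (0 + 1)) α v) =
        esPull E (add_zero (n + 1)) (comp (show n + (0 + 1) = n + 1 by omega) w α) v :=
    fun w ↦ (esPull_esPull E _ _ (by omega) w α v).symm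
  have hμ : pair (esPull E (add_zero _) α v) β ∈ cocycles k _ _ 0 := by
    rw [pair_mem_cocycles_iff (zero_add 1)]
    constructor
    · rw [hDv]
      convert LinearMap.map_zero₂ _ _
    · rw [hev]
      exact hαβ
  refine ⟨HH.mk ⟨_, hμ⟩, isUniversal_of _ (fun W n l h w hw ↦ ?_) (fun W n l h u x hux ↦ ?_)⟩
  · obtain rfl : l = n := by omega
    dsimp only at hw
    rw [srcHom_comp_pair, pair_mem_coboundaries_iff (sub_add_cancel l 1), hpull] at hw
    obtain ⟨u', x', hu', hx'⟩ := hw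
    have hcob := hv.inj W _ ⟨_, hwα w⟩ ((mem_esCoboundaries_iff rfl _).2
      ⟨-u', by rw [map_neg]; exact hu'.symm⟩)
    obtain ⟨a', ha'⟩ := (mem_coboundaries_iff rfl _).1 hcob
    -- `u'` is not closed, but becomes so after correction by the primitive `a'` of `w α`. The
    -- cocycle `(w α, w β)` is then the boundary of a pair with first entry `g - a'`, so that `w`,
    -- which it represents, is exact.
    obtain ⟨g, hg⟩ := hv.surj W l (u' + esPull E (add_zero l) a' v) (by
      rw [map_add, hDv, ha', hu']; exact add_neg_cancel _)
    obtain ⟨c, hc'⟩ := (mem_esCoboundaries_iff (sub_add_cancel l 1) _).1 hg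
    have hu : u' = esPull E (add_zero l) (g.1 - a') v + evalSourceD E W X (sub_add_cancel l 1) c := by
      rw [hc', map_sub, LinearMap.sub_apply]; abel
    have hdb : d rfl (g.1 - a') = -comp (show l + (0 + 1) = l + 1 by omega) w.1 α := by
      rw [map_sub, (mem_cocycles_iff rfl _).1 g.2, ha', zero_sub]
    have h1 := d_comp (show l + -1 = l - 1 by omega) rfl (show (-1 : ℤ) + 1 = 0 by omega)
      (sub_add_cancel l 1) (g.1 - a') j
    have h2 := d_comp_closed_right (show l - 1 + 0 = l - 1 by omega) (sub_add_cancel l 1)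
      (sub_add_cancel l 1) (evalMap E W X rfl c + x') hc.closed_i
    rw [hdb, hj] at h1
    rw [map_add (d (X := W) (Y := X) (sub_add_cancel l 1)),
      ← evalMap_evalSourceD E (sub_add_cancel l 1) rfl rfl] at h2
    have hx : comp h w.1 β = comp (add_zero l) (g.1 - a') γ +
        (evalMap E W X rfl (evalSourceD E W X (sub_add_cancel l 1) c) +
          d (sub_add_cancel l 1) x') := by
      rw [hx', hu, map_add, hev, add_assoc]
    have := Submodule.add_mem _ (hw1 w) (Submodule.add_mem _
      (d_mem_coboundaries (sub_add_cancel l 1) (comp (show l + -1 = l - 1 by omega) (g.1 - a') j))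
      (d_mem_coboundaries (sub_add_cancel l 1) (comp (show l - 1 + 0 = l - 1 by omega)
        (evalMap E W X rfl c + x') i)))
    rw [h1, h2, hx, ← assoc (add_zero l) (zero_add 0) (by omega)] at this
    convert this using 1
    simp only [Int.negOnePow_neg, Int.negOnePow_one, Int.negOnePow_zero, Units.neg_smul, one_smul,
      map_neg, LinearMap.neg_apply, map_add, LinearMap.add_apply]
    abel
  · obtain rfl : l = n := by omega
    rw [pair_mem_cocycles_iff rfl] at hux
    obtain ⟨g, hg⟩ := hv.surj W _ u hux.1
    obtain ⟨c, hc'⟩ := (mem_esCoboundaries_iff rfl _).1 hg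
    have hu : u = esPull E (add_zero (l + 1)) g.1 v + evalSourceD E W X rfl c := by
      rw [hc']; abel
    have hgx : comp (add_zero (l + 1)) g.1 γ + d rfl (x + evalMap E W X rfl c) = 0 := by
      rw [map_add, ← hux.2, hu, map_add, hev, evalMap_evalSourceD E rfl rfl]; abel
    -- The preimage is the morphism to `Z` attached to the cocycle `(g, x + ev c)` of the cone of
    -- `γ`.
    have hw : comp (show l + 1 + -1 = l by omega) g.1 j +
        comp (add_zero l) (x + evalMap E W X rfl c) i ∈ cocycles k W Z l := by
      rw [mem_cocycles_iff rfl, map_add, d_comp_closed_left _ (show (-1 : ℤ) + 1 = 0 by omega) _ g.2,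
        hj, d_comp_closed_right _ rfl _ _ hc.closed_i, ← assoc (add_zero _) _ (by omega),
        eq_neg_of_add_eq_zero_left hgx]
      simp
    have hwc := hw1 ⟨_, hw⟩
    have hwa := hwα ⟨_, hw⟩
    have hwp := hpull (comp (show l + 1 + -1 = l by omega) g.1 j +
        comp (add_zero l) (x + evalMap E W X rfl c) i)
    set w := comp (show l + 1 + -1 = l by omega) g.1 j +
        comp (add_zero l) (x + evalMap E W X rfl c) i with hwdef
    dsimp only at hwc hwa
    -- The cocycles `(g, x + ev c)` and `(w α, w β)` both represent `w`, hence differ by a boundary.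
    obtain ⟨a', b', ha', hb'⟩ := hinj W l (g.1 - comp (show l + (0 + 1) = l + 1 by omega) w α)
      (x + evalMap E W X rfl c - comp (add_zero l) w β)
      (by rw [map_sub, (mem_cocycles_iff rfl _).1 g.2, (mem_cocycles_iff rfl _).1 hwa, sub_zero])
      (by
        have h0 : comp (add_zero (l + 1)) (comp (show l + (0 + 1) = l + 1 by omega) w α) γ +
            d rfl (comp (add_zero l) w β) = 0 := by
          rw [d_comp_closed_left _ rfl _ hw, assoc _ (add_zero (0 + 1)) (by omega), ← map_add,
            hαβ, map_zero]
        rw [map_sub, LinearMap.sub_apply, map_sub, sub_add_sub_comm, hgx, h0, sub_zero])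
      (by
        rw [map_sub, LinearMap.sub_apply, map_sub, LinearMap.sub_apply, sub_add_sub_comm]
        exact hwc)
    refine ⟨⟨w, hw⟩, ?_⟩
    dsimp only
    rw [srcHom_comp_pair, hwp, pair_sub, pair_mem_coboundaries_iff (sub_add_cancel l 1)]
    refine ⟨esPull E (add_zero l) a' v - c, b', ?_, ?_⟩
    · rw [map_sub, hDv, ← neg_eq_iff_eq_neg.2 ha', hu]
      simp only [map_neg, map_sub, LinearMap.neg_apply, LinearMap.sub_apply]
      abel
    · rw [map_sub, hev, sub_add_eq_add_sub, ← hb']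
      abel

end

end TwistGlue

end DGCategory

/-! ### Corepresentability of the twist -/

namespace DGCategory

namespace TwistGlue

section

variable {k : Type v} [CommRing k] {C : Type u} [DGCategory.{w} k C]
  {ι : Type} [DecidableEq ι] {E : ι → C}

lemma srcHom_comp_unit {W V : C} {n l : ℤ} (h : n + 0 = l) (w : Hom k W V n) :
    comp (Z := tgt V) h (srcHom E w) (pair 0 (one V)) = pair 0 (comp h w (one V)) := by
  rw [srcHom_comp_pair, map_zero]

lemma unit_comp_tgtHom {V X : C} {n l : ℤ} (h : 0 + n = l) (f : Hom k V X n) :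
    comp (Z := tgt X) h (pair 0 (one V)) (tgtHom E f) = pair 0 (comp h (one V) f) := by
  rw [pair_comp_tgtHom, map_zero, LinearMap.zero_apply, smul_zero]

lemma unit_mem_cocycles (V : C) :
    pair (E := E) (k := k) 0 (one V) ∈ cocycles k (src V) (tgt V) 0 := by
  rw [pair_mem_cocycles_iff (zero_add 1), map_zero, map_zero, zero_add (d _ _)]
  exact ⟨rfl, d_one V _⟩

variable (k E) in
/-- The class of the canonical morphism from an object to its twist. -/
def unit (V : C) : HH k (src V : TwistGlue E) (tgt V) 0 := HH.mk ⟨_, unit_mem_cocycles V⟩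

/-- This is the boundary of `(-c, 0)`. It serves to trade an exact first entry of a cocycle for a
change of the second entry. -/
lemma pair_evalSourceD_mem {W X : C} {n m : ℤ} (h : n + 1 = m) (c : EvalSource (k := k) E W X m)
    (hm : m + 1 = m + 1) :
    pair (evalSourceD E W X hm c) (-evalMap E W X rfl c) ∈ coboundaries k _ _ m :=
  (pair_mem_coboundaries_iff h _ _).2 ⟨-c, 0, by simp, by simp⟩

end

section

variable {k : Type v} [Field k] {C : Type u} [DGCategory.{w} k C]
  {ι : Type} [DecidableEq ι] {E : ι → C}

/-- Dual to `exists_isUniversal`, with `Z` the cone of `γ : W ⟶ G`. Since `IsCone` describes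
morphisms into `Z` only, exactness for morphisms out of `Z` enters through `h₁` and `h₂`, and is
later read off from a distinguished triangle. The corepresenting object is the fibre of `γ`, a shift
of `Z`, whence the degree `-1`. -/
theorem exists_isCouniversal {W G : C} {v : EvalSource (k := k) E W G 0} (hv : RepresentsLeft v)
    {Z : C} {i : Hom k G Z 0} {p : Hom k Z W 1} (hc : IsCone (evalMap E W G rfl v) i p)
    (h₁ : ∀ (X : C) (n m : ℤ) (h : 1 + m = n) (f : cocycles k Z X n),
      comp (zero_add n) i f.1 ∈ coboundaries k G X n →
      ∃ g : cocycles k W X m, f.1 - comp h p g.1 ∈ coboundaries k Z X n)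
    (h₂ : ∀ (X : C) (n : ℤ) (y : cocycles k G X n),
      comp (zero_add n) (evalMap E W G rfl v) y.1 ∈ coboundaries k W X n →
      ∃ f : cocycles k Z X n, y.1 - comp (zero_add n) i f.1 ∈ coboundaries k G X n)
    (h₃ : comp (add_zero 1) p (evalMap E W G rfl v) ∈ coboundaries k Z G 1) :
    ∃ ν : HH k (src W : TwistGlue E) (tgt Z) (-1), IsCouniversal ν := by
  obtain ⟨j, t, hj, ht, hone, -, -⟩ := hc.exists_homotopies
  set γ := evalMap E W G rfl v with hγ
  have hev : ∀ {X : C} {n m : ℤ} (h : n = m) (g : Hom k G X n),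
      evalMap E W X h (esPush E (zero_add n) v g) = comp (by omega) γ g := fun h g ↦
    evalMap_esPush E _ rfl h v g
  have hDv : ∀ {X : C} {n m : ℤ} (h : n + 1 = m) (g : Hom k G X n),
      evalSourceD E W X h (esPush E (zero_add n) v g) = esPush E (zero_add m) v (d h g) :=
    fun h g ↦ by
      rw [evalSourceD_esPush E _ (zero_add 1) h h, hv.closed]
      simp
  -- `v` followed by `i` evaluates to `i ∘ γ`, and the nullhomotopy `j` completes it to a cocycle.
  have hν : pair (esPush E (show (0 : ℤ) + 0 = -1 + 1 by omega) v i) (-j) ∈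
      cocycles k _ _ (-1) := by
    rw [pair_mem_cocycles_iff (show (-1 : ℤ) + 1 = 0 by omega)]
    constructor
    · refine (hDv (zero_add 1) i).trans ?_
      rw [(mem_cocycles_iff (zero_add 1) i).1 hc.closed_i]
      exact LinearMap.map_zero _
    · refine (congrArg (· + d _ (-j)) (hev rfl i)).trans ?_
      rw [map_neg, hj, add_neg_cancel]
  have hνf : ∀ {X : C} {n l : ℤ} (h : -1 + n = l) (f : Hom k Z X n),
      comp (Z := tgt X) h (pair (esPush E (show (0 : ℤ) + 0 = -1 + 1 by omega) v i) (-j))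
        (tgtHom E f) =
      pair (n.negOnePow • esPush E (show 0 + n = l + 1 by omega) v (comp (zero_add n) i f))
        (-comp h j f) := fun {X n l} h f ↦ by
    rw [pair_comp_tgtHom, map_neg, LinearMap.neg_apply]
    congr 2
    exact esPush_esPush E (zero_add 0) (zero_add _) (by omega) v i f
  -- Followed by the connecting morphism `p`, the class `ν` becomes the canonical class `(0, 1)`;
  -- the homotopy is built from `t` and from the relation of `j`, `t` and the identity of `W`.
  have hνp : comp (Z := tgt W) (show -1 + 1 = (0 : ℤ) by omega)
      (pair (esPush E (show (0 : ℤ) + 0 = -1 + 1 by omega) v i) (-j)) (tgtHom E p) -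
        pair 0 (one W) ∈ coboundaries k _ _ 0 := by
    obtain ⟨b, hb⟩ := (mem_coboundaries_iff (show (-1 : ℤ) + 1 = 0 by omega) _).1 hone
    rw [hνf, pair_sub, pair_mem_coboundaries_iff (show (-1 : ℤ) + 1 = 0 by omega)]
    refine ⟨esPush E (zero_add 0) v t, -b, ?_, ?_⟩
    · rw [hDv, ht]
      simp
    · rw [map_neg, hb, hev]
      abel
  have hνg : ∀ {X : C} {n m : ℤ} (h : 1 + m = n) (h' : -1 + n = m) (g : cocycles k W X m),
      comp (Z := tgt X) h' (pair (esPush E (show (0 : ℤ) + 0 = -1 + 1 by omega) v i) (-j))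
        (tgtHom E (comp h p g.1)) - pair 0 g.1 ∈ coboundaries k _ _ m := fun {X n m} h h' g ↦ by
    have := comp_mem_coboundaries_left (zero_add m) hνp (tgtHom_mem_cocycles (E := E) g)
    rw [map_sub, LinearMap.sub_apply, unit_comp_tgtHom, one_comp, assoc _ h (by omega),
      comp_tgtHom] at this
    exact this
  refine ⟨HH.mk ⟨_, hν⟩, isCouniversal_of _ (fun X n l h f hf ↦ ?_)
    (fun X n l h u x hux ↦ ?_)⟩
  · obtain rfl : n = l + 1 := by omega
    dsimp only at hf
    have hf' := hf
    rw [hνf, pair_mem_coboundaries_iff (sub_add_cancel l 1)] at hf'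
    obtain ⟨u', -, hu', -⟩ := hf'
    have hi := hv.inj X _ ⟨comp (zero_add (l + 1)) i f.1, comp_mem_cocycles _ hc.closed_i f.2⟩
      ((mem_esCoboundaries_iff rfl _).2 ⟨-((l + 1).negOnePow • u'), by
        rw [map_neg, map_zsmul_unit, ← neg_eq_iff_eq_neg.2 hu']; simp [smul_smul]⟩)
    obtain ⟨g, hg⟩ := h₁ X _ l (by omega) f hi
    have h4 := comp_mem_coboundaries_right h hν (f := _)
      (show tgtHom E (f.1 - comp (show 1 + l = l + 1 by omega) p g.1) ∈ coboundaries k _ _ _ from hg)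
    have h5 := Submodule.sub_mem _ (Submodule.sub_mem _ hf h4) (hνg (by omega) h g)
    rw [map_sub, map_sub, sub_sub_cancel, sub_sub_cancel,
      pair_mem_coboundaries_iff (sub_add_cancel l 1)] at h5
    obtain ⟨u, x, hu, hx⟩ := h5
    obtain ⟨y, hy⟩ := hv.surj X l u (neg_eq_zero.1 hu.symm)
    obtain ⟨c, hc'⟩ := (mem_esCoboundaries_iff (sub_add_cancel l 1) _).1 hy
    -- As `(0, g)` is exact, `g` factors through `γ` up to homotopy; then `g ∘ p` vanishes because
    -- `γ ∘ p` does.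
    have hg' : g.1 - comp (zero_add l) γ y.1 ∈ coboundaries k W X l := by
      refine (mem_coboundaries_iff (sub_add_cancel l 1) _).2 ⟨evalMap E W X rfl c + x, ?_⟩
      rw [hx, map_add, ← evalMap_evalSourceD E (sub_add_cancel l 1) rfl rfl, hc', map_sub, hev]
      abel
    have h6 := comp_mem_coboundaries_right (show 1 + l = l + 1 by omega) hc.closed_p hg'
    have h7 := comp_mem_coboundaries_left (show 1 + l = l + 1 by omega) h₃ y.2
    rw [map_sub, ← assoc (add_zero 1) _ (by omega)] at h6
    have h8 := Submodule.add_mem _ hg (Submodule.add_mem _ h6 h7)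
    rwa [sub_add_cancel, sub_add_cancel] at h8
  · obtain rfl : n = l + 1 := by omega
    rw [pair_mem_cocycles_iff rfl] at hux
    obtain ⟨y, hy⟩ := hv.surj X _ u hux.1
    obtain ⟨c, hc'⟩ := (mem_esCoboundaries_iff rfl _).1 hy
    have hyc : comp (zero_add (l + 1)) γ y.1 ∈ coboundaries k W X (l + 1) := by
      refine (mem_coboundaries_iff rfl _).2 ⟨-(x + evalMap E W X rfl c), ?_⟩
      rw [map_neg, map_add, ← evalMap_evalSourceD E rfl rfl rfl, hc', map_sub, hev, ← add_sub_assoc,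
        add_comm (d _ x), hux.2, zero_sub, neg_neg]
    obtain ⟨f, hf⟩ := h₂ X _ y hyc
    obtain ⟨b, hb⟩ := (mem_coboundaries_iff rfl _).1 hf
    have hu : u = esPush E (zero_add (l + 1)) v (comp (zero_add (l + 1)) i f.1) +
        evalSourceD E W X rfl (esPush E (zero_add l) v b + c) := by
      rw [map_add, hDv, hb, hc', map_sub]; abel
    -- Subtracting a multiple of `ν` and an exact pair removes the first entry. What is left has the
    -- form `(0, x')`, which is `ν` followed by `x' ∘ p` up to homotopy. The factor `(-1)^(l+1)`
    -- cancels the sign of the right action.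
    have h4 : pair u x - comp (Z := tgt X) h (pair (esPush E (show (0 : ℤ) + 0 = -1 + 1 by omega) v i)
        (-j)) (tgtHom E ((l + 1).negOnePow • f.1)) -
        pair (evalSourceD E W X rfl (esPush E (zero_add l) v b + c))
          (-evalMap E W X rfl (esPush E (zero_add l) v b + c)) =
      pair 0 (x + (l + 1).negOnePow • comp h j f.1 +
        evalMap E W X rfl (esPush E (zero_add l) v b + c)) := by
      rw [hνf, pair_sub, pair_sub, pair_inj]
      constructor
      · nth_rewrite 1 [hu]
        rw [map_zsmul_unit, map_zsmul_unit, smul_smul]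
        simp
      · rw [map_zsmul_unit]
        abel
    have hpc := pair_evalSourceD_mem (sub_add_cancel l 1) (esPush E (zero_add l) v b + c) rfl
    have hfc : (l + 1).negOnePow • f.1 ∈ cocycles k Z X (l + 1) :=
      Submodule.smul_of_tower_mem _ _ f.2
    have h5 : pair u x - comp (Z := tgt X) h (pair (esPush E (show (0 : ℤ) + 0 = -1 + 1 by omega) v i)
        (-j)) (tgtHom E ((l + 1).negOnePow • f.1)) -
        pair (evalSourceD E W X rfl (esPush E (zero_add l) v b + c))
          (-evalMap E W X rfl (esPush E (zero_add l) v b + c)) ∈ cocycles k _ _ l :=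
      Submodule.sub_mem _ (Submodule.sub_mem _ ((pair_mem_cocycles_iff rfl _ _).2 hux)
        (comp_mem_cocycles h hν (tgtHom_mem_cocycles ⟨_, hfc⟩)))
        (coboundaries_le_cocycles _ _ _ hpc)
    rw [h4, pair_mem_cocycles_iff rfl, map_zero, map_zero, zero_add (d _ _),
      ← mem_cocycles_iff rfl] at h5
    refine ⟨⟨_, Submodule.add_mem _ hfc
      (comp_mem_cocycles (show 1 + l = l + 1 by omega) hc.closed_p h5.2)⟩, ?_⟩
    have h6 := Submodule.sub_mem _ hpc (hνg (show 1 + l = l + 1 by omega) h ⟨_, h5.2⟩)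
    dsimp only at h6
    rw [← h4] at h6
    dsimp only
    rw [map_add, map_add]
    convert h6 using 1
    abel

end

end TwistGlue

end DGCategory

/-! ### Twists of orthogonal objects and of members of the cycle -/

namespace DGCategory

namespace TwistGlue

section

variable {k : Type v} [Field k] {C : Type u} [DGCategory.{w} k C]
  {ι : Type} [DecidableEq ι] {E : ι → C}

lemma mem_esCoboundaries_of_forall_eq_zero {W X : C}
    (h0 : ∀ (i : ι) (p q : ℤ) (x : HH k W (E i) p) (y : HH k (E i) X q), x = 0 ∨ y = 0)
    {n m : ℤ} (h : n + 1 = m) (u : EvalSource (k := k) E W X n) (hu : evalSourceD E W X h u = 0) :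
    u ∈ esCoboundaries k E W X n := by
  refine (Submodule.Quotient.mk_eq_zero _).1 ((Submodule.mem_bot k).1
    (mk_mem_of_evalSourceD_eq_zero h ⊥ (fun i p q hpq x y ↦ ?_) u hu))
  rcases h0 i p q x y with rfl | rfl
  · rw [map_zero, LinearMap.zero_apply]; exact zero_mem _
  · rw [map_zero]; exact zero_mem _

lemma mem_coboundaries_of_pair_zero {W X : C}
    (h0 : ∀ (i : ι) (p q : ℤ) (x : HH k W (E i) p) (y : HH k (E i) X q), x = 0 ∨ y = 0)
    {n : ℤ} {x : Hom k W X n} (hx : pair (E := E) 0 x ∈ coboundaries k _ _ n) :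
    x ∈ coboundaries k W X n := by
  rw [pair_mem_coboundaries_iff (sub_add_cancel n 1)] at hx
  obtain ⟨u, x', hu, rfl⟩ := hx
  obtain ⟨c, rfl⟩ := (mem_esCoboundaries_iff (sub_add_cancel n 1) _).1
    (mem_esCoboundaries_of_forall_eq_zero h0 rfl u (neg_eq_zero.1 hu.symm))
  rw [evalMap_evalSourceD E (sub_add_cancel n 1) rfl rfl, ← map_add]
  exact d_mem_coboundaries _ _

lemma exists_pair_sub_mem {W X : C}
    (h0 : ∀ (i : ι) (p q : ℤ) (x : HH k W (E i) p) (y : HH k (E i) X q), x = 0 ∨ y = 0)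
    {n : ℤ} {u : EvalSource (k := k) E W X (n + 1)} {x : Hom k W X n}
    (hux : pair u x ∈ cocycles k _ _ n) :
    ∃ x' : cocycles k W X n, pair u x - pair 0 x'.1 ∈ coboundaries k _ _ n := by
  have hux' := (pair_mem_cocycles_iff rfl _ _).1 hux
  obtain ⟨c, rfl⟩ := (mem_esCoboundaries_iff rfl _).1
    (mem_esCoboundaries_of_forall_eq_zero h0 rfl u hux'.1)
  refine ⟨⟨x + evalMap E W X rfl c, ?_⟩, ?_⟩
  · rw [mem_cocycles_iff rfl, map_add, ← evalMap_evalSourceD E rfl rfl rfl, add_comm (d _ x)]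
    exact hux'.2
  · rw [pair_sub, sub_zero, sub_add_cancel_left]
    exact pair_evalSourceD_mem (sub_add_cancel n 1) c rfl

/-- By the Künneth argument the source is acyclic at every `(W, V)`, so the cone reduces to `Hom(W,
V)`: an object receiving nothing from the family is its own twist. -/
lemma isUniversal_unit {V : C} (h0 : ∀ (i : ι) (q : ℤ) (y : HH k (E i) V q), y = 0) :
    IsUniversal (unit k E V) := by
  refine isUniversal_of _ (fun W n l h w hw ↦ ?_) (fun W n l h u x hux ↦ ?_)
  · obtain rfl : l = n := by omega
    dsimp only at hw
    rw [srcHom_comp_unit, comp_one] at hw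
    exact mem_coboundaries_of_pair_zero (fun i p q x y ↦ Or.inr (h0 i q y)) hw
  · obtain rfl : l = n := by omega
    obtain ⟨x', hx'⟩ := exists_pair_sub_mem (fun i p q x y ↦ Or.inr (h0 i q y)) hux
    refine ⟨x', ?_⟩
    dsimp only
    rwa [srcHom_comp_unit, comp_one]

lemma isCouniversal_unit {V : C} (h0 : ∀ (i : ι) (q : ℤ) (y : HH k V (E i) q), y = 0) :
    IsCouniversal (unit k E V) := by
  refine isCouniversal_of _ (fun X n l h f hf ↦ ?_) (fun X n l h u x hux ↦ ?_)
  · obtain rfl : l = n := by omega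
    dsimp only at hf
    rw [unit_comp_tgtHom, one_comp] at hf
    exact mem_coboundaries_of_pair_zero (fun i p q x y ↦ Or.inl (h0 i p x)) hf
  · obtain rfl : l = n := by omega
    obtain ⟨x', hx'⟩ := exists_pair_sub_mem (fun i p q x y ↦ Or.inl (h0 i p x)) hux
    refine ⟨x', ?_⟩
    dsimp only
    rwa [unit_comp_tgtHom, one_comp]

variable {j₀ j₁ : ι} {K m : ℤ} (hm : m + 1 = K)

variable (E) in
/-- The element `1 ⊗ g - g ⊗ 1` of the kernel of the evaluation map. -/
def commTmul (g : Hom k (E j₀) (E j₁) K) :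
    EvalSource (k := k) E (E j₀) (E j₁) (m + 1) :=
  esTmul E j₀ (show 0 + K = m + 1 by omega) (one (E j₀)) g -
    esTmul E j₁ (show K + 0 = m + 1 by omega) g (one (E j₁))

lemma commTmul_mem_cocycles {g : Hom k (E j₀) (E j₁) K} (hg : g ∈ cocycles k _ _ K) :
    pair (commTmul E hm g) 0 ∈ cocycles k _ _ m := by
  rw [pair_mem_cocycles_iff rfl, commTmul, map_sub, map_sub,
    evalSourceD_tmul E _ _ _ rfl rfl, evalSourceD_tmul E _ _ _ rfl rfl, evalMap_tmul, evalMap_tmul,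
    (mem_cocycles_iff rfl g).1 hg, d_one, d_one, map_zero (d (k := k) _)]
  subst hm
  rw [one_comp, comp_one]
  simp

lemma srcHom_comp_commTmul {W : C} {n l : ℤ} (h : n + m = l) (w : Hom k W (E j₀) n)
    (g : Hom k (E j₀) (E j₁) K) :
    comp (Z := tgt (E j₁)) h (srcHom E w) (pair (commTmul E hm g) 0) =
      pair (esTmul E j₀ (show n + K = l + 1 by omega) w g -
        esTmul E j₁ (add_zero (l + 1)) (comp (by omega) w g) (one (E j₁))) 0 := by
  rw [srcHom_comp_pair, map_zero, commTmul, map_sub, esPull_tmul E _ _ _ _ (add_zero n),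
    esPull_tmul E _ _ _ _ (show n + K = l + 1 by omega), comp_one]

lemma commTmul_comp_tgtHom {X : C} {n l : ℤ} (h : m + n = l) (g : Hom k (E j₀) (E j₁) K)
    (f : Hom k (E j₁) X n) :
    comp (Z := tgt X) h (pair (commTmul E hm g) 0) (tgtHom E f) =
      pair (n.negOnePow • (esTmul E j₀ (zero_add (l + 1)) (one (E j₀)) (comp (by omega) g f) -
        esTmul E j₁ (show K + n = l + 1 by omega) g f)) 0 := by
  rw [pair_comp_tgtHom, map_zero, LinearMap.zero_apply, commTmul, map_sub, LinearMap.sub_apply,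
    esPush_tmul E _ _ _ _ (zero_add n), esPush_tmul E _ _ _ _ (show K + n = l + 1 by omega),
    one_comp]

/-- The cohomology of the source at `(W, E j₁)` consists of the `x ⊗ g` and the `y ⊗ 1`. Evaluation
is bijective on the products `y ⊗ 1`, so the cone retains only the kernel elements `w ⊗ g - wg ⊗ 1`
with `w` in `HH(W, E j₀)`. The functional `φ` recovers `w` from such an element, since it does not
see the terms `y ⊗ 1`. -/
theorem isUniversal_commTmul (g : cocycles k (E j₀) (E j₁) K)
    (hspan : ∀ (W : C) (n : ℤ) (P : Submodule k (EvalClasses k E W (E j₁) n)),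
      (∀ p (h : p + K = n) (x : HH k W (E j₀) p), classTmul j₀ h x (HH.mk g) ∈ P) →
      (∀ x : HH k W (E j₁) n, classTmul j₁ (add_zero n) x (HH.one k (E j₁)) ∈ P) →
      ∀ j p q (h : p + q = n) (x : HH k W (E j) p) (y : HH k (E j) (E j₁) q), classTmul j h x y ∈ P)
    (φ : HH k (E j₀) (E j₁) K →ₗ[k] k) (hφ : φ (HH.mk g) = 1)
    (hφ' : ∀ (W : C) (n l : ℤ) (h : n + K = l) (x : HH k W (E j₁) l),
      classContractRight h φ (classTmul j₁ (add_zero l) x (HH.one k (E j₁))) = 0) :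
    IsUniversal (HH.mk ⟨_, commTmul_mem_cocycles hm g.2⟩) := by
  refine isUniversal_of _ (fun W n l h w hw ↦ ?_) (fun W n l h u x hux ↦ ?_)
  · dsimp only at hw
    rw [srcHom_comp_commTmul, pair_mem_coboundaries_iff (sub_add_cancel l 1)] at hw
    obtain ⟨u', -, hu', -⟩ := hw
    have h1 : classTmul j₀ (show n + K = l + 1 by omega) (HH.mk w) (HH.mk g) -
        classTmul j₁ (add_zero (l + 1)) (HH.comp (by omega) (HH.mk w) (HH.mk g))
          (HH.one k (E j₁)) = 0 :=
      (Submodule.Quotient.mk_eq_zero _).2 ((mem_esCoboundaries_iff rfl _).2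
        ⟨-u', by rw [map_neg]; exact hu'.symm⟩)
    have h2 := congrArg (classContractRight (show n + K = l + 1 by omega) φ) h1
    rw [map_sub, map_zero, hφ', sub_zero, classContractRight_tmul, hφ, one_smul] at h2
    exact (HH.mk_eq_zero_iff w).1 (HH.incl_injective _ _ _ (h2.trans (map_zero _).symm))
  · have hux' := (pair_mem_cocycles_iff rfl _ _).1 hux
    obtain ⟨⟨w₀, w₁⟩, hw⟩ := mk_mem_of_evalSourceD_eq_zero rfl
      (LinearMap.range (((classTmul (E := E) j₀ (show n + K = l + 1 by omega)).flip
        (HH.mk g)).coprod ((classTmul j₁ (add_zero (l + 1))).flip (HH.one k (E j₁)))))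
      (hspan W _ _ (fun p h x ↦ by
        obtain rfl : p = n := by omega
        exact ⟨(x, 0), by simp⟩) (fun x ↦ ⟨(0, x), by simp⟩)) u hux'.1
    obtain ⟨w₀, rfl⟩ := HH.mk_surjective w₀
    obtain ⟨w₁, rfl⟩ := HH.mk_surjective w₁
    have hw' : esTmul E j₀ (show n + K = l + 1 by omega) w₀.1 g.1 +
        esTmul E j₁ (add_zero (l + 1)) w₁.1 (one (E j₁)) - u ∈ esCoboundaries k E W (E j₁) (l + 1) :=
      (Submodule.Quotient.eq _).1 hw
    obtain ⟨c, hc⟩ := (mem_esCoboundaries_iff rfl _).1 hw'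
    have hu : u = esTmul E j₀ (show n + K = l + 1 by omega) w₀.1 g.1 +
        esTmul E j₁ (add_zero (l + 1)) w₁.1 (one (E j₁)) - evalSourceD E W _ rfl c := by
      rw [hc]; abel
    have hcc := pair_evalSourceD_mem (sub_add_cancel l 1) c rfl
    have h3 : pair u x - comp (Z := tgt (E j₁)) h (srcHom E w₀.1) (pair (commTmul E hm g.1) 0) +
        pair (evalSourceD E W _ rfl c) (-evalMap E W _ rfl c) =
        pair (esTmul E j₁ (add_zero (l + 1)) (w₁.1 + comp (show n + K = l + 1 by omega) w₀.1 g.1)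
          (one (E j₁))) (x - evalMap E W _ rfl c) := by
      rw [srcHom_comp_commTmul, pair_sub, pair_add, pair_inj, hu]
      constructor
      · rw [map_add, LinearMap.add_apply]; abel
      · abel
    have h4 := Submodule.add_mem _ (Submodule.sub_mem _ hux (comp_mem_cocycles h
      (srcHom_mem_cocycles w₀) (commTmul_mem_cocycles hm g.2))) (coboundaries_le_cocycles _ _ _ hcc)
    rw [h3, pair_mem_cocycles_iff rfl, evalMap_tmul, comp_one] at h4
    refine ⟨w₀, (Submodule.add_mem_iff_left _ hcc).1 ?_⟩
    dsimp only
    -- The remaining cocycle is `(e ⊗ 1, x')` with `e = -d x'`, which is the boundary of `(x' ⊗ 1,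
    -- 0)`.
    rw [h3, eq_neg_of_add_eq_zero_left h4.2, pair_mem_coboundaries_iff (sub_add_cancel l 1)]
    refine ⟨esTmul E j₁ (add_zero l) (x - evalMap E W _ rfl c) (one (E j₁)), 0, ?_, ?_⟩
    · rw [evalSourceD_tmul E _ _ _ rfl (zero_add 1), d_one]
      simp
    · rw [evalMap_tmul, comp_one, map_zero, add_zero (_ - _)]

theorem isCouniversal_commTmul (g : cocycles k (E j₀) (E j₁) K)
    (hspan : ∀ (X : C) (n : ℤ) (P : Submodule k (EvalClasses k E (E j₀) X n)),
      (∀ p (h : K + p = n) (y : HH k (E j₁) X p), classTmul j₁ h (HH.mk g) y ∈ P) →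
      (∀ y : HH k (E j₀) X n, classTmul j₀ (zero_add n) (HH.one k (E j₀)) y ∈ P) →
      ∀ j p q (h : p + q = n) (x : HH k (E j₀) (E j) p) (y : HH k (E j) X q), classTmul j h x y ∈ P)
    (φ : HH k (E j₀) (E j₁) K →ₗ[k] k) (hφ : φ (HH.mk g) = 1)
    (hφ' : ∀ (X : C) (n l : ℤ) (h : K + n = l) (y : HH k (E j₀) X l),
      classContractLeft h φ (classTmul j₀ (zero_add l) (HH.one k (E j₀)) y) = 0) :
    IsCouniversal (HH.mk ⟨_, commTmul_mem_cocycles hm g.2⟩) := by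
  refine isCouniversal_of _ (fun X n l h f hf ↦ ?_) (fun X n l h u x hux ↦ ?_)
  · dsimp only at hf
    rw [commTmul_comp_tgtHom, pair_mem_coboundaries_iff (sub_add_cancel l 1)] at hf
    obtain ⟨u', -, hu', -⟩ := hf
    have h1 : classTmul j₀ (zero_add (l + 1)) (HH.one k (E j₀))
        (HH.comp (by omega) (HH.mk g) (HH.mk f)) -
        classTmul j₁ (show K + n = l + 1 by omega) (HH.mk g) (HH.mk f) = 0 :=
      (Submodule.Quotient.mk_eq_zero _).2 ((mem_esCoboundaries_iff rfl _).2
        ⟨-(n.negOnePow • u'), by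
          rw [map_neg, map_zsmul_unit, ← neg_eq_iff_eq_neg.2 hu']
          simp [smul_smul]⟩)
    have h2 := congrArg (classContractLeft (show K + n = l + 1 by omega) φ) h1
    rw [map_sub, map_zero, hφ', zero_sub, classContractLeft_tmul, hφ, one_smul, neg_eq_zero] at h2
    exact (HH.mk_eq_zero_iff f).1 (HH.incl_injective _ _ _ (h2.trans (map_zero _).symm))
  · have hux' := (pair_mem_cocycles_iff rfl _ _).1 hux
    obtain ⟨⟨z₁, z₀⟩, hz⟩ := mk_mem_of_evalSourceD_eq_zero rfl
      (LinearMap.range ((classTmul (E := E) j₁ (show K + n = l + 1 by omega)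
        (HH.mk g)).coprod (classTmul j₀ (zero_add (l + 1)) (HH.one k (E j₀)))))
      (hspan X _ _ (fun p h y ↦ by
        obtain rfl : p = n := by omega
        exact ⟨(y, 0), by simp⟩) (fun y ↦ ⟨(0, y), by simp⟩)) u hux'.1
    obtain ⟨z₀, rfl⟩ := HH.mk_surjective z₀
    obtain ⟨z₁, rfl⟩ := HH.mk_surjective z₁
    have hz' : esTmul E j₁ (show K + n = l + 1 by omega) g.1 z₁.1 +
        esTmul E j₀ (zero_add (l + 1)) (one (E j₀)) z₀.1 - u ∈ esCoboundaries k E (E j₀) X (l + 1) :=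
      (Submodule.Quotient.eq _).1 hz
    obtain ⟨c, hc⟩ := (mem_esCoboundaries_iff rfl _).1 hz'
    have hu : u = esTmul E j₁ (show K + n = l + 1 by omega) g.1 z₁.1 +
        esTmul E j₀ (zero_add (l + 1)) (one (E j₀)) z₀.1 - evalSourceD E _ X rfl c := by
      rw [hc]; abel
    have hcc := pair_evalSourceD_mem (sub_add_cancel l 1) c rfl
    -- The minus sign comes from the term `-g ⊗ 1` of `commTmul`, and `(-1)^n` from the right action
    -- on the shifted source.
    have hfc : -(n.negOnePow • z₁.1) ∈ cocycles k (E j₁) X n :=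
      neg_mem (Submodule.smul_of_tower_mem _ _ z₁.2)
    have h3 : pair u x - comp (Z := tgt X) h (pair (commTmul E hm g.1) 0)
          (tgtHom E (-(n.negOnePow • z₁.1))) +
        pair (evalSourceD E _ X rfl c) (-evalMap E _ X rfl c) =
        pair (esTmul E j₀ (zero_add (l + 1)) (one (E j₀))
          (z₀.1 + comp (show K + n = l + 1 by omega) g.1 z₁.1)) (x - evalMap E _ X rfl c) := by
      rw [commTmul_comp_tgtHom, pair_sub, pair_add, pair_inj, hu]
      constructor
      · simp only [map_neg, map_zsmul_unit, smul_sub, smul_neg, smul_smul, Int.units_mul_self,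
          one_smul, map_add]
        abel
      · abel
    have h4 := Submodule.add_mem _ (Submodule.sub_mem _ hux (comp_mem_cocycles h
      (commTmul_mem_cocycles hm g.2) (tgtHom_mem_cocycles ⟨_, hfc⟩)))
      (coboundaries_le_cocycles _ _ _ hcc)
    rw [h3, pair_mem_cocycles_iff rfl, evalMap_tmul, one_comp] at h4
    refine ⟨⟨_, hfc⟩, (Submodule.add_mem_iff_left _ hcc).1 ?_⟩
    dsimp only
    rw [h3, eq_neg_of_add_eq_zero_left h4.2, pair_mem_coboundaries_iff (sub_add_cancel l 1)]
    refine ⟨esTmul E j₀ (zero_add l) (one (E j₀)) (x - evalMap E _ X rfl c), 0, ?_, ?_⟩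
    · rw [evalSourceD_tmul E _ _ _ (zero_add 1) rfl, d_one]
      simp
    · rw [evalMap_tmul, one_comp, map_zero, add_zero (_ - _)]

end

end TwistGlue

end DGCategory

/-! ### Functors on graded morphisms and their compatibility with the shift -/

section ShiftedFunctor

variable {D : Type u₁} [Category.{v₁} D] [HasShift D ℤ]

namespace CategoryTheory.ShiftedHom

lemma isIso_of_comp_eq {X Y : D} {n m : ℤ} (a : ShiftedHom X Y n) (b : ShiftedHom Y X m)
    (h : m + n = 0) (h' : n + m = 0) (hab : a.comp b h = mk₀ 0 rfl (𝟙 X))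
    (hba : b.comp a h' = mk₀ 0 rfl (𝟙 Y)) : IsIso (X := X) (Y := Y⟦n⟧) a := by
  refine isIso_of_yoneda_map_bijective _ fun W ↦ ⟨fun f g hfg ↦ ?_, fun g ↦ ?_⟩
  · dsimp only at hfg
    have key : ∀ f : W ⟶ X, ShiftedHom.comp (X := W) (f ≫ a) b h = mk₀ 0 rfl f := fun f ↦ by
      rw [← mk₀_comp 0 rfl f a, comp_assoc _ _ _ (add_zero n) h (by omega), hab,
        mk₀_comp_mk₀, Category.comp_id]
    exact (homEquiv (0 : ℤ) rfl).injective ((key f).symm.trans ((congrArg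
      (fun z : ShiftedHom W Y n ↦ z.comp b h) hfg).trans (key g)))
  · refine ⟨(homEquiv (0 : ℤ) rfl).symm (ShiftedHom.comp (X := W) g b h), ?_⟩
    dsimp only
    rw [← mk₀_comp 0 rfl _ a]
    change ((homEquiv (0 : ℤ) rfl) ((homEquiv (0 : ℤ) rfl).symm _)).comp _ _ = _
    rw [Equiv.apply_symm_apply, comp_assoc _ _ _ h h' (by omega), hba, comp_mk₀_id]

/-- The identity of `X⟦n⟧`, as a morphism of degree `n`. -/
def shiftSelf (X : D) (n : ℤ) : ShiftedHom (X⟦n⟧) X n := 𝟙 (X⟦n⟧)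

/-- The inverse of `shiftSelf`. -/
noncomputable def shiftSelfInv (X : D) (n : ℤ) : ShiftedHom X (X⟦n⟧) (-n) :=
  (shiftFunctorCompIsoId D n (-n) (add_neg_cancel n)).inv.app X

lemma shiftSelfInv_comp (X : D) (n : ℤ) :
    (shiftSelfInv X n).comp (shiftSelf X n) (add_neg_cancel n) = mk₀ 0 rfl (𝟙 X) := by
  simp [shiftSelf, shiftSelfInv, comp, mk₀, shiftFunctorCompIsoId, shiftFunctorZero']

lemma shiftSelf_comp (X : D) (n : ℤ) :
    (shiftSelf X n).comp (shiftSelfInv X n) (neg_add_cancel n) = mk₀ 0 rfl (𝟙 (X⟦n⟧)) := by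
  simp only [shiftSelf, shiftSelfInv, comp, mk₀, Category.id_comp]
  rw [shift_shiftFunctorCompIsoId_inv_app]
  simp [shiftFunctorCompIsoId, shiftFunctorZero']

end CategoryTheory.ShiftedHom

variable (D) in
/-- A functor on the category of graded morphisms. -/
structure ShiftedFunctor where
  obj : D → D
  map : ∀ {A B : D} {n : ℤ}, ShiftedHom A B n → ShiftedHom (obj A) (obj B) n
  map_id : ∀ A : D, map (ShiftedHom.mk₀ 0 rfl (𝟙 A)) = ShiftedHom.mk₀ (0 : ℤ) rfl (𝟙 (obj A))
  map_comp : ∀ {A B Z : D} {p q n : ℤ} (h : q + p = n) (f : ShiftedHom A B p)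
    (g : ShiftedHom B Z q), map (f.comp g h) = (map f).comp (map g) h

namespace ShiftedFunctor

open ShiftedHom

variable (F : ShiftedFunctor D)

/-- The action on morphisms of degree zero. -/
noncomputable def map₀ {A B : D} (f : A ⟶ B) : F.obj A ⟶ F.obj B :=
  (homEquiv (0 : ℤ) rfl).symm (F.map (mk₀ 0 rfl f))

lemma mk₀_map₀ {A B : D} (f : A ⟶ B) :
    mk₀ 0 rfl (F.map₀ f) = F.map (mk₀ (0 : ℤ) rfl f) :=
  (homEquiv (0 : ℤ) rfl).apply_symm_apply _

/-- The underlying functor in degree zero. -/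
noncomputable def toFunctor : D ⥤ D where
  obj := F.obj
  map f := F.map₀ f
  map_id A := by rw [map₀, F.map_id, Equiv.symm_apply_eq]; rfl
  map_comp f g := by
    refine (homEquiv (0 : ℤ) rfl).injective ?_
    simp only [homEquiv_apply, mk₀_map₀]
    rw [← mk₀_comp_mk₀ f g (zero_add 0) rfl rfl, F.map_comp,
      ← mk₀_comp_mk₀ _ _ (zero_add 0) rfl rfl, mk₀_map₀, mk₀_map₀]

lemma map_precomp {A B Z : D} {n : ℤ} (f : A ⟶ B) (g : ShiftedHom B Z n) :
    F.map (show ShiftedHom A Z n from f ≫ g) = F.map₀ f ≫ F.map g := by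
  rw [← mk₀_comp 0 rfl f g, F.map_comp, ← mk₀_map₀, mk₀_comp]

lemma map_postcomp {A B Z : D} {n : ℤ} (f : ShiftedHom A B n) (g : B ⟶ Z) :
    F.map (show ShiftedHom A Z n from f ≫ g⟦n⟧') = F.map f ≫ (F.map₀ g)⟦n⟧' := by
  rw [← comp_mk₀ f 0 rfl g, F.map_comp, ← mk₀_map₀, comp_mk₀]

/-- The identity of `A⟦n⟧` is an invertible morphism of degree `n` from `A⟦n⟧` to `A`, and functors
on graded morphisms preserve invertibility. This is the source of the commutation with shifts. -/
instance (A : D) (n : ℤ) :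
    IsIso (X := F.obj (A⟦n⟧)) (Y := (F.obj A)⟦n⟧) (F.map (shiftSelf A n)) :=
  isIso_of_comp_eq _ (F.map (shiftSelfInv A n)) (neg_add_cancel n) (add_neg_cancel n)
    (by rw [← F.map_comp, shiftSelf_comp, F.map_id])
    (by rw [← F.map_comp, shiftSelfInv_comp, F.map_id])

/-- The compatibility with the shifts. -/
noncomputable def commShiftIso (n : ℤ) :
    shiftFunctor D n ⋙ F.toFunctor ≅ F.toFunctor ⋙ shiftFunctor D n :=
  NatIso.ofComponents
    (fun A ↦ asIso (X := F.obj (A⟦n⟧)) (Y := (F.obj A)⟦n⟧) (F.map (shiftSelf A n)))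
    (fun {A B} f ↦ by
      change F.map₀ (f⟦n⟧') ≫ F.map (shiftSelf B n) =
        F.map (shiftSelf A n) ≫ (F.map₀ f)⟦n⟧'
      rw [← map_precomp, ← map_postcomp]
      simp [shiftSelf])

lemma commShiftIso_hom_app (n : ℤ) (A : D) :
    (F.commShiftIso n).hom.app A = F.map (shiftSelf A n) := rfl

noncomputable instance : F.toFunctor.CommShift ℤ where
  commShiftIso := F.commShiftIso
  commShiftIso_zero := by
    ext A
    rw [commShiftIso_hom_app, Functor.CommShift.isoZero_hom_app]
    have : shiftSelf A (0 : ℤ) = mk₀ 0 rfl ((shiftFunctorZero D ℤ).hom.app A) := by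
      simp [shiftSelf, mk₀, shiftFunctorZero']
    rw [this, ← mk₀_map₀]
    simp [mk₀, shiftFunctorZero']
    rfl
  commShiftIso_add a b := by
    ext A
    rw [commShiftIso_hom_app, Functor.CommShift.isoAdd_hom_app, commShiftIso_hom_app,
      commShiftIso_hom_app]
    have : shiftSelf A (a + b) = (shiftFunctorAdd D a b).hom.app A ≫
        (shiftSelf (A⟦a⟧) b).comp (shiftSelf A a) rfl := by
      simp [shiftSelf, ShiftedHom.comp, shiftFunctorAdd'_eq_shiftFunctorAdd]
    rw [this]
    refine (F.map_precomp _ _).trans ?_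
    rw [F.map_comp]
    simp [ShiftedHom.comp, shiftFunctorAdd'_eq_shiftFunctorAdd]
    rfl

/-- With this choice of commutation isomorphisms, the graded action is recovered from the degree
zero functor; it identifies the images of connecting morphisms. -/
lemma shiftedHom_map {A B : D} {n : ℤ} (f : ShiftedHom A B n) :
    ShiftedHom.map f F.toFunctor = F.map f := by
  change F.map₀ f ≫ F.map (shiftSelf B n) = F.map f
  rw [← map_precomp]
  simp [shiftSelf]

end ShiftedFunctor

end ShiftedFunctor

/-! ### Graded isomorphisms, exact triangles and Serre forms on homotopy classes -/

namespace DGCategory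

section

variable {k : Type v} [CommRing k] {C : Type u} [DGCategory.{w} k C]

variable (k) in
/-- A graded isomorphism in the homotopy category. -/
structure HH.Iso (X Y : C) (n m : ℤ) where
  hom : HH k X Y n
  inv : HH k Y X m
  add_eq : n + m = 0
  hom_inv : HH.comp add_eq hom inv = HH.one k X
  inv_hom : HH.comp (show m + n = 0 by omega) inv hom = HH.one k Y

namespace HH.Iso

variable {X Y Z : C} {n m : ℤ}

/-- The inverse of a graded isomorphism. -/
def symm (σ : HH.Iso k X Y n m) : HH.Iso k Y X m n where
  hom := σ.inv
  inv := σ.hom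
  add_eq := by have := σ.add_eq; omega
  hom_inv := σ.inv_hom
  inv_hom := σ.hom_inv

lemma hom_inv_comp (σ : HH.Iso k X Y n m) {p q : ℤ} (h : n + p = q) (h' : m + q = p)
    (f : HH k X Z q) : HH.comp h σ.hom (HH.comp h' σ.inv f) = f := by
  rw [← HH.comp_assoc σ.add_eq h' (by omega), σ.hom_inv]
  exact HH.one_comp f

lemma inv_hom_comp (σ : HH.Iso k X Y n m) {p q : ℤ} (h : m + q = p) (h' : n + p = q)
    (f : HH k Y Z p) : HH.comp h σ.inv (HH.comp h' σ.hom f) = f :=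
  σ.symm.hom_inv_comp h h' f

lemma comp_hom_inv (σ : HH.Iso k X Y n m) {p q : ℤ} (h : p + n = q) (h' : q + m = p)
    (f : HH k Z X p) : HH.comp h' (HH.comp h f σ.hom) σ.inv = f := by
  rw [HH.comp_assoc h σ.add_eq (by have := σ.add_eq; omega), σ.hom_inv]
  exact HH.comp_one f

lemma comp_inv_hom (σ : HH.Iso k X Y n m) {p q : ℤ} (h : p + m = q) (h' : q + n = p)
    (f : HH k Z Y p) : HH.comp h' (HH.comp h f σ.inv) σ.hom = f :=
  σ.symm.comp_hom_inv h h' f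

lemma precomp_bijective (σ : HH.Iso k X Y n m) {p q : ℤ} (h : n + p = q) :
    Function.Bijective (fun f : HH k Y Z p ↦ HH.comp h σ.hom f) := by
  have := σ.add_eq
  exact Function.bijective_iff_has_inverse.2 ⟨fun f ↦ HH.comp (show m + q = p by omega) σ.inv f,
    fun f ↦ σ.inv_hom_comp _ _ f, fun f ↦ σ.hom_inv_comp _ _ f⟩

lemma postcomp_bijective (σ : HH.Iso k X Y n m) {p q : ℤ} (h : p + n = q) :
    Function.Bijective (fun f : HH k Z X p ↦ HH.comp h f σ.hom) := by
  have := σ.add_eq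
  exact Function.bijective_iff_has_inverse.2 ⟨fun f ↦ HH.comp (show q + m = p by omega) f σ.inv,
    fun f ↦ σ.comp_hom_inv _ _ f, fun f ↦ σ.comp_inv_hom _ _ f⟩

end HH.Iso

/-- The long exact sequences attached to a triangle in the homotopy category. -/
structure IsExactTriangle {X Y Q : C} (f : HH k X Y 0) (i : HH k Y Q 0) (p : HH k Q X 1) :
    Prop where
  comp₁₂ : HH.comp (zero_add 0) f i = 0
  comp₂₃ : HH.comp (zero_add 1) i p = 0
  comp₃₁ : HH.comp (add_zero 1) p f = 0
  exact₂ : ∀ (W : C) (n : ℤ) (w : HH k W Y n), HH.comp (add_zero n) w i = 0 →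
    ∃ v, HH.comp (add_zero n) v f = w
  exact₃ : ∀ (W : C) (n m : ℤ) (h : n + 1 = m) (w : HH k W Q n), HH.comp h w p = 0 →
    ∃ v, HH.comp (add_zero n) v i = w
  exact₁ : ∀ (W : C) (n m : ℤ) (h : m + 1 = n) (w : HH k W X n), HH.comp (add_zero n) w f = 0 →
    ∃ v, HH.comp h v p = w

namespace IsExactTriangle

variable {X Y Q : C} {f : HH k X Y 0} {i : HH k Y Q 0} {p : HH k Q X 1}

/-- In the long exact sequence, degree `n` of `Q` lies between degree `n` of `Y` and degree `n + 1`
of `X`, so bijectivity is needed in two consecutive degrees. -/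
lemma eq_zero_of_bijective (T : IsExactTriangle f i p) {W : C}
    (h : ∀ n, Function.Bijective fun v : HH k W X n ↦ HH.comp (add_zero n) v f)
    {n : ℤ} (w : HH k W Q n) : w = 0 := by
  have h1 : HH.comp rfl w p = 0 := (h (n + 1)).1 (by
    dsimp only
    rw [HH.comp_assoc rfl (add_zero 1) (by omega), T.comp₃₁]
    simp)
  obtain ⟨v, rfl⟩ := T.exact₃ W n _ rfl w h1
  obtain ⟨v, rfl⟩ := (h n).2 v
  dsimp only
  rw [HH.comp_assoc _ (zero_add 0) (by omega), T.comp₁₂, map_zero]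

lemma exists_iso (T : IsExactTriangle f i p) (hQ : HH.one k Q = 0) :
    ∃ σ : HH.Iso k X Y 0 0, σ.hom = f := by
  have h0 : ∀ (W : C) (n : ℤ) (w : HH k W Q n), w = 0 := fun W n w ↦ by
    rw [← HH.comp_one w, hQ, map_zero]
  obtain ⟨g, hg⟩ := T.exact₂ Y 0 (HH.one k Y) (h0 _ _ _)
  refine ⟨⟨f, g, rfl, ?_, hg⟩, rfl⟩
  rw [← sub_eq_zero]
  obtain ⟨v, hv⟩ := T.exact₁ X 0 (-1) (by omega) (HH.comp (zero_add 0) f g - HH.one k X) (by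
    rw [map_sub, LinearMap.sub_apply, HH.comp_assoc _ (zero_add 0) (by omega), hg, HH.comp_one,
      HH.one_comp, sub_self])
  rw [← hv, h0 _ _ v, map_zero, LinearMap.zero_apply]

end IsExactTriangle

/-- A linear form `lam` exhibiting `Y` as a shift of the value at `X` of a Serre functor. -/
def IsSerreDual {X Y : C} {d : ℤ} (lam : HH k X Y d →ₗ[k] k) : Prop :=
  ∀ (Z : C) (n m : ℤ) (h : n + m = d),
    (Function.Bijective fun e : HH k Z Y m ↦ lam ∘ₗ (HH.comp h).flip e) ∧
      Function.Bijective fun u : HH k X Z n ↦ lam ∘ₗ HH.comp h u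

lemma IsSerreDual.comp_iso {X Y Y' : C} {d a b d' : ℤ} {lam : HH k X Y d →ₗ[k] k}
    (hlam : IsSerreDual lam) (σ : HH.Iso k Y Y' a b) (h : d' + b = d) :
    IsSerreDual (lam ∘ₗ (HH.comp h).flip σ.inv) := fun Z n m hm ↦ by
  have hab := σ.add_eq
  have key : ∀ (u : HH k X Z n) (e : HH k Z Y' m), HH.comp h (HH.comp hm u e) σ.inv =
      HH.comp (show n + (m + b) = d by omega) u (HH.comp rfl e σ.inv) := fun u e ↦
    HH.comp_assoc hm rfl (by omega) u e σ.inv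
  constructor
  · have := (hlam Z n (m + b) (by omega)).1.comp
      (σ.symm.postcomp_bijective (Z := Z) (show m + b = m + b from rfl))
    convert this using 1
    funext e
    exact LinearMap.ext fun u ↦ congrArg lam (key u e)
  · let ε := LinearEquiv.ofBijective ((HH.comp (show m + b = m + b from rfl)).flip σ.inv)
      (σ.symm.postcomp_bijective (Z := Z) rfl)
    have := (LinearEquiv.dualMap ε).bijective.comp (hlam Z n (m + b) (by omega)).2
    convert this using 1
    funext u
    exact LinearMap.ext fun e ↦ congrArg lam (key u e)

end

end DGCategory

/-! ### Transfer between the triangulated category and its enhancement -/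

namespace CategoryTheory.ShiftedHom

variable {D : Type u₁} [Category.{v₁} D] [HasShift D ℤ]

lemma comp_shiftSelfInv_comp {A B Z : D} {n : ℤ} (p : ShiftedHom A B n) (g : B⟦n⟧ ⟶ Z) :
    p.comp ((shiftSelfInv B n).comp (mk₀ 0 rfl g) (zero_add _)) (neg_add_cancel n) =
      mk₀ 0 rfl (show A ⟶ Z from p ≫ g) := by
  have hp : p = (mk₀ 0 rfl (show A ⟶ B⟦n⟧ from p)).comp (shiftSelf B n) (add_zero n) := by
    rw [mk₀_comp]
    exact (Category.comp_id p).symm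
  conv_lhs => rw [hp]
  rw [comp_assoc _ _ _ _ (neg_add_cancel n) (by omega),
    ← comp_assoc _ _ _ (neg_add_cancel n) _ (by omega), shiftSelf_comp, mk₀_comp_mk₀, mk₀_comp_mk₀,
    Category.id_comp]

lemma shiftSelfInv_comp_comp {A B : D} {n : ℤ} (p : B⟦n⟧ ⟶ A) (g : ShiftedHom A B n) :
    ((shiftSelfInv B n).comp (mk₀ 0 rfl p) (zero_add _)).comp g (add_neg_cancel n) =
      (shiftSelfInv B n).comp (show ShiftedHom (B⟦n⟧) B n from p ≫ g) (add_neg_cancel n) := by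
  rw [comp_assoc _ _ _ _ (add_zero n) (by omega), mk₀_comp]

end CategoryTheory.ShiftedHom

open CategoryTheory.ShiftedHom hiding map_zero map_add map_smul map_comp comp_assoc
open DGCategory

namespace DGEnhancement

section

variable {k : Type v} [Field k]
  {D : Type u₁} [Category.{v₁} D] [Preadditive D] [Linear k D] [HasZeroObject D] [HasShift D ℤ]
  [∀ n : ℤ, (shiftFunctor D n).Additive] [Pretriangulated D]
  {C : Type u₂} [DGCategory.{w} k C] (Φ : DGEnhancement k D C)

/-- The identification of the homotopy classes with the graded morphisms. -/
noncomputable def hh {X Y : C} {n : ℤ} : HH k X Y n ≃ₗ[k] ShiftedHom (Φ.obj X) (Φ.obj Y) n :=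
  LinearEquiv.ofBijective
    (Submodule.liftQ _ (Φ.cl n) fun f hf ↦ (Φ.cl_eq_zero_iff f).2 hf)
    ⟨(injective_iff_map_eq_zero _).2 fun f hf ↦ by
      obtain ⟨f, rfl⟩ := HH.mk_surjective f
      exact (HH.mk_eq_zero_iff f).2 ((Φ.cl_eq_zero_iff f).1 hf),
    fun g ↦ by
      obtain ⟨f, rfl⟩ := Φ.cl_surjective X Y n g
      exact ⟨HH.mk f, rfl⟩⟩

lemma hh_one (X : C) : Φ.hh (HH.one k X) = mk₀ 0 rfl (𝟙 (Φ.obj X)) := Φ.cl_one X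

lemma hh_comp {X Y Z : C} {p q n : ℤ} (h : p + q = n) (f : HH k X Y p) (g : HH k Y Z q) :
    Φ.hh (HH.comp h f g) = (Φ.hh f).comp (Φ.hh g) (show q + p = n by omega) := by
  obtain ⟨f, rfl⟩ := HH.mk_surjective f
  obtain ⟨g, rfl⟩ := HH.mk_surjective g
  exact Φ.cl_comp h f g

/-- The identification of the homotopy classes of degree zero with the morphisms. -/
noncomputable def hom₀ {X Y : C} : HH k X Y 0 ≃ₗ[k] (Φ.obj X ⟶ Φ.obj Y) :=
  Φ.hh ≪≫ₗ LinearEquiv.symm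
    { homEquiv (X := Φ.obj X) (Y := Φ.obj Y) (0 : ℤ) rfl with
      map_add' := fun f g ↦ mk₀_add _ _ f g
      map_smul' := fun c _ ↦ mk₀_smul _ _ c }

lemma hom₀_mk {X Y : C} (f : cocycles k X Y 0) : Φ.hom₀ (HH.mk f) = Φ.map f := rfl

lemma mk₀_hom₀ {X Y : C} (f : HH k X Y 0) : mk₀ 0 rfl (Φ.hom₀ f) = Φ.hh f :=
  (homEquiv (0 : ℤ) rfl).apply_symm_apply _

lemma hom₀_one (X : C) : Φ.hom₀ (HH.one k X) = 𝟙 (Φ.obj X) :=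
  (homEquiv (0 : ℤ) rfl).injective ((Φ.mk₀_hom₀ _).trans (Φ.hh_one X))

lemma hh_precomp {X Y Z : C} {n : ℤ} (f : HH k X Y 0) (g : HH k Y Z n) :
    Φ.hh (HH.comp (zero_add n) f g) = Φ.hom₀ f ≫ Φ.hh g := by
  rw [hh_comp, ← mk₀_hom₀, mk₀_comp]

lemma hh_postcomp {X Y Z : C} {n : ℤ} (f : HH k X Y n) (g : HH k Y Z 0) :
    Φ.hh (HH.comp (add_zero n) f g) = Φ.hh f ≫ (Φ.hom₀ g)⟦n⟧' := by
  rw [hh_comp, ← mk₀_hom₀, comp_mk₀]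

lemma hom₀_comp {X Y Z : C} (f : HH k X Y 0) (g : HH k Y Z 0) :
    Φ.hom₀ (HH.comp (zero_add 0) f g) = Φ.hom₀ f ≫ Φ.hom₀ g := by
  refine (homEquiv (0 : ℤ) rfl).injective ?_
  rw [homEquiv_apply, homEquiv_apply, mk₀_hom₀, hh_precomp, ← mk₀_hom₀, mk₀, mk₀, Category.assoc]

/-- A graded isomorphism given by an isomorphism. -/
noncomputable def isoOfIso {X Y : C} {n : ℤ} (e : Φ.obj X ≅ (Φ.obj Y)⟦n⟧) :
    HH.Iso k X Y n (-n) where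
  hom := Φ.hh.symm e.hom
  inv := Φ.hh.symm ((shiftSelfInv (Φ.obj Y) n).comp (mk₀ 0 rfl e.inv) (zero_add _))
  add_eq := add_neg_cancel n
  hom_inv := Φ.hh.injective (by
    rw [hh_comp, hh_one, LinearEquiv.apply_symm_apply, LinearEquiv.apply_symm_apply]
    refine (comp_shiftSelfInv_comp _ _).trans ?_
    rw [← e.hom_inv_id])
  inv_hom := Φ.hh.injective (by
    rw [hh_comp, hh_one, LinearEquiv.apply_symm_apply, LinearEquiv.apply_symm_apply]
    refine (shiftSelfInv_comp_comp _ _).trans ?_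
    rw [← shiftSelfInv_comp, e.inv_hom_id]
    rfl)

/-- An isomorphism in the homotopy category given by an isomorphism. -/
noncomputable def isoOfIso₀ {X Y : C} (e : Φ.obj X ≅ Φ.obj Y) : HH.Iso k X Y 0 0 where
  hom := Φ.hom₀.symm e.hom
  inv := Φ.hom₀.symm e.inv
  add_eq := rfl
  hom_inv := Φ.hom₀.injective (by
    refine (Φ.hom₀_comp _ _).trans ?_
    rw [LinearEquiv.apply_symm_apply, LinearEquiv.apply_symm_apply, e.hom_inv_id, hom₀_one])
  inv_hom := Φ.hom₀.injective (by
    refine (Φ.hom₀_comp _ _).trans ?_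
    rw [LinearEquiv.apply_symm_apply, LinearEquiv.apply_symm_apply, e.inv_hom_id, hom₀_one])

/-- The isomorphism given by an isomorphism in the homotopy category. -/
noncomputable def toIso {X Y : C} (σ : HH.Iso k X Y 0 0) : Φ.obj X ≅ Φ.obj Y where
  hom := Φ.hom₀ σ.hom
  inv := Φ.hom₀ σ.inv
  hom_inv_id := by
    rw [← hom₀_comp, ← hom₀_one]
    exact congrArg Φ.hom₀ σ.hom_inv
  inv_hom_id := by
    rw [← hom₀_comp, ← hom₀_one]
    exact congrArg Φ.hom₀ σ.inv_hom

/-- `C` carries no shift functor; an object with a graded isomorphism to `X` takes the place of a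
shift, and reduces statements about classes of any degree to degree zero, where the exact sequences
of `D` apply. -/
lemma exists_shift (Φ : DGEnhancement k D C) (X : C) {n m : ℤ} (h : n + m = 0) :
    ∃ X' : C, Nonempty (HH.Iso k X' X n m) := by
  obtain rfl : m = -n := by omega
  obtain ⟨X', ⟨e⟩⟩ := Φ.essSurj ((Φ.obj X)⟦n⟧)
  exact ⟨X', ⟨Φ.isoOfIso e⟩⟩

lemma finite_hh (Φ : DGEnhancement k D C) [∀ m : ℤ, (shiftFunctor D m).Linear k] (hfin : IsHomFinite k D) (X Y : C) (n : ℤ) :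
    Module.Finite k (HH k X Y n) :=
  have := hfin (Φ.obj X) ((Φ.obj Y)⟦n⟧)
  Module.Finite.equiv Φ.hh.symm

lemma isExactTriangle {X Y Q : C} {f : HH k X Y 0} {i : HH k Y Q 0} {p : HH k Q X 1}
    (hT : Triangle.mk (Φ.hom₀ f) (Φ.hom₀ i) (Φ.hh p) ∈ distTriang D) :
    IsExactTriangle f i p where
  comp₁₂ := Φ.hom₀.injective (by
    rw [hom₀_comp, map_zero]; exact comp_distTriang_mor_zero₁₂ _ hT)
  comp₂₃ := Φ.hh.injective (by
    rw [hh_precomp, map_zero]; exact comp_distTriang_mor_zero₂₃ _ hT)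
  comp₃₁ := Φ.hh.injective (by
    rw [hh_postcomp, map_zero]; exact comp_distTriang_mor_zero₃₁ _ hT)
  exact₂ W n w hw := by
    obtain ⟨W', ⟨σ⟩⟩ := Φ.exists_shift W (neg_add_cancel n)
    have h0 : Φ.hom₀ (HH.comp (neg_add_cancel n) σ.hom w) ≫ Φ.hom₀ i = 0 := by
      rw [← hom₀_comp, HH.comp_assoc _ (add_zero n) (by omega), hw, map_zero, map_zero]
    obtain ⟨g, hg⟩ := Triangle.coyoneda_exact₂ _ hT _ h0
    obtain ⟨g, rfl⟩ := Φ.hom₀.surjective g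
    have h1 := Φ.hom₀.injective (hg.trans (Φ.hom₀_comp g f).symm)
    refine ⟨HH.comp (by omega) σ.inv g, ?_⟩
    rw [HH.comp_assoc _ (zero_add 0) (by omega), ← h1, σ.inv_hom_comp]
  exact₃ W n m h w hw := by
    obtain ⟨W', ⟨σ⟩⟩ := Φ.exists_shift W (neg_add_cancel n)
    have h0 : Φ.hom₀ (HH.comp (neg_add_cancel n) σ.hom w) ≫ Φ.hh p = 0 := by
      rw [← hh_precomp, HH.comp_assoc _ h (by omega), hw, map_zero, map_zero]
    obtain ⟨g, hg⟩ := Triangle.coyoneda_exact₃ _ hT _ h0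
    obtain ⟨g, rfl⟩ := Φ.hom₀.surjective g
    have h1 := Φ.hom₀.injective (hg.trans (Φ.hom₀_comp g i).symm)
    refine ⟨HH.comp (by omega) σ.inv g, ?_⟩
    rw [HH.comp_assoc _ (zero_add 0) (by omega), ← h1, σ.inv_hom_comp]
  exact₁ W n m h w hw := by
    obtain ⟨W', ⟨σ⟩⟩ := Φ.exists_shift W (neg_add_cancel m)
    have h0 : Φ.hh (HH.comp (show -m + n = 1 by omega) σ.hom w) ≫ (Φ.hom₀ f)⟦(1 : ℤ)⟧' = 0 := by
      rw [← hh_postcomp, HH.comp_assoc _ (add_zero n) (by omega), hw, map_zero, map_zero]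
    obtain ⟨g, hg⟩ := Triangle.coyoneda_exact₁ _ hT _ h0
    obtain ⟨g, rfl⟩ := Φ.hom₀.surjective g
    have h1 := Φ.hh.injective (hg.trans (Φ.hh_precomp g p).symm)
    refine ⟨HH.comp (by omega) σ.inv g, ?_⟩
    rw [HH.comp_assoc _ (zero_add 1) (by omega), ← h1, σ.inv_hom_comp]

lemma coexact₂ {X Y Q : C} {f : HH k X Y 0} {i : HH k Y Q 0} {p : HH k Q X 1}
    (hT : Triangle.mk (Φ.hom₀ f) (Φ.hom₀ i) (Φ.hh p) ∈ distTriang D) {V : C} {n : ℤ}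
    (w : HH k Y V n) (hw : HH.comp (zero_add n) f w = 0) :
    ∃ v, HH.comp (zero_add n) i v = w := by
  obtain ⟨V', ⟨σ⟩⟩ := Φ.exists_shift V (add_neg_cancel n)
  have h0 : Φ.hom₀ f ≫ Φ.hom₀ (HH.comp (add_neg_cancel n) w σ.inv) = 0 := by
    rw [← hom₀_comp, ← HH.comp_assoc (zero_add n) _ (by omega), hw, map_zero,
      LinearMap.zero_apply, map_zero]
  obtain ⟨g, hg⟩ := Triangle.yoneda_exact₂ _ hT _ h0
  obtain ⟨g, rfl⟩ := Φ.hom₀.surjective g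
  have h1 := Φ.hom₀.injective (hg.trans (Φ.hom₀_comp i g).symm)
  refine ⟨HH.comp (zero_add n) g σ.hom, ?_⟩
  rw [← HH.comp_assoc (zero_add 0) _ (by omega), ← h1, σ.comp_inv_hom]

lemma coexact₃ {X Y Q : C} {f : HH k X Y 0} {i : HH k Y Q 0} {p : HH k Q X 1}
    (hT : Triangle.mk (Φ.hom₀ f) (Φ.hom₀ i) (Φ.hh p) ∈ distTriang D) {V : C} {n m : ℤ}
    (h : 1 + m = n) (w : HH k Q V n) (hw : HH.comp (zero_add n) i w = 0) :
    ∃ v, HH.comp h p v = w := by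
  obtain ⟨V', ⟨σ⟩⟩ := Φ.exists_shift V (add_neg_cancel n)
  have h0 : Φ.hom₀ i ≫ Φ.hom₀ (HH.comp (add_neg_cancel n) w σ.inv) = 0 := by
    rw [← hom₀_comp, ← HH.comp_assoc (zero_add n) _ (by omega), hw, map_zero,
      LinearMap.zero_apply, map_zero]
  obtain ⟨g, hg⟩ : ∃ g : (Φ.obj X)⟦(1 : ℤ)⟧ ⟶ Φ.obj V', Φ.hom₀ _ = Φ.hh p ≫ g :=
    Triangle.yoneda_exact₃ _ hT _ h0
  -- A morphism out of the shift of `Φ.obj X` by one is a class of degree `-1` out of `X`.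
  obtain ⟨v, hv⟩ := Φ.hh.surjective
    ((shiftSelfInv (Φ.obj X) 1).comp (mk₀ 0 rfl g) (zero_add _))
  have h1 : HH.comp (add_neg_cancel n) w σ.inv = HH.comp (add_neg_cancel 1) p v := by
    refine Φ.hh.injective ?_
    rw [← mk₀_hom₀, hh_comp, hv, comp_shiftSelfInv_comp]
    exact congrArg _ hg
  refine ⟨HH.comp (by omega) v σ.hom, ?_⟩
  rw [← HH.comp_assoc (add_neg_cancel 1) _ (by omega), ← h1, σ.comp_inv_hom]

lemma exists_isExactTriangle {X Y : C} (f : HH k X Y 0) :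
    ∃ (Q : C) (i : HH k Y Q 0) (p : HH k Q X 1),
      Triangle.mk (Φ.hom₀ f) (Φ.hom₀ i) (Φ.hh p) ∈ distTriang D := by
  obtain ⟨f, rfl⟩ := HH.mk_surjective f
  obtain ⟨Q, i, p, hc⟩ := Φ.exists_isCone f
  exact ⟨Q, HH.mk ⟨i, hc.closed_i⟩, HH.mk ⟨p, hc.closed_p⟩, Φ.distinguished f _ _ hc⟩

lemma hasShiftedSums (Φ : DGEnhancement k D C) {ι : Type} [DecidableEq ι] (E : ι → C) : HasShiftedSums k E := by
  classical
  intro β _ i q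
  choose E' σ using fun b ↦ Φ.exists_shift (E (i b)) (neg_add_cancel (q b))
  let σ := fun b ↦ (σ b).some
  obtain ⟨G, ⟨e⟩⟩ := Φ.essSurj (⨁ fun b ↦ Φ.obj (E' b))
  let a : ∀ b, HH k (E' b) G 0 := fun b ↦ Φ.hom₀.symm (biproduct.ι (fun b ↦ Φ.obj (E' b)) b ≫ e.inv)
  let c : ∀ b, HH k G (E' b) 0 := fun b ↦ Φ.hom₀.symm (e.hom ≫ biproduct.π (fun b ↦ Φ.obj (E' b)) b)
  have hac : ∀ b, HH.comp (zero_add 0) (a b) (c b) = HH.one k _ := fun b ↦ Φ.hom₀.injective (by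
    rw [hom₀_comp, hom₀_one]; simp [a, c])
  have hac' : ∀ b b', b ≠ b' → HH.comp (zero_add 0) (a b) (c b') = 0 := fun b b' h ↦
    Φ.hom₀.injective (by
      rw [hom₀_comp, map_zero]; simp [a, c, biproduct.ι_π_ne _ h])
  have hca : ∑ b, HH.comp (zero_add 0) (c b) (a b) = HH.one k _ := Φ.hom₀.injective (by
    rw [map_sum, hom₀_one]
    simp only [hom₀_comp, a, c, LinearEquiv.apply_symm_apply, Category.assoc]
    rw [← Preadditive.comp_sum, ← cancel_epi e.inv, ← cancel_mono e.hom]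
    simp only [Category.assoc, e.inv_hom_id_assoc, Preadditive.sum_comp, e.inv_hom_id,
      Category.comp_id, biproduct.total])
  refine ⟨G, fun b ↦ HH.comp (add_zero _) (σ b).inv (a b),
    fun b ↦ HH.comp (zero_add _) (c b) (σ b).hom, fun b ↦ ?_, fun b b' n h hne ↦ ?_, ?_⟩
  · rw [← HH.comp_assoc (add_zero (q b)) _ (by omega), HH.comp_assoc _ (zero_add 0) (by omega), hac,
      HH.comp_one, (σ b).inv_hom]
  · rw [← HH.comp_assoc (add_zero (q b)) _ (by omega), HH.comp_assoc _ (zero_add 0) (by omega),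
      hac' _ _ hne, map_zero, map_zero, LinearMap.zero_apply]
  · rw [← hca]
    refine Finset.sum_congr rfl fun b _ ↦ ?_
    rw [← HH.comp_assoc (show -q b + q b = 0 by omega) _ (by omega),
      HH.comp_assoc _ (show -q b + q b = 0 by omega) (by omega), (σ b).hom_inv, HH.comp_one]

lemma bijective_flip {V W : Type*} [AddCommGroup V] [Module k V] [AddCommGroup W] [Module k W]
    [Module.Finite k W] (L : V →ₗ[k] Module.Dual k W) (hL : Function.Bijective L) :
    Function.Bijective L.flip := by
  have : L.flip = (LinearEquiv.ofBijective L hL).dualMap.toLinearMap ∘ₗ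
      (Module.evalEquiv k W).toLinearMap :=
    LinearMap.ext fun w ↦ LinearMap.ext fun v ↦ rfl
  rw [this]
  exact (LinearEquiv.ofBijective L hL).dualMap.bijective.comp (Module.evalEquiv k W).bijective

/-- Evaluating the Serre functional of a morphism at `e` gives a trace form. By naturality the
pairing it induces through composition is the Serre pairing, perfect on one side by definition and
on the other by finite dimension. Replacing `Z` by a shift extends this to all degrees. -/
lemma exists_isSerreDual (Φ : DGEnhancement k D C) [∀ m : ℤ, (shiftFunctor D m).Linear k]
    (hfin : IsHomFinite k D) (S : SerreFunctor k D) {X Y : C}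
    (e : Φ.obj Y ≅ S.S.obj (Φ.obj X)) : ∃ lam : HH k X Y 0 →ₗ[k] k, IsSerreDual lam := by
  let lam : HH k X Y 0 →ₗ[k] k :=
    ((S.duality (Φ.obj X) (Φ.obj Y)).toLinearMap.flip e.hom) ∘ₗ Φ.hom₀.toLinearMap
  have hlam : ∀ {Z : C} (u : HH k X Z 0) (v : HH k Z Y 0), lam (HH.comp (add_zero 0) u v) =
      S.duality _ _ (Φ.hom₀ u) (Φ.hom₀ v ≫ e.hom) := fun u v ↦ by
    have := S.duality_natural (𝟙 _) (Φ.hom₀ u) (Φ.hom₀ v) e.hom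
    rw [Category.id_comp, S.S.map_id, Category.comp_id, ← hom₀_comp] at this
    exact this
  have h0 : ∀ (Z : C), Function.Bijective fun u : HH k X Z 0 ↦ lam ∘ₗ HH.comp (add_zero 0) u := by
    intro Z
    let ε : HH k Z Y 0 ≃ₗ[k] (Φ.obj Z ⟶ S.S.obj (Φ.obj X)) :=
      Φ.hom₀ ≪≫ₗ Linear.homCongr k (Iso.refl _) e
    have : (fun u : HH k X Z 0 ↦ lam ∘ₗ HH.comp (add_zero 0) u) =
        (Φ.hom₀ ≪≫ₗ S.duality (Φ.obj X) (Φ.obj Z) ≪≫ₗ ε.dualMap) := by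
      funext u
      refine LinearMap.ext fun v ↦ ?_
      refine (hlam u v).trans ?_
      simp [ε, Linear.homCongr]
    rw [this]
    exact LinearEquiv.bijective _
  have h0' : ∀ (Z : C), Function.Bijective
      fun e : HH k Z Y 0 ↦ lam ∘ₗ (HH.comp (add_zero 0)).flip e := fun Z ↦ by
    have := Φ.finite_hh hfin Z Y 0
    exact bijective_flip ((HH.comp (X := X) (Y := Z) (Z := Y) (add_zero 0)).compr₂ lam) (h0 Z)
  refine ⟨lam, fun Z n m h ↦ ?_⟩
  obtain ⟨Z', ⟨σ⟩⟩ := Φ.exists_shift Z h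
  let a : HH k X Z' 0 ≃ₗ[k] HH k X Z n := LinearEquiv.ofBijective
    ((HH.comp (zero_add n)).flip σ.hom) (σ.postcomp_bijective _)
  let b : HH k Z Y m ≃ₗ[k] HH k Z' Y 0 := LinearEquiv.ofBijective
    (HH.comp h σ.hom) (σ.precomp_bijective _)
  have hab : ∀ (u : HH k X Z' 0) (v : HH k Z Y m),
      lam (HH.comp h (a u) v) = lam (HH.comp (zero_add 0) u (b v)) := fun u v ↦
    congrArg lam (HH.comp_assoc _ _ (by omega) _ _ _)
  constructor
  · have : (fun e : HH k Z Y m ↦ lam ∘ₗ (HH.comp h).flip e) =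
        a.symm.dualMap ∘ (fun e : HH k Z' Y 0 ↦ lam ∘ₗ (HH.comp (add_zero 0)).flip e) ∘ b := by
      funext v
      refine LinearMap.ext fun u ↦ ?_
      obtain ⟨u, rfl⟩ := a.surjective u
      exact (hab u v).trans (by simp)
    rw [this]
    exact (LinearEquiv.bijective _).comp ((h0' Z').comp (LinearEquiv.bijective _))
  · have : (fun u : HH k X Z n ↦ lam ∘ₗ HH.comp h u) =
        b.dualMap ∘ (fun u : HH k X Z' 0 ↦ lam ∘ₗ HH.comp (add_zero 0) u) ∘ a.symm := by
      funext u
      refine LinearMap.ext fun v ↦ ?_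
      obtain ⟨u, rfl⟩ := a.surjective u
      exact (hab u v).trans (by simp)
    rw [this]
    exact (LinearEquiv.bijective _).comp ((h0 Z').comp (LinearEquiv.bijective _))

lemma exists_isSerreDual_left (Φ : DGEnhancement k D C) [∀ m : ℤ, (shiftFunctor D m).Linear k]
    (hfin : IsHomFinite k D) (S : SerreFunctor k D) (Y : C) :
    ∃ (X : C) (lam : HH k X Y 0 →ₗ[k] k), IsSerreDual lam := by
  have := S.isEquivalence
  obtain ⟨X, ⟨e⟩⟩ := Φ.essSurj (S.S.objPreimage (Φ.obj Y))
  exact ⟨X, Φ.exists_isSerreDual hfin S ((S.S.objObjPreimageIso (Φ.obj Y)).symm ≪≫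
    S.S.mapIso e.symm)⟩

lemma exists_isSerreDual_right (Φ : DGEnhancement k D C) [∀ m : ℤ, (shiftFunctor D m).Linear k]
    (hfin : IsHomFinite k D) (S : SerreFunctor k D) (X : C) :
    ∃ (Y : C) (lam : HH k X Y 0 →ₗ[k] k), IsSerreDual lam := by
  obtain ⟨Y, ⟨e⟩⟩ := Φ.essSurj (S.S.obj (Φ.obj X))
  exact ⟨Y, Φ.exists_isSerreDual hfin S e⟩

end

end DGEnhancement

/-! ### The twist on homotopy classes: adjoints and the equivalence criterion -/

namespace DGCategory

namespace TwistGlue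

section

variable {k : Type v} [CommRing k] {C : Type u} [DGCategory.{w} k C]
  {ι : Type} [DecidableEq ι] {E : ι → C}

/-- The action on the first copy of a graded isomorphism. -/
def srcIso {X Y : C} {n m : ℤ} (σ : HH.Iso k X Y n m) :
    HH.Iso k (src X : TwistGlue E) (src Y) n m where
  hom := srcHH E σ.hom
  inv := srcHH E σ.inv
  add_eq := σ.add_eq
  hom_inv := by rw [← srcHH_comp, σ.hom_inv, srcHH_one]
  inv_hom := by rw [← srcHH_comp, σ.inv_hom, srcHH_one]

namespace IsUniversal

/-- The bijection given by a universal element. -/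
noncomputable def equiv {Z X : C} {m : ℤ} {μ : HH k (src Z : TwistGlue E) (tgt X) m}
    (hμ : IsUniversal μ) (W : C) {n l : ℤ} (h : n + m = l) :
    HH k W Z n ≃ₗ[k] HH k (src W : TwistGlue E) (tgt X) l :=
  LinearEquiv.ofBijective ((HH.comp h).flip μ ∘ₗ (srcHH E).toLinearMap) (hμ W n l h)

lemma equiv_apply {Z X : C} {m : ℤ} {μ : HH k (src Z : TwistGlue E) (tgt X) m}
    (hμ : IsUniversal μ) {W : C} {n l : ℤ} (h : n + m = l) (w : HH k W Z n) :
    hμ.equiv W h w = HH.comp h (srcHH E w) μ := rfl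

lemma comp_equiv_symm {Z X : C} {m : ℤ} {μ : HH k (src Z : TwistGlue E) (tgt X) m}
    (hμ : IsUniversal μ) {W : C} {n l : ℤ} (h : n + m = l)
    (z : HH k (src W : TwistGlue E) (tgt X) l) :
    HH.comp h (srcHH E ((hμ.equiv W h).symm z)) μ = z :=
  (hμ.equiv W h).apply_symm_apply z

end IsUniversal

/-- The bijection given by a couniversal element. -/
noncomputable def IsCouniversal.equiv {W Z : C} {m : ℤ}
    {ν : HH k (src W : TwistGlue E) (tgt Z) m} (hν : IsCouniversal ν) (X : C) {n l : ℤ}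
    (h : m + n = l) : HH k Z X n ≃ₗ[k] HH k (src W : TwistGlue E) (tgt X) l :=
  LinearEquiv.ofBijective (HH.comp h ν ∘ₗ (tgtHH E).toLinearMap) (hν X n l h)

lemma IsCouniversal.equiv_apply {W Z : C} {m : ℤ}
    {ν : HH k (src W : TwistGlue E) (tgt Z) m} (hν : IsCouniversal ν) {X : C} {n l : ℤ}
    (h : m + n = l) (f : HH k Z X n) : hν.equiv X h f = HH.comp h ν (tgtHH E f) := rfl

lemma IsCouniversal.comp_equiv_symm {W Z : C} {m : ℤ}
    {ν : HH k (src W : TwistGlue E) (tgt Z) m} (hν : IsCouniversal ν) {X : C} {n l : ℤ}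
    (h : m + n = l) (z : HH k (src W : TwistGlue E) (tgt X) l) :
    HH.comp h ν (tgtHH E ((hν.equiv X h).symm z)) = z :=
  (hν.equiv X h).apply_symm_apply z

lemma IsCouniversal.comp_iso {W Z Z' : C} {m a b m' : ℤ}
    {ν : HH k (src W : TwistGlue E) (tgt Z) m} (hν : IsCouniversal ν) (σ : HH.Iso k Z Z' a b)
    (h : m + a = m') : IsCouniversal (HH.comp h ν (tgtHH E σ.hom)) := fun X n l hl ↦ by
  have := (hν X (a + n) l (by omega)).comp (σ.precomp_bijective (Z := X) (show a + n = a + n from rfl))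
  convert this using 1
  funext f
  exact (HH.comp_assoc h rfl (by omega) _ _ _).trans (by rw [← tgtHH_comp]; rfl)

section

variable {Z : C → C} {μ : ∀ X, HH k (src (Z X) : TwistGlue E) (tgt X) 0}
  (hμ : ∀ X, IsUniversal (μ X))

/-- The action of the twist on homotopy classes. -/
noncomputable def twistMap {X Y : C} {n : ℤ} : HH k X Y n →ₗ[k] HH k (Z X) (Z Y) n :=
  ((hμ Y).equiv (Z X) (add_zero n)).symm.toLinearMap ∘ₗ HH.comp (zero_add n) (μ X) ∘ₗ
    (tgtHH E).toLinearMap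

lemma twistMap_comp_univ {X Y : C} {n : ℤ} (f : HH k X Y n) :
    HH.comp (add_zero n) (srcHH E (twistMap hμ f)) (μ Y) =
      HH.comp (zero_add n) (μ X) (tgtHH E f) :=
  (hμ Y).comp_equiv_symm (add_zero n) _

lemma eq_twistMap {X Y : C} {n : ℤ} {f : HH k X Y n} {g : HH k (Z X) (Z Y) n}
    (h : HH.comp (add_zero n) (srcHH E g) (μ Y) = HH.comp (zero_add n) (μ X) (tgtHH E f)) :
    g = twistMap hμ f :=
  ((hμ Y).equiv (Z X) (add_zero n)).injective (h.trans (twistMap_comp_univ hμ f).symm)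

lemma twistMap_one (X : C) : twistMap hμ (HH.one k X) = HH.one k (Z X) := by
  refine (eq_twistMap hμ ?_).symm
  rw [srcHH_one, tgtHH_one, HH.comp_one, HH.one_comp]

lemma twistMap_comp {X Y V : C} {p q n : ℤ} (h : p + q = n) (f : HH k X Y p) (g : HH k Y V q) :
    twistMap hμ (HH.comp h f g) = HH.comp h (twistMap hμ f) (twistMap hμ g) := by
  refine (eq_twistMap hμ ?_).symm
  rw [srcHH_comp, tgtHH_comp, HH.comp_assoc h (add_zero q) (by omega), twistMap_comp_univ,
    ← HH.comp_assoc (add_zero p) (zero_add q) (by omega), twistMap_comp_univ,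
    HH.comp_assoc (zero_add p) h (by omega)]

/-- The action of the twist on graded isomorphisms. -/
noncomputable def twistIso {X Y : C} {n m : ℤ} (σ : HH.Iso k X Y n m) :
    HH.Iso k (Z X) (Z Y) n m where
  hom := twistMap hμ σ.hom
  inv := twistMap hμ σ.inv
  add_eq := σ.add_eq
  hom_inv := by rw [← twistMap_comp, σ.hom_inv, twistMap_one]
  inv_hom := by rw [← twistMap_comp, σ.inv_hom, twistMap_one]

/-- Under the universal property, `twistMap f` corresponds to `μ X` followed by `f`, which is
bijective in `f` precisely by couniversality. -/
lemma bijective_twistMap_of_isCouniversal {X : C} (h : IsCouniversal (μ X)) (Y : C) (n : ℤ) :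
    Function.Bijective (twistMap hμ : HH k X Y n → _) :=
  ((hμ Y).equiv (Z X) (add_zero n)).symm.bijective.comp (h Y n n (zero_add n))

lemma exists_iso_of_isUniversal (hμ : ∀ X, IsUniversal (μ X)) {W X : C} {m m' : ℤ} {θ : HH k (src W : TwistGlue E) (tgt X) m}
    (hθ : IsUniversal θ) (hm : m + m' = 0) :
    ∃ σ : HH.Iso k W (Z X) m m', HH.comp (add_zero m) (srcHH E σ.hom) (μ X) = θ := by
  let s := ((hμ X).equiv W (add_zero m)).symm θ
  let t := (hθ.equiv (Z X) (show m' + m = 0 by omega)).symm (μ X)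
  have hs : HH.comp (add_zero m) (srcHH E s) (μ X) = θ := (hμ X).comp_equiv_symm _ _
  have ht : HH.comp (show m' + m = 0 by omega) (srcHH E t) θ = μ X := hθ.comp_equiv_symm _ _
  refine ⟨⟨s, t, hm, ?_, ?_⟩, hs⟩
  · refine (hθ.equiv W (zero_add m)).injective ?_
    rw [IsUniversal.equiv_apply, IsUniversal.equiv_apply, srcHH_comp,
      HH.comp_assoc hm (show m' + m = 0 by omega) (by omega), ht, hs, srcHH_one, HH.one_comp]
  · refine ((hμ X).equiv (Z X) (add_zero 0)).injective ?_
    rw [IsUniversal.equiv_apply, IsUniversal.equiv_apply, srcHH_comp,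
      HH.comp_assoc (show m' + m = 0 by omega) (add_zero m) (by omega), hs, ht, srcHH_one]
    exact (HH.one_comp _).symm

/-- Universal classes at `X` differ by a graded isomorphism, so couniversality may be tested on an
explicit one such as the class of `commTmul` or `unit`. -/
lemma isCouniversal_of_isUniversal (hμ : ∀ X, IsUniversal (μ X)) {W X : C} {m : ℤ} {θ : HH k (src W : TwistGlue E) (tgt X) m}
    (hθ : IsUniversal θ) (hθ' : IsCouniversal θ) : IsCouniversal (μ X) := fun Y n l h ↦ by
  obtain ⟨σ, hσ⟩ := exists_iso_of_isUniversal hμ hθ (add_neg_cancel m)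
  have hσ' : HH.comp (neg_add_cancel m) (srcHH E σ.inv) θ = μ X := by
    rw [← hσ]
    exact (srcIso σ).inv_hom_comp _ _ _
  have := ((srcIso (E := E) σ).symm.precomp_bijective (Z := tgt Y)
    (show -m + (m + n) = l by omega)).comp (hθ' Y n (m + n) rfl)
  convert this using 1
  funext f
  rw [← hσ']
  exact HH.comp_assoc _ rfl (by omega) _ _ _

end

end

section

variable {k : Type v} [Field k] {C : Type u} [DGCategory.{w} k C]
  {ι : Type} [DecidableEq ι] {E : ι → C}
  {Z : C → C} {μ : ∀ X, HH k (src (Z X) : TwistGlue E) (tgt X) 0}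
  (hμ : ∀ X, IsUniversal (μ X))

/-- The right adjoint is the left adjoint conjugated by the Serre functor: `HH(Z W, Y)` is dual to
`HH(Y', Z W)`, which is `HH(K, W)` by couniversality, and this is dual to `HH(W, R)`. -/
theorem exists_twistMap_comp_bijective {Y' Y K R : C} {lam : HH k Y' Y 0 →ₗ[k] k}
    (hlam : IsSerreDual lam) {ν : HH k (src Y' : TwistGlue E) (tgt K) 0} (hν : IsCouniversal ν)
    {lam' : HH k K R 0 →ₗ[k] k} (hlam' : IsSerreDual lam') :
    ∃ ω : HH k (Z R) Y 0, ∀ (W : C) (n : ℤ),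
      Function.Bijective fun v : HH k W R n ↦ HH.comp (add_zero n) (twistMap hμ v) ω := by
  let a : ∀ (W : C) (m : ℤ), HH k Y' (Z W) m ≃ₗ[k] HH k K W m := fun W m ↦
    (hμ W).equiv Y' (add_zero m) ≪≫ₗ (hν.equiv W (zero_add m)).symm
  have ha : ∀ {W : C} {m : ℤ} (g : HH k Y' (Z W) m), HH.comp (zero_add m) ν (tgtHH E (a W m g)) =
      HH.comp (add_zero m) (srcHH E g) (μ W) := fun g ↦ hν.comp_equiv_symm _ _
  have ha' : ∀ {W V : C} {m n l : ℤ} (h : m + n = l) (g : HH k Y' (Z W) m) (v : HH k W V n),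
      a V l (HH.comp h g (twistMap hμ v)) = HH.comp h (a W m g) v := fun {W V m n l} h g v ↦ by
    refine (hν.equiv V (zero_add l)).injective ?_
    rw [IsCouniversal.equiv_apply, IsCouniversal.equiv_apply, ha, tgtHH_comp,
      ← HH.comp_assoc (zero_add m) h (by omega), ha, srcHH_comp,
      HH.comp_assoc h (add_zero n) (by omega), twistMap_comp_univ,
      HH.comp_assoc (add_zero m) (zero_add n) (by omega)]
  -- `ω` is the counit: under Serre duality it is the trace form of `K` and `R`, transported along
  -- the bijection `a`.
  obtain ⟨ω, hω⟩ := ((hlam (Z R) 0 0 rfl).1).2 (lam' ∘ₗ (a R 0).toLinearMap)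
  have hω' : ∀ g : HH k Y' (Z R) 0, lam (HH.comp (add_zero 0) g ω) = lam' (a R 0 g) :=
    fun g ↦ LinearMap.congr_fun hω g
  have key : ∀ {W : C} {n m : ℤ} (h : m + n = 0) (v : HH k W R n) (g : HH k Y' (Z W) m),
      lam (HH.comp h g (HH.comp (add_zero n) (twistMap hμ v) ω)) =
        lam' (HH.comp h (a W m g) v) := fun h v g ↦ by
    rw [← HH.comp_assoc h (add_zero _) (by omega), hω', ha']
  refine ⟨ω, fun W n ↦ ⟨?_, fun e ↦ ?_⟩⟩
  · refine (injective_iff_map_eq_zero ((HH.comp (add_zero n)).flip ω ∘ₗ twistMap hμ)).2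
      fun v hv ↦ (hlam' W (-n) n (neg_add_cancel n)).1.1 (LinearMap.ext fun f ↦ ?_)
    obtain ⟨g, rfl⟩ := (a W (-n)).surjective f
    have hv' : HH.comp (add_zero n) (twistMap hμ v) ω = 0 := hv
    refine (key (neg_add_cancel n) v g).symm.trans ?_
    rw [hv', map_zero, map_zero]
    simp
  · obtain ⟨v, hv⟩ := (hlam' W (-n) n (neg_add_cancel n)).1.2
      (lam ∘ₗ (HH.comp (neg_add_cancel n)).flip e ∘ₗ (a W (-n)).symm.toLinearMap)
    refine ⟨v, (hlam (Z W) (-n) n (neg_add_cancel n)).1.1 (LinearMap.ext fun g ↦ ?_)⟩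
    refine (key (neg_add_cancel n) v g).trans ((LinearMap.congr_fun hv (a W (-n) g)).trans ?_)
    simp

/-- The unit `ξ` of the adjunction is shown to be invertible by killing its cone `Q`. Bijectivity is
known on morphisms out of the `E j`, and this already forces it on morphisms out of `Q`. -/
theorem bijective_twistMap
    (hR : ∀ Y : C, ∃ (R : C) (ω : HH k (Z R) Y 0), ∀ (W : C) (n : ℤ),
      Function.Bijective fun v : HH k W R n ↦ HH.comp (add_zero n) (twistMap hμ v) ω)
    (hcone : ∀ {X Y : C} (f : HH k X Y 0), ∃ (Q : C) (i : HH k Y Q 0) (p : HH k Q X 1),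
      IsExactTriangle f i p)
    (hE : ∀ j, IsCouniversal (μ (E j)))
    (horth : ∀ Q : C, (∀ j n (y : HH k (E j) Q n), y = 0) → ∀ j n (y : HH k Q (E j) n), y = 0)
    (A X : C) (n : ℤ) :
    Function.Bijective (twistMap hμ : HH k A X n → _) := by
  obtain ⟨R, ω, hω⟩ := hR (Z X)
  obtain ⟨ξ, hξ⟩ := (hω X 0).2 (HH.one k (Z X))
  -- Since the twist of `ξ` followed by `ω` is the identity, composing with `ξ` and then applying
  -- the adjunction bijection gives back `twistMap`.
  have key : ∀ (A : C) (n : ℤ), Function.Bijective (twistMap hμ : HH k A X n → _) ↔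
      Function.Bijective fun v : HH k A X n ↦ HH.comp (add_zero n) v ξ := fun A n ↦ by
    rw [← (hω A n).of_comp_iff']
    have : ((fun v : HH k A R n ↦ HH.comp (add_zero n) (twistMap hμ v) ω) ∘
        fun v : HH k A X n ↦ HH.comp (add_zero n) v ξ) = twistMap hμ := by
      funext v
      refine (congrArg (fun z ↦ HH.comp (add_zero n) z ω) (twistMap_comp hμ _ v ξ)).trans ?_
      refine (HH.comp_assoc _ (zero_add 0) (by omega) _ _ _).trans ?_
      exact (congrArg _ hξ).trans (HH.comp_one _)
    rw [this]
  obtain ⟨Q, i, p, hQ⟩ := hcone ξ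
  have hQE : ∀ j n (y : HH k (E j) Q n), y = 0 := fun j n y ↦ hQ.eq_zero_of_bijective
    (fun n ↦ (key _ n).1 (bijective_twistMap_of_isCouniversal hμ (hE j) X n)) y
  -- `Q` is orthogonal to the family on both sides, so its canonical class is universal and
  -- couniversal. Hence `key` applies with `A = Q`, and the identity of `Q` vanishes.
  have hQc := isCouniversal_of_isUniversal hμ (isUniversal_unit (E := E) (V := Q) (k := k)
    (fun j q y ↦ hQE j q y)) (isCouniversal_unit (fun j q y ↦ horth Q hQE j q y))
  obtain ⟨σ, rfl⟩ := hQ.exists_iso (hQ.eq_zero_of_bijective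
    (fun n ↦ (key _ n).1 (bijective_twistMap_of_isCouniversal hμ hQc X n)) _)
  exact (key A n).2 (σ.postcomp_bijective _)

theorem exists_iso_twist
    (hR : ∀ Y : C, ∃ (R : C) (ω : HH k (Z R) Y 0), ∀ (W : C) (n : ℤ),
      Function.Bijective fun v : HH k W R n ↦ HH.comp (add_zero n) (twistMap hμ v) ω)
    (hcone : ∀ {X Y : C} (f : HH k X Y 0), ∃ (Q : C) (i : HH k Y Q 0) (p : HH k Q X 1),
      IsExactTriangle f i p)
    (hE : ∀ j, IsCouniversal (μ (E j)))
    (horth : ∀ Q : C, (∀ j n (y : HH k (E j) Q n), y = 0) → ∀ j n (y : HH k Q (E j) n), y = 0)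
    (hEZ : ∀ j, ∃ (j' : ι) (m m' : ℤ),
      Nonempty (HH.Iso k (E j) (Z (E j')) m m'))
    (Y : C) : ∃ X : C, Nonempty (HH.Iso k (Z X) Y 0 0) := by
  obtain ⟨R, ω, hω⟩ := hR Y
  obtain ⟨Q, i, p, hQ⟩ := hcone ω
  -- Composition with `ω` is bijective on morphisms out of each `Z W`: precomposed with the
  -- bijection `twistMap` it becomes the adjunction bijection.
  have h0 : ∀ (W : C) (n : ℤ) (y : HH k (Z W) Q n), y = 0 := fun W n y ↦
    hQ.eq_zero_of_bijective (fun n ↦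
      (Function.Bijective.of_comp_iff _ (bijective_twistMap hμ hR hcone hE horth W R n)).1 (hω W n)) y
  have hQE : ∀ j n (y : HH k (E j) Q n), y = 0 := fun j n y ↦ by
    obtain ⟨j', m, m', ⟨σ⟩⟩ := hEZ j
    have := σ.add_eq
    rw [← σ.hom_inv_comp (show m + (m' + n) = n by omega) rfl y, h0 _ _ (HH.comp rfl σ.inv y),
      map_zero]
  obtain ⟨σ, -⟩ := exists_iso_of_isUniversal hμ (isUniversal_unit (E := E) (V := Q) (k := k)
    (fun j q y ↦ hQE j q y)) (add_zero 0)
  -- `Q` is isomorphic to its twist `Z Q`, and morphisms from there to `Q` vanish, so the identity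
  -- of `Q` is zero.
  obtain ⟨τ, -⟩ := hQ.exists_iso (by
    rw [← σ.hom_inv, h0 _ _ σ.inv, map_zero])
  exact ⟨R, ⟨τ⟩⟩

end

end TwistGlue

end DGCategory

/-! ### Biuniversal classes from one-dimensional morphism spaces -/

namespace DGCategory

namespace TwistGlue

section

variable {k : Type v} [Field k] {C : Type u} [DGCategory.{w} k C]
  {ι : Type} [DecidableEq ι] {E : ι → C}

/-- The vanishing hypotheses leave only the multiples of `g` and of the identities. By `hne` the
generator `g` and the identities lie in different summands of the source, so the contraction against
`φ` does not see the identities. -/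
theorem exists_biuniversal {j₀ j₁ : ι} {K : ℤ} {g : HH k (E j₀) (E j₁) K}
    {φ : HH k (E j₀) (E j₁) K →ₗ[k] k} (hφ : φ g = 1)
    (hg : ∀ y : HH k (E j₀) (E j₁) K, ∃ c : k, y = c • g) (hne : ¬(j₀ = j₁ ∧ K = 0))
    (h₀ : ∀ y : HH k (E j₀) (E j₀) 0, ∃ c : k, y = c • HH.one k (E j₀))
    (h₁ : ∀ y : HH k (E j₁) (E j₁) 0, ∃ c : k, y = c • HH.one k (E j₁))
    (hr : ∀ j q, ¬(j = j₀ ∧ q = K) → ¬(j = j₁ ∧ q = 0) → ∀ y : HH k (E j) (E j₁) q, y = 0)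
    (hl : ∀ j q, ¬(j = j₁ ∧ q = K) → ¬(j = j₀ ∧ q = 0) → ∀ y : HH k (E j₀) (E j) q, y = 0) :
    ∃ θ : HH k (src (E j₀) : TwistGlue E) (tgt (E j₁)) (K - 1),
      IsUniversal θ ∧ IsCouniversal θ := by
  obtain ⟨g, rfl⟩ := HH.mk_surjective g
  refine ⟨_, isUniversal_commTmul (sub_add_cancel K 1) g (fun W n P hP₁ hP₂ j p q h x y ↦ ?_) φ hφ
    (fun W n l h x ↦ ?_), isCouniversal_commTmul (sub_add_cancel K 1) g
    (fun X n P hP₁ hP₂ j p q h x y ↦ ?_) φ hφ (fun X n l h y ↦ ?_)⟩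
  · by_cases hj₀ : j = j₀ ∧ q = K
    · obtain ⟨rfl, rfl⟩ := hj₀
      obtain ⟨c, rfl⟩ := hg y
      rw [map_smul]
      exact P.smul_mem c (hP₁ p h x)
    by_cases hj₁ : j = j₁ ∧ q = 0
    · obtain ⟨rfl, rfl⟩ := hj₁
      obtain rfl : p = n := by omega
      obtain ⟨c, rfl⟩ := h₁ y
      rw [map_smul]
      exact P.smul_mem c (hP₂ x)
    · rw [hr j q hj₀ hj₁ y, map_zero]
      exact zero_mem _
  · exact classContractRight_tmul_of_ne _ _ _ (fun h ↦ hne ⟨h.1.symm, h.2.symm⟩) _ _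
  · by_cases hj₁ : j = j₁ ∧ p = K
    · obtain ⟨rfl, rfl⟩ := hj₁
      obtain ⟨c, rfl⟩ := hg x
      rw [map_smul]
      exact P.smul_mem c (hP₁ q h y)
    by_cases hj₀ : j = j₀ ∧ p = 0
    · obtain ⟨rfl, rfl⟩ := hj₀
      obtain rfl : q = n := by omega
      obtain ⟨c, rfl⟩ := h₀ x
      rw [map_smul]
      exact P.smul_mem c (hP₂ y)
    · rw [hl j p hj₁ hj₀ x, map_zero, LinearMap.zero_apply]
      exact zero_mem _
  · exact classContractLeft_tmul_of_ne _ _ _ (fun h ↦ hne ⟨h.1, h.2.symm⟩) _ _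

/-- Here `g` and the identity share one summand; they are separated by `φ`, which takes the values
one and zero on them. -/
theorem exists_biuniversal_of_degree_zero {j₀ : ι} {g : HH k (E j₀) (E j₀) 0}
    {φ : HH k (E j₀) (E j₀) 0 →ₗ[k] k} (hφ : φ g = 1) (hφ' : φ (HH.one k (E j₀)) = 0)
    (hg : ∀ y : HH k (E j₀) (E j₀) 0, ∃ c c' : k, y = c • g + c' • HH.one k (E j₀))
    (hr : ∀ j q, ¬(j = j₀ ∧ q = 0) → ∀ y : HH k (E j) (E j₀) q, y = 0)
    (hl : ∀ j q, ¬(j = j₀ ∧ q = 0) → ∀ y : HH k (E j₀) (E j) q, y = 0) :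
    ∃ θ : HH k (src (E j₀) : TwistGlue E) (tgt (E j₀)) (-1),
      IsUniversal θ ∧ IsCouniversal θ := by
  obtain ⟨g, rfl⟩ := HH.mk_surjective g
  refine ⟨_, isUniversal_commTmul (neg_add_cancel 1) g (fun W n P hP₁ hP₂ j p q h x y ↦ ?_) φ hφ
    (fun W n l h x ↦ ?_), isCouniversal_commTmul (neg_add_cancel 1) g
    (fun X n P hP₁ hP₂ j p q h x y ↦ ?_) φ hφ (fun X n l h y ↦ ?_)⟩
  · by_cases hj₀ : j = j₀ ∧ q = 0
    · obtain ⟨rfl, rfl⟩ := hj₀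
      obtain rfl : p = n := by omega
      obtain ⟨c, c', rfl⟩ := hg y
      rw [map_add, map_smul, map_smul]
      exact P.add_mem (P.smul_mem c (hP₁ p h x)) (P.smul_mem c' (hP₂ x))
    · rw [hr j q hj₀ y, map_zero]
      exact zero_mem _
  · obtain rfl : n = l := by omega
    rw [classContractRight_tmul, hφ', zero_smul]
  · by_cases hj₀ : j = j₀ ∧ p = 0
    · obtain ⟨rfl, rfl⟩ := hj₀
      obtain rfl : q = n := by omega
      obtain ⟨c, c', rfl⟩ := hg x
      rw [map_add, map_smul, map_smul]
      exact P.add_mem (P.smul_mem c (hP₁ q h y)) (P.smul_mem c' (hP₂ y))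
    · rw [hl j p hj₀ x, map_zero, LinearMap.zero_apply]
      exact zero_mem _
  · obtain rfl : n = l := by omega
    rw [classContractLeft_tmul, hφ', zero_smul]

end

end TwistGlue

section

variable {k : Type v} [Field k] {C : Type u} [DGCategory.{w} k C]

lemma IsSerreDual.eq_zero {X Y : C} {d : ℤ} {lam : HH k X Y d →ₗ[k] k} (hlam : IsSerreDual lam)
    {Z : C} {n m : ℤ} (h : n + m = d) (h0 : ∀ u : HH k X Z n, u = 0) (e : HH k Z Y m) : e = 0 :=
  (hlam Z n m h).1.1 (LinearMap.ext fun u ↦ by rw [h0 u, map_zero, map_zero])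

/-- Degree `d` classes from `X` to `Y` are dual to the degree zero endomorphisms of `X`, here a
line; `g` is dual to the identity. -/
lemma IsSerreDual.exists_generator {X Y : C} {d : ℤ} {lam : HH k X Y d →ₗ[k] k}
    (hlam : IsSerreDual lam) (h1 : HH.one k X ≠ 0)
    (hX : ∀ y : HH k X X 0, ∃ c : k, y = c • HH.one k X) :
    ∃ g : HH k X Y d, lam g = 1 ∧ ∀ y : HH k X Y d, ∃ c : k, y = c • g := by
  obtain ⟨φ, hφ⟩ : ∃ φ : Module.Dual k (HH k X X 0), φ (HH.one k X) ≠ 0 := by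
    by_contra! h
    exact h1 ((Module.forall_dual_apply_eq_zero_iff k _).1 h)
  have hlam' := (hlam X 0 d (zero_add d)).1
  obtain ⟨g, hg⟩ := hlam'.2 φ
  have hg1 : lam g = φ (HH.one k X) := by
    rw [← LinearMap.congr_fun hg (HH.one k X)]
    exact congrArg lam (HH.one_comp g).symm
  refine ⟨(φ (HH.one k X))⁻¹ • g, by rw [map_smul, hg1, smul_eq_mul, inv_mul_cancel₀ hφ],
    fun y ↦ ⟨lam y, hlam'.1 (LinearMap.ext fun u ↦ ?_)⟩⟩
  obtain ⟨c, rfl⟩ := hX u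
  simp only [LinearMap.comp_apply, LinearMap.flip_apply, map_smul, LinearMap.smul_apply,
    HH.one_comp, hg1, smul_eq_mul, inv_mul_cancel₀ hφ, mul_one]

end

end DGCategory

/-! ### Spherical objects and exceptional cycles -/

open DGCategory TwistGlue

lemma Module.exists_dual_eq_one {k : Type*} [Field k] {V : Type*} [AddCommGroup V] [Module k V]
    {x : V} (hx : x ≠ 0) : ∃ φ : V →ₗ[k] k, φ x = 1 := by
  obtain ⟨φ, hφ⟩ : ∃ φ : Module.Dual k V, φ x ≠ 0 := by
    by_contra! h
    exact hx ((Module.forall_dual_apply_eq_zero_iff k _).1 h)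
  exact ⟨(φ x)⁻¹ • φ, inv_mul_cancel₀ hφ⟩

lemma Module.exists_complement_of_finrank_eq_two {k : Type*} [Field k] {V : Type*}
    [AddCommGroup V] [Module k V] [Module.Finite k V] (h : Module.finrank k V = 2) {x : V}
    (hx : x ≠ 0) : ∃ (g : V) (φ : V →ₗ[k] k), φ g = 1 ∧ φ x = 0 ∧
      ∀ y, ∃ c c' : k, y = c • g + c' • x := by
  have h1 : Module.finrank k (V ⧸ Submodule.span k {x}) = 1 := by
    have := (Submodule.span k {x}).finrank_quotient_add_finrank
    rw [finrank_span_singleton hx, h] at this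
    omega
  obtain ⟨v, hv, hv'⟩ := (finrank_eq_one_iff' (K := k) (V := V ⧸ Submodule.span k {x})).1 h1
  obtain ⟨g, rfl⟩ := (Submodule.span k {x}).mkQ_surjective v
  obtain ⟨ψ, hψ⟩ := Module.exists_dual_eq_one (k := k) hv
  refine ⟨g, ψ ∘ₗ Submodule.mkQ _, hψ, ?_, fun y ↦ ?_⟩
  · rw [LinearMap.comp_apply, Submodule.mkQ_apply,
      (Submodule.Quotient.mk_eq_zero _).2 (Submodule.mem_span_singleton_self x), map_zero]
  · obtain ⟨c, hc⟩ := hv' (Submodule.mkQ _ y)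
    rw [← map_smul, ← sub_eq_zero, ← map_sub, Submodule.mkQ_apply,
      Submodule.Quotient.mk_eq_zero, Submodule.mem_span_singleton] at hc
    obtain ⟨c', hc'⟩ := hc
    exact ⟨c, -c', by rw [neg_smul, hc']; abel⟩

namespace DGEnhancement

section

variable {k : Type v} [Field k]
  {D : Type u₁} [Category.{v₁} D] [Preadditive D] [Linear k D] [HasZeroObject D] [HasShift D ℤ]
  [∀ n : ℤ, (shiftFunctor D n).Additive] [Pretriangulated D]
  [∀ m : ℤ, (shiftFunctor D m).Linear k]
  {C : Type u₂} [DGCategory.{w} k C] (Φ : DGEnhancement k D C)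

/-- The identification of homotopy classes with morphisms between isomorphic objects. -/
noncomputable def hhCongr {X Y : C} {A B : D} (e : Φ.obj X ≅ A) (e' : Φ.obj Y ≅ B) (n : ℤ) :
    HH k X Y n ≃ₗ[k] (A ⟶ B⟦n⟧) :=
  Φ.hh ≪≫ₗ Linear.homCongr k e ((shiftFunctor D n).mapIso e')

/-- The identification of endomorphisms of degree zero. -/
noncomputable def endCongr {X : C} {A : D} (e : Φ.obj X ≅ A) : HH k X X 0 ≃ₗ[k] (A ⟶ A) :=
  Φ.hom₀ ≪≫ₗ Linear.homCongr k e e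

lemma endCongr_one {X : C} {A : D} (e : Φ.obj X ≅ A) : Φ.endCongr e (HH.one k X) = 𝟙 A := by
  simp [endCongr, Linear.homCongr, hom₀_one]

lemma exists_isSerreDual_of_iso (Φ : DGEnhancement k D C) (hfin : IsHomFinite k D)
    (S : SerreFunctor k D) {X Y : C} {A B : D} (e : Φ.obj X ≅ A) (e' : Φ.obj Y ≅ B) {l : ℤ}
    (σ : S.S.obj A ≅ B⟦l⟧) : ∃ lam : HH k X Y l →ₗ[k] k, IsSerreDual lam := by
  obtain ⟨Y₀, ⟨e₀⟩⟩ := Φ.essSurj (S.S.obj (Φ.obj X))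
  obtain ⟨lam, hlam⟩ := Φ.exists_isSerreDual hfin S e₀
  exact ⟨_, hlam.comp_iso (Φ.isoOfIso (e₀ ≪≫ S.S.mapIso e ≪≫ σ ≪≫
    (shiftFunctor D l).mapIso e'.symm)) (add_neg_cancel l)⟩

lemma exists_biuniversal_of_isSpherical (Φ : DGEnhancement k D C) (hfin : IsHomFinite k D)
    (S : SerreFunctor k D) {A : D} (hA : IsSpherical S A) {ι : Type} [DecidableEq ι] [Subsingleton ι]
    (E : ι → C) (j : ι) (e : Φ.obj (E j) ≅ A) :
    ∃ (m : ℤ) (θ : HH k (src (E j) : TwistGlue E) (tgt (E j)) m),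
      IsUniversal θ ∧ IsCouniversal θ := by
  obtain ⟨l, ⟨σ⟩, hdim⟩ := hA
  obtain ⟨lam, hlam⟩ := Φ.exists_isSerreDual_of_iso hfin S e e σ
  have hf : ∀ m, Module.Finite k (HH k (E j) (E j) m) := fun m ↦ Φ.finite_hh hfin _ _ m
  have hdim' : ∀ m, Module.finrank k (HH k (E j) (E j) m) =
      (if m = 0 then 1 else 0) + (if m = l then 1 else 0) := fun m ↦
    (LinearEquiv.finrank_eq (Φ.hhCongr e e m)).trans (hdim m)
  have hone : HH.one k (E j) ≠ 0 := fun h ↦ by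
    have : Subsingleton (HH k (E j) (E j) 0) := ⟨fun a b ↦ by
      rw [← HH.comp_one a, ← HH.comp_one b, h, map_zero, map_zero]⟩
    have h1 := hdim' 0
    rw [Module.finrank_zero_of_subsingleton, if_pos rfl] at h1
    omega
  have hvan : ∀ m, m ≠ 0 → m ≠ l → ∀ y : HH k (E j) (E j) m, y = 0 := fun m h0 hl y ↦ by
    have h1 := hdim' m
    rw [if_neg h0, if_neg hl, add_zero] at h1
    have := Module.finrank_zero_iff.1 h1
    exact Subsingleton.elim _ _
  -- For `l = 0` the endomorphisms form a plane in degree zero, and `g` spans a complement of the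
  -- identity. Otherwise degree zero is a line, and `g` is its Serre dual in degree `l`.
  by_cases hl : l = 0
  · subst hl
    have h2 := hdim' 0
    rw [if_pos rfl] at h2
    obtain ⟨g, φ, hφ, hφ', hg⟩ := Module.exists_complement_of_finrank_eq_two h2 hone
    refine ⟨_, exists_biuniversal_of_degree_zero hφ hφ' hg (fun i q hq y ↦ ?_)
      (fun i q hq y ↦ ?_)⟩ <;> obtain rfl := Subsingleton.elim i j
    · exact hvan q (fun h ↦ hq ⟨rfl, h⟩) (fun h ↦ hq ⟨rfl, h⟩) y
    · exact hvan q (fun h ↦ hq ⟨rfl, h⟩) (fun h ↦ hq ⟨rfl, h⟩) y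
  · have h1 := hdim' 0
    rw [if_pos rfl, if_neg (Ne.symm hl)] at h1
    have h₀ : ∀ y : HH k (E j) (E j) 0, ∃ c : k, y = c • HH.one k (E j) := fun y ↦ by
      obtain ⟨c, hc⟩ := (finrank_eq_one_iff_of_nonzero' _ hone).1 h1 y
      exact ⟨c, hc.symm⟩
    obtain ⟨g, hg, hg'⟩ := hlam.exists_generator hone h₀
    refine ⟨_, exists_biuniversal hg hg' (fun h ↦ hl h.2) h₀ h₀ (fun i q hq hq' y ↦ ?_)
      (fun i q hq hq' y ↦ ?_)⟩ <;> obtain rfl := Subsingleton.elim i j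
    · exact hvan q (fun h ↦ hq' ⟨rfl, h⟩) (fun h ↦ hq ⟨rfl, h⟩) y
    · exact hvan q (fun h ↦ hq' ⟨rfl, h⟩) (fun h ↦ hq ⟨rfl, h⟩) y

/-- The properties of the objects of an exceptional cycle which make the twist an equivalence. -/
structure IsTwistCycle {ι : Type} [DecidableEq ι] (E : ι → C) (s : ι → ι) : Prop where
  surjective : Function.Surjective s
  serre : ∀ j, ∃ (K : ℤ) (lam : HH k (E j) (E (s j)) K →ₗ[k] k), IsSerreDual lam
  biuniversal : ∀ j, ∃ (m : ℤ) (θ : HH k (src (E j) : TwistGlue E) (tgt (E (s j))) m),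
    IsUniversal θ ∧ IsCouniversal θ

/-- For `n ≥ 2`, Serre duality turns exceptionality of `E j` into the statement that the morphisms
from `E j` to `E (j + 1)` form a line in a single degree. With the orthogonality in the cycle these
are all the nonzero morphisms between different members, as a biuniversal class requires. -/
theorem isTwistCycle (Φ : DGEnhancement k D C) (hfin : IsHomFinite k D)
    (S : SerreFunctor k D) {n : ℕ} [NeZero n] {E : Fin n → D} (hE : IsExceptionalCycle S E)
    (E' : Fin n → C) (e : ∀ i, Φ.obj (E' i) ≅ E i) :
    IsTwistCycle (k := k) E' (fun i ↦ i + 1) := by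
  have hs : Function.Surjective fun i : Fin n ↦ i + 1 := fun i ↦ ⟨i - 1, sub_add_cancel i 1⟩
  rcases hE with ⟨rfl, hE⟩ | ⟨hn, hE, hSE, h0⟩
  · have hj : ∀ j : Fin 1, j + 1 = j := fun j ↦ Subsingleton.elim _ _
    refine ⟨hs, fun j ↦ ?_, fun j ↦ ?_⟩
    · rw [hj]
      obtain ⟨l, ⟨σ⟩, -⟩ := hE j
      exact ⟨l, Φ.exists_isSerreDual_of_iso hfin S (e j) (e j) σ⟩
    · rw [hj]
      exact Φ.exists_biuniversal_of_isSpherical hfin S (hE j) E' j (e j)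
  · have hj : ∀ j : Fin n, j ≠ j + 1 := fun j h ↦ by
      have h1 : (1 : Fin n) = 0 := by simpa using h
      rw [Fin.one_eq_zero_iff] at h1
      omega
    have hone : ∀ j, HH.one k (E' j) ≠ 0 := fun j h ↦ (hE j).1 (by
      rw [← Φ.endCongr_one (e j), h, map_zero])
    have hend : ∀ j (y : HH k (E' j) (E' j) 0), ∃ c : k, y = c • HH.one k (E' j) := fun j y ↦ by
      obtain ⟨c, hc⟩ := (hE j).2.1 (Φ.endCongr (e j) y)
      refine ⟨c, (Φ.endCongr (e j)).injective ?_⟩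
      rw [hc, map_smul, endCongr_one]
    have hvan : ∀ j q, q ≠ 0 → ∀ y : HH k (E' j) (E' j) q, y = 0 := fun j q hq y ↦
      (Φ.hhCongr (e j) (e j) q).injective (by rw [map_zero]; exact (hE j).2.2 q hq _)
    have hvan' : ∀ i j, j ≠ i → j ≠ i + 1 → ∀ (q : ℤ) (y : HH k (E' i) (E' j) q), y = 0 :=
      fun i j h h' q y ↦ (Φ.hhCongr (e i) (e j) q).injective (by
        rw [map_zero]; exact h0 i j h h' q _)
    choose K hK using hSE
    have hser : ∀ j, ∃ lam : HH k (E' j) (E' (j + 1)) (K j) →ₗ[k] k, IsSerreDual lam := fun j ↦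
      Φ.exists_isSerreDual_of_iso hfin S (e j) (e (j + 1)) (hK j).some
    refine ⟨hs, fun j ↦ ⟨_, hser j⟩, fun j ↦ ?_⟩
    obtain ⟨lam, hlam⟩ := hser j
    -- Degree `q` is dual to the endomorphisms of `E' j` of degree `K j - q`, which vanish unless
    -- this is zero.
    have hvan'' : ∀ q, q ≠ K j → ∀ y : HH k (E' j) (E' (j + 1)) q, y = 0 := fun q hq y ↦
      hlam.eq_zero (sub_add_cancel (K j) q) (hvan j _ (by omega)) y
    obtain ⟨g, hg, hg'⟩ := hlam.exists_generator (hone j) (hend j)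
    refine ⟨_, exists_biuniversal hg hg' (fun h ↦ hj j h.1) (hend j) (hend (j + 1))
      (fun i q hq hq' ↦ ?_) (fun i q hq hq' ↦ ?_)⟩
    · by_cases hi : i = j
      · subst hi
        exact hvan'' q fun h ↦ hq ⟨rfl, h⟩
      by_cases hi' : i = j + 1
      · subst hi'
        exact hvan _ q fun h ↦ hq' ⟨rfl, h⟩
      · exact hvan' i (j + 1) (Ne.symm hi') (fun h ↦ hi (add_right_cancel h).symm) q
    · by_cases hi : i = j
      · subst hi
        exact hvan _ q fun h ↦ hq' ⟨rfl, h⟩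
      by_cases hi' : i = j + 1
      · subst hi'
        exact hvan'' q fun h ↦ hq ⟨rfl, h⟩
      · exact hvan' j i hi hi' q

end

end DGEnhancement

/-! ### The twist along a cycle is an equivalence on homotopy classes -/

open DGCategory TwistGlue

namespace DGEnhancement

section

variable {k : Type v} [Field k]
  {D : Type u₁} [Category.{v₁} D] [Preadditive D] [Linear k D] [HasZeroObject D] [HasShift D ℤ]
  [∀ n : ℤ, (shiftFunctor D n).Additive] [Pretriangulated D]
  [∀ m : ℤ, (shiftFunctor D m).Linear k]
  {C : Type u₂} [DGCategory.{w} k C] {ι : Type} [DecidableEq ι] [Fintype ι] {E : ι → C} {s : ι → ι}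

/-- The cohomology of the complexes of morphisms out of the objects `E i` is bounded. -/
def _root_.DGCategory.HasFiniteSupport (k : Type v) [Field k] {C : Type u₂} [DGCategory.{w} k C]
    {ι : Type} (E : ι → C) : Prop :=
  ∀ i X, {m : ℤ | ∃ f : HH k (E i) X m, f ≠ 0}.Finite

lemma exists_universal (Φ : DGEnhancement k D C) (hfin : IsHomFinite k D)
    (htot : HasFiniteSupport k E) (X : C) :
    ∃ (Z : C) (μ : HH k (src Z : TwistGlue E) (tgt X) 0), IsUniversal μ := by
  obtain ⟨G, v, hv⟩ := exists_representsRight (fun i q ↦ Φ.finite_hh hfin (E i) X q)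
    (Finset.univ.biUnion fun i ↦ (htot i X).toFinset.image fun q ↦ (i, q))
    (fun i q hiq y ↦ by
      by_contra hy
      exact hiq (Finset.mem_biUnion.2 ⟨i, Finset.mem_univ _, Finset.mem_image.2
        ⟨q, (htot i X).mem_toFinset.2 ⟨y, hy⟩, rfl⟩⟩)) (Φ.hasShiftedSums E)
  obtain ⟨Z, i, p, hc⟩ := Φ.exists_isCone ⟨evalMap E G X rfl v, by
    rw [mem_cocycles_iff (zero_add 1), ← evalMap_evalSourceD E (zero_add 1) rfl rfl, hv.closed,
      map_zero]⟩
  exact ⟨Z, exists_isUniversal hv hc⟩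

lemma exists_couniversal (Φ : DGEnhancement k D C) (hfin : IsHomFinite k D)
    (hE : IsTwistCycle (k := k) E s) (htot : HasFiniteSupport k E) (W : C) :
    ∃ (Z : C) (ν : HH k (src W : TwistGlue E) (tgt Z) 0), IsCouniversal ν := by
  choose K lam hlam using hE.serre
  obtain ⟨G, v, hv⟩ := exists_representsLeft (fun i q ↦ Φ.finite_hh hfin W (E i) q)
    -- Boundedness of the morphisms from `W` to the family comes from Serre duality: classes from
    -- `W` to `E (s i)` of degree `K i - q` are dual to classes from `E i` to `W` of degree `q`.
    -- Degrees are recorded with the opposite sign.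
    (Finset.univ.biUnion fun i ↦ (htot i W).toFinset.image fun q ↦ (s i, q - K i))
    (fun j q hjq y ↦ by
      obtain ⟨i, rfl⟩ := hE.surjective j
      refine (hlam i).eq_zero (show K i + q + -q = K i by omega) (fun u ↦ ?_) y
      by_contra hu
      exact hjq (Finset.mem_biUnion.2 ⟨i, Finset.mem_univ _, Finset.mem_image.2
        ⟨_, (htot i W).mem_toFinset.2 ⟨u, hu⟩, by simp⟩⟩)) (Φ.hasShiftedSums E)
  let γ : cocycles k W G 0 := ⟨evalMap E W G rfl v, by
    rw [mem_cocycles_iff (zero_add 1), ← evalMap_evalSourceD E (zero_add 1) rfl rfl, hv.closed,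
      map_zero]⟩
  obtain ⟨Z, i, p, hc⟩ := Φ.exists_isCone γ
  have hT : Triangle.mk (Φ.hom₀ (HH.mk γ)) (Φ.hom₀ (HH.mk ⟨i, hc.closed_i⟩))
    (Φ.hh (HH.mk ⟨p, hc.closed_p⟩)) ∈ distTriang D := Φ.distinguished γ _ _ hc
  obtain ⟨ν, hν⟩ := exists_isCouniversal hv hc
    (fun X n m h f hf ↦ by
      obtain ⟨g, hg⟩ := Φ.coexact₃ hT h (HH.mk f) ((HH.mk_eq_zero_iff _).2 hf)
      obtain ⟨g, rfl⟩ := HH.mk_surjective g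
      exact ⟨g, (HH.mk_eq_mk_iff _ _).1 hg.symm⟩)
    (fun X n y hy ↦ by
      obtain ⟨f, hf⟩ := Φ.coexact₂ hT (HH.mk y) ((HH.mk_eq_zero_iff _).2 hy)
      obtain ⟨f, rfl⟩ := HH.mk_surjective f
      exact ⟨f, (HH.mk_eq_mk_iff _ _).1 hf.symm⟩)
    ((HH.mk_eq_zero_iff _).1 (Φ.isExactTriangle hT).comp₃₁)
  -- The class `ν` has degree `-1`; passing to a shift of `Z` brings it to degree zero.
  obtain ⟨Z', ⟨σ⟩⟩ := Φ.exists_shift Z (neg_add_cancel 1)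
  exact ⟨Z', _, hν.comp_iso σ.symm (neg_add_cancel 1)⟩

section

variable {Z : C → C} {μ : ∀ X, HH k (src (Z X) : TwistGlue E) (tgt X) 0}

lemma IsTwistCycle.isCouniversal (hE : IsTwistCycle (k := k) E s) (hμ : ∀ X, IsUniversal (μ X))
    (j : ι) : IsCouniversal (μ (E j)) := by
  obtain ⟨j, rfl⟩ := hE.surjective j
  obtain ⟨m, θ, hθ, hθ'⟩ := hE.biuniversal j
  exact isCouniversal_of_isUniversal hμ hθ hθ'

lemma IsTwistCycle.orthogonal (hE : IsTwistCycle (k := k) E s) {Q : C}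
    (hQ : ∀ j n (y : HH k (E j) Q n), y = 0) (j : ι) (n : ℤ) (y : HH k Q (E j) n) : y = 0 := by
  obtain ⟨j, rfl⟩ := hE.surjective j
  obtain ⟨K, lam, hlam⟩ := hE.serre j
  exact hlam.eq_zero (sub_add_cancel K n) (hQ j _) y

/-- `Y'` plays the role of S⁻¹ Y, `K` that of the left adjoint applied to it, and `R` that of S K.
-/
lemma exists_twist_adjoint (Φ : DGEnhancement k D C) (hfin : IsHomFinite k D)
    (S : SerreFunctor k D) (hE : IsTwistCycle (k := k) E s) (htot : HasFiniteSupport k E)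
    (hμ : ∀ X, IsUniversal (μ X)) (Y : C) : ∃ (R : C) (ω : HH k (Z R) Y 0), ∀ (W : C) (n : ℤ),
      Function.Bijective fun v : HH k W R n ↦ HH.comp (add_zero n) (twistMap hμ v) ω := by
  obtain ⟨Y', lam, hlam⟩ := Φ.exists_isSerreDual_left hfin S Y
  obtain ⟨K, ν, hν⟩ := Φ.exists_couniversal hfin hE htot Y'
  obtain ⟨R, lam', hlam'⟩ := Φ.exists_isSerreDual_right hfin S K
  exact ⟨R, exists_twistMap_comp_bijective hμ hlam hν hlam'⟩

lemma exists_cone (Φ : DGEnhancement k D C) {X Y : C} (f : HH k X Y 0) :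
    ∃ (Q : C) (i : HH k Y Q 0) (p : HH k Q X 1), IsExactTriangle f i p := by
  obtain ⟨Q, i, p, hT⟩ := Φ.exists_isExactTriangle f
  exact ⟨Q, i, p, Φ.isExactTriangle hT⟩

theorem twistMap_bijective (Φ : DGEnhancement k D C) (hfin : IsHomFinite k D)
    (S : SerreFunctor k D) (hE : IsTwistCycle (k := k) E s) (htot : HasFiniteSupport k E)
    (hμ : ∀ X, IsUniversal (μ X)) {X Y : C} {n : ℤ} :
    Function.Bijective (twistMap hμ : HH k X Y n → _) :=
  bijective_twistMap hμ (Φ.exists_twist_adjoint hfin S hE htot hμ) Φ.exists_cone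
    (hE.isCouniversal hμ) (fun _ ↦ hE.orthogonal) X Y n

theorem twist_essSurj (Φ : DGEnhancement k D C) (hfin : IsHomFinite k D)
    (S : SerreFunctor k D) (hE : IsTwistCycle (k := k) E s) (htot : HasFiniteSupport k E)
    (hμ : ∀ X, IsUniversal (μ X)) (Y : C) : ∃ X : C, Nonempty (HH.Iso k (Z X) Y 0 0) := by
  refine exists_iso_twist hμ (Φ.exists_twist_adjoint hfin S hE htot hμ) Φ.exists_cone
    (hE.isCouniversal hμ) (fun _ ↦ hE.orthogonal) (fun j ↦ ?_) Y
  obtain ⟨m, θ, hθ, -⟩ := hE.biuniversal j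
  obtain ⟨σ, -⟩ := exists_iso_of_isUniversal hμ hθ (add_neg_cancel m)
  exact ⟨s j, m, -m, ⟨σ⟩⟩

end

end

end DGEnhancement

/-! ### Compatibility of the twist with cones -/

namespace DGCategory

section

variable {k : Type v} [CommRing k] {C : Type u} [DGCategory.{w} k C]

/-- The quantifiers over objects in `IsCone` range over `C` and say nothing about the other objects
of the glued category. The equations extracted here involve finitely many morphisms, so they persist
under the embedding of `C` as the first copy. -/
lemma IsCone.exists_contraction {X Y Z : C} {f : Hom k X Y 0} {i : Hom k Y Z 0} {p : Hom k Z X 1}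
    (hc : IsCone f i p) : ∃ (α : Hom k Z X 1) (β : Hom k Z Y 0) (a : Hom k Y X 0)
      (b : Hom k Y Y (-1)), α ∈ cocycles k Z X 1 ∧
      comp (add_zero 1) α f + d (zero_add 1) β = 0 ∧ p + α ∈ coboundaries k Z X 1 ∧
      comp (zero_add 1) i α = -d (zero_add 1) a ∧
      comp (zero_add 0) i β - one Y =
        comp (add_zero 0) a f + d (show (-1 : ℤ) + 1 = 0 by omega) b := by
  obtain ⟨j, t, hj, ht, ⟨c, hc'⟩, hsurj, hinj⟩ := hc.exists_homotopies
  have hsurj' : ∀ (W : C) (n m : ℤ) (h : n + 1 = m) (z : Hom k W Z n), z ∈ cocycles k W Z n →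
      ∃ (a : Hom k W X m) (b : Hom k W Y n),
        a ∈ cocycles k W X m ∧ comp (add_zero m) a f + d h b = 0 ∧
        z - (comp (by omega) a j + comp (add_zero n) b i) ∈ coboundaries k W Z n := by
    rintro W n _ rfl z hz
    exact hsurj W n z hz
  have hinj' : ∀ (W : C) (n m l : ℤ) (h : n + 1 = m) (h' : l + 1 = n) (a : Hom k W X m)
      (b : Hom k W Y n), a ∈ cocycles k W X m → comp (add_zero m) a f + d h b = 0 →
      comp (by omega) a j + comp (add_zero n) b i ∈ coboundaries k W Z n →
      ∃ (a' : Hom k W X n) (b' : Hom k W Y l),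
        a = -d h a' ∧ b = comp (add_zero n) a' f + d h' b' := by
    rintro W n _ l rfl h' a b ha hab hz
    obtain rfl : l = n - 1 := by omega
    exact hinj W n a b ha hab hz
  obtain ⟨α, β, hα, hαβ, γ, hγ⟩ := hsurj' Z 0 1 (zero_add 1) (one Z) (one_mem_cocycles Z)
  have hi := hc.closed_i
  have hiα := comp_mem_cocycles (zero_add 1) hi hα
  -- Both `(0, 1)` and `(α ∘ i, β ∘ i)` represent `i`, so they differ by the boundary of some `(a,
  -- b)`.
  obtain ⟨a, b, ha, hb⟩ := hinj' Y 0 1 (-1) (zero_add 1) (by omega) (comp (zero_add 1) i α)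
    (comp (zero_add 0) i β - one Y) hiα (by
      rw [map_sub, d_one, sub_zero, d_comp_closed_left _ (zero_add 1) _ hi,
        assoc _ (add_zero 1) (by omega), ← map_add, hαβ, map_zero]) (by
      rw [map_sub, LinearMap.sub_apply, one_comp, assoc _ (show (1 : ℤ) + -1 = 0 by omega) (by omega),
        assoc _ (add_zero 0) (by omega), ← add_sub_assoc, ← map_add, ← neg_sub,
        Submodule.neg_mem_iff]
      have := comp_mem_coboundaries_right (add_zero 0) hi ⟨γ, hγ⟩
      rwa [map_sub, comp_one] at this)
  refine ⟨α, β, a, b, hα, hαβ, ?_, ha, hb⟩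
  -- The decomposition of the identity of `Z` is followed by `p`; then `p ∘ j` is replaced using the
  -- third relation and `p ∘ i` by `d t`. The terms containing `t` add up to the boundary of `t ∘
  -- β`, leaving `p + α`.
  have h1 := comp_mem_coboundaries_left (zero_add 1) ⟨γ, hγ⟩ hc.closed_p
  have h2 := comp_mem_coboundaries_right (add_zero 1) hα ⟨c, hc'⟩
  have h3 := d_mem_coboundaries (zero_add 1) (comp (zero_add 0) β t)
  rw [d_comp (zero_add 0) (zero_add 1) (zero_add 1) (zero_add 1), ht, Int.negOnePow_zero, one_smul,
    eq_neg_of_add_eq_zero_right hαβ] at h3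
  have := add_mem (add_mem h1 h2) h3
  convert this using 1
  simp only [map_sub, map_add, map_neg, LinearMap.sub_apply, LinearMap.add_apply,
    LinearMap.neg_apply, one_comp, comp_one]
  rw [assoc (show (1 : ℤ) + -1 = 0 by omega) (show (-1 : ℤ) + 1 = 0 by omega) (by omega),
    assoc (zero_add 0) (zero_add 1) (by omega), assoc (add_zero 1) (zero_add 0) (by omega)]
  abel

/-- The map of cones induced by a homotopy commutative square. Only explicit equations are assumed,
so that it applies in the glued category with one cone in each copy. -/
theorem exists_map_of_cones {X Y Z X' Y' Q : C} {f : Hom k X Y 0} {i : Hom k Y Z 0}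
    {p : Hom k Z X 1} {j : Hom k X Z (-1)} {t : Hom k Y X 0}
    (hi : i ∈ cocycles k Y Z 0)
    (hj : d (show (-1 : ℤ) + 1 = 0 by omega) j = comp (zero_add 0) f i)
    (ht : d (zero_add 1) t = comp (zero_add 1) i p)
    (hjt : comp (show (-1 : ℤ) + 1 = 0 by omega) j p + comp (zero_add 0) f t + one X ∈
      coboundaries k X X 0)
    {f' : Hom k X' Y' 0} {i' : Hom k Y' Q 0} {p' : Hom k Q X' 1} {α : Hom k Q X' 1}
    {β : Hom k Q Y' 0} {a : Hom k Y' X' 0} {b : Hom k Y' Y' (-1)}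
    (hα : α ∈ cocycles k Q X' 1)
    (hαβ : comp (add_zero 1) α f' + d (zero_add 1) β = 0)
    (hp' : p' + α ∈ coboundaries k Q X' 1) (ha : comp (zero_add 1) i' α = -d (zero_add 1) a)
    (hb : comp (zero_add 0) i' β - one Y' =
        comp (add_zero 0) a f' + d (show (-1 : ℤ) + 1 = 0 by omega) b)
    {μ : Hom k X' X 0} {μ' : Hom k Y' Y 0} (hμ : μ ∈ cocycles k X' X 0)
    (hμ' : μ' ∈ cocycles k Y' Y 0) {h : Hom k X' Y (-1)}
    (hh : comp (zero_add 0) f' μ' - comp (zero_add 0) μ f =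
      d (show (-1 : ℤ) + 1 = 0 by omega) h) :
    ∃ ζ : cocycles k Q Z 0,
      comp (zero_add 0) i' ζ.1 - comp (zero_add 0) μ' i ∈ coboundaries k Y' Z 0 ∧
      comp (zero_add 1) ζ.1 p - comp (add_zero 1) p' μ ∈ coboundaries k Q X 1 := by
  have hm : (-1 : ℤ) + 1 = 0 := by omega
  have hpm : (1 : ℤ) + -1 = 0 := by omega
  -- `M` is a morphism from `Y'` to `Z` and `A` a nullhomotopy of its composite with `f'`, so they
  -- define a morphism from the cone of `f'`. It is evaluated on the pair `(α, β)` to give a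
  -- morphism out of `Q`.
  obtain ⟨M, hM⟩ : ∃ M, M = comp (zero_add 0) μ' i := ⟨_, rfl⟩
  obtain ⟨A, hA⟩ : ∃ A, A = comp (zero_add (-1)) μ j + comp (add_zero (-1)) h i := ⟨_, rfl⟩
  obtain ⟨B, hB⟩ : ∃ B, B = comp (zero_add 0) μ' t := ⟨_, rfl⟩
  have hMc : M ∈ cocycles k Y' Z 0 := hM ▸ comp_mem_cocycles _ hμ' hi
  have hdA : d hm A = comp (zero_add 0) f' M := by
    rw [hA, hM, map_add, d_comp_closed_left _ hm hm hμ, hj, d_comp_closed_right _ hm hm _ hi, ← hh,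
      ← assoc (zero_add 0) _ (by omega), ← assoc (zero_add 0) _ (by omega)]
    simp
  have hdB : d (zero_add 1) B = comp (zero_add 1) M p := by
    rw [hB, hM, d_comp_closed_left _ (zero_add 1) _ hμ', ht, assoc _ (zero_add 1) (by omega)]
  have hN : comp hm A p + comp (zero_add 0) f' B + μ ∈ coboundaries k X' X 0 := by
    have h1 := comp_mem_coboundaries_right (zero_add 0) hμ hjt
    have h2 := d_mem_coboundaries hm (comp (add_zero (-1)) h t)
    rw [d_comp (add_zero (-1)) hm (zero_add 1) hm, ht, ← hh, Int.negOnePow_zero, one_smul] at h2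
    convert add_mem h1 h2 using 1
    rw [hA, hB]
    simp only [map_sub, map_add, LinearMap.sub_apply, LinearMap.add_apply, comp_one]
    rw [assoc (zero_add (-1)) hm (by omega), assoc (add_zero (-1)) (zero_add 1) (by omega),
      assoc (zero_add 0) (zero_add 0) (by omega), assoc (zero_add 0) (zero_add 0) (by omega)]
    abel
  have hβ : d (zero_add 1) β = -comp (add_zero 1) α f' := eq_neg_of_add_eq_zero_right hαβ
  refine ⟨⟨comp hpm α A + comp (zero_add 0) β M, ?_⟩, ?_, ?_⟩
  · rw [mem_cocycles_iff (zero_add 1), map_add, d_comp_closed_left _ hm _ hα, hdA,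
      d_comp_closed_right _ (zero_add 1) _ _ hMc, hβ, ← assoc (add_zero 1) _ (by omega)]
    simp
  · have h1 := d_mem_coboundaries hm (comp (zero_add (-1)) a A)
    rw [d_comp (zero_add (-1)) (zero_add 1) hm hm, hdA, Int.negOnePow_neg, Int.negOnePow_one,
      Units.neg_smul, one_smul, ← LinearMap.neg_apply, ← map_neg, ← ha] at h1
    have h2 := d_mem_coboundaries hm (comp (add_zero (-1)) b M)
    rw [d_comp_closed_right _ hm hm _ hMc, Int.negOnePow_zero, one_smul,
      ← sub_eq_iff_eq_add'.2 hb] at h2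
    convert add_mem h1 h2 using 1
    simp only [map_sub, map_add, LinearMap.sub_apply, one_comp, ← hM]
    rw [assoc (zero_add 1) hpm (by omega), assoc (zero_add 0) (zero_add 0) (by omega),
      assoc (zero_add 0) (zero_add 0) (by omega)]
    abel
  · have h1 := comp_mem_coboundaries_right (add_zero 1) hα hN
    have h2 := d_mem_coboundaries (zero_add 1) (comp (zero_add 0) β B)
    rw [d_comp (zero_add 0) (zero_add 1) (zero_add 1) (zero_add 1), hdB, hβ, Int.negOnePow_zero,
      one_smul] at h2
    have h3 := comp_mem_coboundaries_left (add_zero 1) hp' hμ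
    convert sub_mem (add_mem h1 h2) h3 using 1
    simp only [map_add, map_neg, LinearMap.add_apply, LinearMap.neg_apply]
    rw [assoc hpm hm (by omega), assoc (zero_add 0) (zero_add 1) (by omega),
      assoc (add_zero 1) (zero_add 0) (by omega)]
    abel

end

section

variable {k : Type v} [CommRing k] {C : Type u} [DGCategory.{w} k C]

/-- The five lemma for the functors of morphisms out of a test object, followed by Yoneda. -/
theorem IsExactTriangle.exists_iso_of_comp {X Y Q Q' : C} {f : HH k X Y 0} {i : HH k Y Q 0}
    {p : HH k Q X 1} {i' : HH k Y Q' 0} {p' : HH k Q' X 1} (T : IsExactTriangle f i p)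
    (T' : IsExactTriangle f i' p') {φ : HH k Q Q' 0} (hi : HH.comp (zero_add 0) i φ = i')
    (hp : HH.comp (zero_add 1) φ p' = p) : ∃ σ : HH.Iso k Q Q' 0 0, σ.hom = φ := by
  have hinj : ∀ (W : C) (w : HH k W Q 0), HH.comp (zero_add 0) w φ = 0 → w = 0 := fun W w hw ↦ by
    obtain ⟨v, rfl⟩ := T.exact₃ W 0 1 (zero_add 1) w (by
      rw [← hp, ← HH.comp_assoc (zero_add 0) _ (by omega), hw, map_zero, LinearMap.zero_apply])
    rw [HH.comp_assoc _ (zero_add 0) (by omega), hi] at hw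
    obtain ⟨u, rfl⟩ := T'.exact₂ W 0 v hw
    rw [HH.comp_assoc _ (zero_add 0) (by omega), T.comp₁₂, map_zero]
  have hsurj : ∀ (W : C) (w : HH k W Q' 0), ∃ v, HH.comp (zero_add 0) v φ = w := fun W w ↦ by
    obtain ⟨v, hv⟩ := T.exact₁ W 1 0 (zero_add 1) (HH.comp (zero_add 1) w p') (by
      rw [HH.comp_assoc _ (add_zero 1) (by omega), T'.comp₃₁, map_zero])
    obtain ⟨u, hu⟩ := T'.exact₃ W 0 1 (zero_add 1) (w - HH.comp (zero_add 0) v φ) (by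
      rw [map_sub, LinearMap.sub_apply, HH.comp_assoc _ (zero_add 1) (by omega), hp, hv, sub_self])
    refine ⟨v + HH.comp (zero_add 0) u i, ?_⟩
    rw [map_add, LinearMap.add_apply, HH.comp_assoc _ (zero_add 0) (by omega), hi, hu]
    abel
  obtain ⟨g, hg⟩ := hsurj Q' (HH.one k Q')
  refine ⟨⟨φ, g, rfl, ?_, hg⟩, rfl⟩
  rw [← sub_eq_zero]
  refine hinj _ _ ?_
  rw [map_sub, LinearMap.sub_apply, HH.comp_assoc _ (zero_add 0) (by omega), hg]
  exact (congrArg₂ _ (HH.comp_one φ) (HH.one_comp φ)).trans (sub_self φ)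

end

namespace TwistGlue

section

variable {k : Type v} [CommRing k] {C : Type u} [DGCategory.{w} k C]
  {ι : Type} [DecidableEq ι] {E : ι → C}
  {Z : C → C} {μ : ∀ X, HH k (src (Z X) : TwistGlue E) (tgt X) 0}
  (hμ : ∀ X, IsUniversal (μ X))

/-- By `hess` every test object is isomorphic to some `Z A`, and by `hbij` morphisms out of `Z A`
come from morphisms out of `A`, where exactness is known. -/
theorem isExactTriangle_twistMap
    (hbij : ∀ (X Y : C) (n : ℤ), Function.Bijective (twistMap hμ : HH k X Y n → _))
    (hess : ∀ Y : C, ∃ X : C, Nonempty (HH.Iso k (Z X) Y 0 0))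
    {X Y Q : C} {f : HH k X Y 0} {i : HH k Y Q 0} {p : HH k Q X 1} (T : IsExactTriangle f i p) :
    IsExactTriangle (twistMap hμ f) (twistMap hμ i) (twistMap hμ p) where
  comp₁₂ := by rw [← twistMap_comp, T.comp₁₂, map_zero]
  comp₂₃ := by rw [← twistMap_comp, T.comp₂₃, map_zero]
  comp₃₁ := by rw [← twistMap_comp, T.comp₃₁, map_zero]
  exact₂ W n w hw := by
    obtain ⟨A, ⟨σ⟩⟩ := hess W
    obtain ⟨a, ha⟩ := (hbij A Y n).2 (HH.comp (zero_add n) σ.hom w)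
    obtain ⟨v, rfl⟩ := T.exact₂ A n a ((hbij _ _ _).1 (by
      rw [twistMap_comp, ha, HH.comp_assoc _ (add_zero n) (by omega), hw, map_zero, map_zero]))
    refine ⟨HH.comp (zero_add n) σ.inv (twistMap hμ v), ?_⟩
    rw [HH.comp_assoc _ (add_zero n) (by omega), ← twistMap_comp, ha, σ.inv_hom_comp]
  exact₃ W n m h w hw := by
    obtain ⟨A, ⟨σ⟩⟩ := hess W
    obtain ⟨a, ha⟩ := (hbij A Q n).2 (HH.comp (zero_add n) σ.hom w)
    obtain ⟨v, rfl⟩ := T.exact₃ A n m h a ((hbij _ _ _).1 (by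
      rw [twistMap_comp, ha, HH.comp_assoc _ h (by omega), hw, map_zero, map_zero]))
    refine ⟨HH.comp (zero_add n) σ.inv (twistMap hμ v), ?_⟩
    rw [HH.comp_assoc _ (add_zero n) (by omega), ← twistMap_comp, ha, σ.inv_hom_comp]
  exact₁ W n m h w hw := by
    obtain ⟨A, ⟨σ⟩⟩ := hess W
    obtain ⟨a, ha⟩ := (hbij A X n).2 (HH.comp (zero_add n) σ.hom w)
    obtain ⟨v, rfl⟩ := T.exact₁ A n m h a ((hbij _ _ _).1 (by
      rw [twistMap_comp, ha, HH.comp_assoc _ (add_zero n) (by omega), hw, map_zero, map_zero]))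
    refine ⟨HH.comp (zero_add m) σ.inv (twistMap hμ v), ?_⟩
    rw [HH.comp_assoc _ h (by omega), ← twistMap_comp, ha, σ.inv_hom_comp]

/-- The classes `μ X` and `μ Y` form a homotopy commutative square from `f'` in the first copy to
`f` in the second. The induced map of cones goes from `src Q` to `tgt V`, so it factors uniquely
through `μ V`. -/
theorem exists_twist_map_of_cones {X Y V Q : C} {f : cocycles k X Y 0} {i : cocycles k Y V 0}
    {p : cocycles k V X 1} (hc : IsCone f.1 i.1 p.1) {f' : cocycles k (Z X) (Z Y) 0}
    {i' : cocycles k (Z Y) Q 0} {p' : cocycles k Q (Z X) 1} (hc' : IsCone f'.1 i'.1 p'.1)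
    (hf : HH.mk f' = twistMap hμ (HH.mk f)) :
    ∃ φ : HH k Q (Z V) 0, HH.comp (zero_add 0) (HH.mk i') φ = twistMap hμ (HH.mk i) ∧
      HH.comp (zero_add 1) φ (twistMap hμ (HH.mk p)) = HH.mk p' := by
  obtain ⟨j, t, hj, ht, hjt, -, -⟩ := hc.exists_homotopies
  obtain ⟨α, β, a, b, hα, hαβ, hp', ha, hb⟩ := hc'.exists_contraction
  obtain ⟨m, hm⟩ := HH.mk_surjective (μ X)
  obtain ⟨m', hm'⟩ := HH.mk_surjective (μ Y)
  have hff := twistMap_comp_univ hμ (HH.mk f)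
  rw [← hf, ← hm, ← hm', srcHH_mk, tgtHH_mk, HH.comp_mk, HH.comp_mk, HH.mk_eq_mk_iff,
    mem_coboundaries_iff (show (-1 : ℤ) + 1 = 0 by omega)] at hff
  obtain ⟨h, hh⟩ := hff
  obtain ⟨ζ, hζ, hζ'⟩ := exists_map_of_cones (tgtHom_mem_cocycles (E := E) i)
    (p := tgtHom E p.1) (j := tgtHom E j) (t := tgtHom E t) hj ht hjt
    (f' := srcHom E f'.1) (i' := srcHom E i'.1) (p' := srcHom E p'.1) (α := srcHom E α) (β := srcHom E β)
    (a := srcHom E a) (b := srcHom E b) hα hαβ hp' ha hb m.2 m'.2 hh.symm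
  have hiζ : HH.comp (zero_add 0) (srcHH E (HH.mk i')) (HH.mk ζ) =
      HH.comp (zero_add 0) (μ Y) (tgtHH E (HH.mk i)) := by
    rw [← hm']
    exact (HH.mk_eq_mk_iff _ _).2 hζ
  have hζp : HH.comp (zero_add 1) (HH.mk ζ) (tgtHH E (HH.mk p)) =
      HH.comp (add_zero 1) (srcHH E (HH.mk p')) (μ X) := by
    rw [← hm]
    exact (HH.mk_eq_mk_iff _ _).2 hζ'
  let φ := ((hμ V).equiv Q (zero_add 0)).symm (HH.mk ζ)
  have hφ : HH.comp (zero_add 0) (srcHH E φ) (μ V) = HH.mk ζ := (hμ V).comp_equiv_symm _ _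
  refine ⟨φ, eq_twistMap hμ ?_, ((hμ X).equiv Q (add_zero 1)).injective ?_⟩
  · rw [srcHH_comp, HH.comp_assoc _ (zero_add 0) (by omega), hφ, hiζ]
  · rw [IsUniversal.equiv_apply, IsUniversal.equiv_apply, srcHH_comp,
      HH.comp_assoc _ (add_zero 1) (by omega), twistMap_comp_univ,
      ← HH.comp_assoc (zero_add 0) _ (by omega), hφ, hζp]

end

end TwistGlue

end DGCategory

/-! ### The twist as a functor on the triangulated category -/

open DGCategory TwistGlue
open CategoryTheory.ShiftedHom hiding map_zero map_add map_smul map_comp comp_assoc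

namespace DGEnhancement

section

variable {k : Type v} [Field k]
  {D : Type u₁} [Category.{v₁} D] [Preadditive D] [Linear k D] [HasZeroObject D] [HasShift D ℤ]
  [∀ n : ℤ, (shiftFunctor D n).Additive] [Pretriangulated D]
  {C : Type u₂} [DGCategory.{w} k C] {ι : Type} [DecidableEq ι] {E : ι → C}

lemma distinguished_of_iso₃ {A B Q Q' : D} {f : A ⟶ B} {i : B ⟶ Q} {p : Q ⟶ A⟦(1 : ℤ)⟧}
    (hT : Triangle.mk f i p ∈ distTriang D) (e : Q ≅ Q') {i' : B ⟶ Q'} {p' : Q' ⟶ A⟦(1 : ℤ)⟧}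
    (hi : i ≫ e.hom = i') (hp : e.hom ≫ p' = p) : Triangle.mk f i' p' ∈ distTriang D := by
  subst hi hp
  exact isomorphic_distinguished _ hT _ (Triangle.isoMk _ _ (Iso.refl A) (Iso.refl B) e.symm
    (show f ≫ 𝟙 B = 𝟙 A ≫ f by simp) (show (i ≫ e.hom) ≫ e.inv = 𝟙 B ≫ i by simp)
    (show p' ≫ (𝟙 A)⟦(1 : ℤ)⟧' = e.inv ≫ e.hom ≫ p' by simp))

lemma mk₀_comp_shift {A B F : D} (f : A ⟶ B) (g : B ⟶ F) :
    mk₀ (0 : ℤ) rfl f ≫ g⟦(0 : ℤ)⟧' = mk₀ (0 : ℤ) rfl (f ≫ g) := by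
  rw [← comp_mk₀ _ 0 rfl, mk₀_comp_mk₀]

lemma comp_mk₀_shift {A B F : D} (f : A ⟶ B) (g : B ⟶ F) :
    f ≫ mk₀ (0 : ℤ) rfl g = mk₀ (0 : ℤ) rfl (f ≫ g) := by
  rw [mk₀, mk₀, Category.assoc]

section

variable (Φ : DGEnhancement k D C)
  {Z : C → C} {μ : ∀ X, HH k (src (Z X) : TwistGlue E) (tgt X) 0}
  (hμ : ∀ X, IsUniversal (μ X))

/-- The twisted triangle is compared with the distinguished triangle of a dg cone of `f'`, a
representative of the twist of `f`. Both are exact, so the comparison on third objects is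
invertible. -/
theorem distinguished_twistMap
    (hbij : ∀ (X Y : C) (n : ℤ), Function.Bijective (twistMap hμ : HH k X Y n → _))
    (hess : ∀ Y : C, ∃ X : C, Nonempty (HH.Iso k (Z X) Y 0 0))
    {X Y V : C} {f : cocycles k X Y 0} {i : cocycles k Y V 0}
    {p : cocycles k V X 1} (hc : IsCone f.1 i.1 p.1) :
    Triangle.mk (Φ.hom₀ (twistMap hμ (HH.mk f))) (Φ.hom₀ (twistMap hμ (HH.mk i)))
      (Φ.hh (twistMap hμ (HH.mk p))) ∈ distTriang D := by
  obtain ⟨f', hf'⟩ := HH.mk_surjective (twistMap hμ (HH.mk f))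
  obtain ⟨Q, i', p', hc'⟩ := Φ.exists_isCone f'
  let i'' : cocycles k (Z Y) Q 0 := ⟨i', hc'.closed_i⟩
  let p'' : cocycles k Q (Z X) 1 := ⟨p', hc'.closed_p⟩
  have hT' : Triangle.mk (Φ.hom₀ (HH.mk f')) (Φ.hom₀ (HH.mk i'')) (Φ.hh (HH.mk p'')) ∈
    distTriang D := Φ.distinguished f' i'' p'' hc'
  have hT : Triangle.mk (Φ.hom₀ (HH.mk f)) (Φ.hom₀ (HH.mk i)) (Φ.hh (HH.mk p)) ∈
    distTriang D := Φ.distinguished f i p hc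
  obtain ⟨φ, hφ, hφ'⟩ := exists_twist_map_of_cones hμ hc (i' := i'') (p' := p'') hc' hf'
  rw [hf'] at hT'
  obtain ⟨σ, hσ⟩ := (Φ.isExactTriangle hT').exists_iso_of_comp
    (isExactTriangle_twistMap hμ hbij hess (Φ.isExactTriangle hT)) hφ hφ'
  refine distinguished_of_iso₃ hT' (Φ.toIso σ) ?_ ?_
  · exact (Φ.hom₀_comp _ _).symm.trans (congrArg Φ.hom₀ (hσ ▸ hφ))
  · exact (Φ.hh_precomp _ _).symm.trans (congrArg Φ.hh (hσ ▸ hφ'))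

end

section

variable [∀ m : ℤ, (shiftFunctor D m).Linear k] (Φ : DGEnhancement k D C)

lemma hhCongr_apply {X Y : C} {A B : D} (e : Φ.obj X ≅ A) (e' : Φ.obj Y ≅ B) {n : ℤ}
    (f : HH k X Y n) : Φ.hhCongr e e' n f = e.inv ≫ Φ.hh f ≫ e'.hom⟦n⟧' :=
  Category.assoc _ _ _

lemma hhCongr_one {X : C} {A : D} (e : Φ.obj X ≅ A) :
    Φ.hhCongr e e 0 (HH.one k X) = mk₀ 0 rfl (𝟙 A) := by
  rw [hhCongr_apply, hh_one, mk₀_comp_shift, comp_mk₀_shift, Category.id_comp, e.inv_hom_id]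

lemma hhCongr_comp {X Y V : C} {A B F : D} (e : Φ.obj X ≅ A) (e' : Φ.obj Y ≅ B)
    (e'' : Φ.obj V ≅ F) {p q n : ℤ} (h : p + q = n) (f : HH k X Y p) (g : HH k Y V q) :
    Φ.hhCongr e e'' n (HH.comp h f g) =
      ShiftedHom.comp (X := A) (Y := B) (Z := F) (Φ.hhCongr e e' p f) (Φ.hhCongr e' e'' q g)
        (show q + p = n by omega) := by
  simp only [hhCongr_apply, hh_comp, ShiftedHom.comp, Functor.map_comp, Category.assoc]
  rw [← Functor.map_comp_assoc _ e'.hom, e'.hom_inv_id, CategoryTheory.Functor.map_id, Category.id_comp]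
  exact congrArg (_ ≫ _ ≫ _ ≫ ·) ((shiftFunctorAdd' D q p n _).inv.naturality e''.hom).symm

/-- An object of the dg category lifting an object of the triangulated category. -/
noncomputable def lift (A : D) : C := (Φ.essSurj A).choose

/-- The isomorphism between an object and the image of its lift. -/
noncomputable def liftIso (A : D) : Φ.obj (Φ.lift A) ≅ A := (Φ.essSurj A).choose_spec.some

/-- The comparison between an object of the dg category and the lift of its image. -/
noncomputable def liftObjIso (X : C) : HH.Iso k X (Φ.lift (Φ.obj X)) 0 0 :=
  Φ.isoOfIso₀ (Φ.liftIso (Φ.obj X)).symm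

lemma hhCongr_symm_hh {X Y : C} {n : ℤ} (f : HH k X Y n) :
    (Φ.hhCongr (Φ.liftIso (Φ.obj X)) (Φ.liftIso (Φ.obj Y)) n).symm (Φ.hh f) =
      HH.comp (add_zero n) (HH.comp (zero_add n) (Φ.liftObjIso X).inv f) (Φ.liftObjIso Y).hom := by
  rw [LinearEquiv.symm_apply_eq, hhCongr_apply, hh_postcomp, hh_precomp]
  simp [liftObjIso, isoOfIso₀, ← Functor.map_comp]

variable {Z : C → C} {μ : ∀ X, HH k (src (Z X) : TwistGlue E) (tgt X) 0}
  (hμ : ∀ X, IsUniversal (μ X))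

/-- The twist on the category of graded morphisms. -/
noncomputable def twistShifted : ShiftedFunctor D where
  obj A := Φ.obj (Z (Φ.lift A))
  map {A B n} f := Φ.hh (twistMap hμ ((Φ.hhCongr (Φ.liftIso A) (Φ.liftIso B) n).symm f))
  map_id A := by
    rw [← Φ.hhCongr_one (Φ.liftIso A), LinearEquiv.symm_apply_apply, twistMap_one, hh_one]
  map_comp {A B F p q n} h f g := by
    obtain ⟨f, rfl⟩ := (Φ.hhCongr (Φ.liftIso A) (Φ.liftIso B) p).surjective f
    obtain ⟨g, rfl⟩ := (Φ.hhCongr (Φ.liftIso B) (Φ.liftIso F) q).surjective g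
    rw [← hhCongr_comp (h := show p + q = n by omega), LinearEquiv.symm_apply_apply,
      LinearEquiv.symm_apply_apply, LinearEquiv.symm_apply_apply, twistMap_comp, hh_comp]

/-- The twist functor. -/
noncomputable def twistFunctor : D ⥤ D := (Φ.twistShifted hμ).toFunctor

/-- The value of the twist functor on the image of an object of the dg category. -/
noncomputable def twistObjIso (X : C) : Φ.obj (Z X) ≅ (Φ.twistFunctor hμ).obj (Φ.obj X) :=
  Φ.toIso (twistIso hμ (Φ.liftObjIso X))

lemma twistShifted_map_hh {X Y : C} {n : ℤ} (f : HH k X Y n) :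
    (Φ.twistShifted hμ).map (Φ.hh f) =
      (Φ.twistObjIso hμ X).inv ≫ Φ.hh (twistMap hμ f) ≫ (Φ.twistObjIso hμ Y).hom⟦n⟧' := by
  refine (congrArg (fun z ↦ Φ.hh (twistMap hμ z)) (Φ.hhCongr_symm_hh f)).trans ?_
  rw [twistMap_comp, twistMap_comp, hh_postcomp, hh_precomp, Category.assoc]
  rfl

lemma twistFunctor_map_hom₀ {X Y : C} (f : HH k X Y 0) :
    (Φ.twistFunctor hμ).map (Φ.hom₀ f) =
      (Φ.twistObjIso hμ X).inv ≫ Φ.hom₀ (twistMap hμ f) ≫ (Φ.twistObjIso hμ Y).hom := by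
  refine (homEquiv (0 : ℤ) rfl).injective (((Φ.twistShifted hμ).mk₀_map₀ _).trans ?_)
  rw [mk₀_hom₀, twistShifted_map_hh, ← mk₀_hom₀, mk₀_comp_shift, comp_mk₀_shift]
  rfl

end

end

end DGEnhancement

/-! ### Identification with the cone of evaluation, and uniqueness -/

open DGCategory TwistGlue
open CategoryTheory.ShiftedHom hiding map_zero map_add map_smul map_comp comp_assoc

namespace DGCategory.TwistGlue

variable {k : Type v} [CommRing k] {C : Type u} [DGCategory.{w} k C]
  {ι : Type} [DecidableEq ι] {E : ι → C}

/-- The class of a cocycle of the cone of the evaluation map. -/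
def twistClass {W X : C} :
    twistCocycles k E W X →ₗ[k] HH k (src W : TwistGlue E) (tgt X) 0 :=
  HH.mk (X := (src W : TwistGlue E)) (Y := tgt X) (n := 0)

lemma twistClass_surjective {W X : C} :
    Function.Surjective (twistClass (k := k) (E := E) (W := W) (X := X)) :=
  HH.mk_surjective

lemma twistClass_eq_zero_iff {W X : C} (z : twistCocycles k E W X) :
    twistClass z = 0 ↔ z.1 ∈ twistCoboundaries k E W X :=
  HH.mk_eq_zero_iff (X := (src W : TwistGlue E)) (Y := tgt X) _

lemma twistClass_pull {W' W X : C} (g : cocycles k W' W 0) (z : twistCocycles k E W X) :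
    twistClass ⟨twistConePull E X g.1 0 z.1, twistConePull_mem_twistCocycles E g.2 z.2⟩ =
      HH.comp (zero_add 0) (srcHH E (HH.mk g)) (twistClass z) := by
  refine congrArg HH.mk (Subtype.ext (Prod.ext ?_ rfl))
  exact (esPull_eq_evalSourcePull E g.1 z.1.1).symm

lemma twistClass_push {W X X' : C} (f : cocycles k X X' 0) (z : twistCocycles k E W X) :
    twistClass ⟨twistConePush E W f.1 0 z.1, twistConePush_mem_twistCocycles E f.2 z.2⟩ =
      HH.comp (zero_add 0) (twistClass z) (tgtHH E (HH.mk f)) := by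
  refine congrArg HH.mk (Subtype.ext (Prod.ext ?_ rfl))
  exact (esPush_eq_evalSourcePush E f.1 z.1.1).symm.trans (one_smul _ _).symm

end DGCategory.TwistGlue

namespace TwistIdentification

variable {k : Type v} [Field k]
  {D : Type u₁} [Category.{v₁} D] [Preadditive D] [Linear k D] [HasZeroObject D] [HasShift D ℤ]
  [∀ n : ℤ, (shiftFunctor D n).Additive] [Pretriangulated D]
  {C : Type u₂} [DGCategory.{w} k C] {ι : Type} [DecidableEq ι] {E : ι → C}
  {Φ : DGEnhancement k D C}

open DGEnhancement

/-- Yoneda by hand: a cocycle `z` representing an isomorphism from an object of `C` to the value of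
`T` is a universal element, and its image under `I'` defines the morphism. -/
lemma exists_comparison {T T' : D ⥤ D} (I : TwistIdentification Φ E T)
    (I' : TwistIdentification Φ E T') (X : C) :
    ∃ θ : T.obj (Φ.obj X) ⟶ T'.obj (Φ.obj X), ∀ (W : C) (z : twistCocycles k E W X),
      I.rep W X z ≫ θ = I'.rep W X z := by
  obtain ⟨Z, ⟨e⟩⟩ := Φ.essSurj (T.obj (Φ.obj X))
  obtain ⟨z, hz⟩ := I.rep_surjective Z X e.hom
  refine ⟨e.inv ≫ I'.rep Z X z, fun W y ↦ ?_⟩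
  obtain ⟨g, hg⟩ := Φ.hom₀.surjective (I.rep W X y ≫ e.inv)
  obtain ⟨g, rfl⟩ := HH.mk_surjective g
  have hg' : Φ.map g ≫ e.hom = I.rep W X y := (Iso.eq_comp_inv e).1 hg
  let z' : twistCocycles k E W X := ⟨twistConePull E X g.1 0 z.1,
    twistConePull_mem_twistCocycles E g.2 z.2⟩
  have h1 : I.rep W X z' = I.rep W X y := (I.rep_pull X g z).trans (hz ▸ hg')
  -- The two identifications have the same kernel, the coboundaries of the cone, so the relation
  -- found for `I` passes to `I'`.
  have h2 : I.rep W X (y - z') = 0 :=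
    ((I.rep W X).map_sub y z').trans (sub_eq_zero.2 h1.symm)
  have h3 : I'.rep W X (y - z') = 0 := (I'.rep_eq_zero_iff _).2 ((I.rep_eq_zero_iff _).1 h2)
  have h0 : I'.rep W X y = Φ.map g ≫ I'.rep Z X z :=
    (sub_eq_zero.1 (((I'.rep W X).map_sub y z').symm.trans h3)).trans (I'.rep_pull X g z)
  rw [h0, ← Category.assoc]
  exact congrArg (· ≫ _) hg.symm

lemma hom_ext {T : D ⥤ D} (I : TwistIdentification Φ E T) {X : C} {A : D}
    {θ θ' : T.obj (Φ.obj X) ⟶ A}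
    (h : ∀ (W : C) (z : twistCocycles k E W X), I.rep W X z ≫ θ = I.rep W X z ≫ θ') : θ = θ' := by
  obtain ⟨Z, ⟨e⟩⟩ := Φ.essSurj (T.obj (Φ.obj X))
  obtain ⟨z, hz⟩ := I.rep_surjective Z X e.hom
  have := h Z z
  rwa [hz, cancel_epi] at this

/-- The twist functor is unique up to isomorphism. -/
theorem nonempty_iso [∀ m : ℤ, (shiftFunctor D m).Linear k] {T T' : D ⥤ D} (I : TwistIdentification Φ E T)
    (I' : TwistIdentification Φ E T') : Nonempty (T ≅ T') := by
  choose θ hθ using I.exists_comparison I'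
  choose θ' hθ' using I'.exists_comparison I
  have hnat : ∀ {X Y : C} (f : Φ.obj X ⟶ Φ.obj Y), θ X ≫ T'.map f = T.map f ≫ θ Y :=
    fun {X Y} f ↦ by
      obtain ⟨f, rfl⟩ := Φ.hom₀.surjective f
      obtain ⟨f, rfl⟩ := HH.mk_surjective f
      rw [hom₀_mk]
      refine I.hom_ext fun W z ↦ ?_
      rw [← Category.assoc, hθ, ← Category.assoc, ← I.rep_push, hθ, I'.rep_push]
  let e : ∀ X, T.obj (Φ.obj X) ≅ T'.obj (Φ.obj X) := fun X ↦
    ⟨θ X, θ' X, I.hom_ext fun W z ↦ by rw [← Category.assoc, hθ, hθ', Category.comp_id],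
      I'.hom_ext fun W z ↦ by rw [← Category.assoc, hθ', hθ, Category.comp_id]⟩
  refine ⟨NatIso.ofComponents (fun A ↦ T.mapIso (Φ.liftIso A).symm ≪≫ e _ ≪≫
    T'.mapIso (Φ.liftIso A)) fun {A B} f ↦ ?_⟩
  have := hnat ((Φ.liftIso A).hom ≫ f ≫ (Φ.liftIso B).inv)
  simp only [Functor.map_comp] at this
  simp only [Iso.trans_hom, Functor.mapIso_hom, Iso.symm_hom, e]
  rw [← cancel_epi (T.map (Φ.liftIso A).hom), ← cancel_mono (T'.map (Φ.liftIso B).inv)]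
  simpa using this.symm

end TwistIdentification

/-! ### Linearity, equivalence and exactness of the twist functor -/

namespace DGEnhancement

section

variable {k : Type v} [Field k]
  {D : Type u₁} [Category.{v₁} D] [Preadditive D] [Linear k D] [HasZeroObject D] [HasShift D ℤ]
  [∀ n : ℤ, (shiftFunctor D n).Additive] [Pretriangulated D]
  {C : Type u₂} [DGCategory.{w} k C] {ι : Type} [DecidableEq ι] {E : ι → C}

section

variable [∀ m : ℤ, (shiftFunctor D m).Linear k] (Φ : DGEnhancement k D C)
  {Z : C → C} {μ : ∀ X, HH k (src (Z X) : TwistGlue E) (tgt X) 0}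
  (hμ : ∀ X, IsUniversal (μ X))

/-- The universal property of the values of the twist functor. -/
noncomputable def twistEquiv (W X : C) : HH k (src W : TwistGlue E) (tgt X) 0 ≃ₗ[k]
    (Φ.obj W ⟶ (Φ.twistFunctor hμ).obj (Φ.obj X)) :=
  ((hμ X).equiv W (add_zero 0)).symm ≪≫ₗ Φ.hom₀ ≪≫ₗ
    Linear.homCongr k (Iso.refl _) (Φ.twistObjIso hμ X)

lemma twistEquiv_comp {W X : C} (w : HH k W (Z X) 0) :
    Φ.twistEquiv hμ W X (HH.comp (add_zero 0) (srcHH E w) (μ X)) =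
      Φ.hom₀ w ≫ (Φ.twistObjIso hμ X).hom := by
  rw [← IsUniversal.equiv_apply (hμ X)]
  simp [twistEquiv, Linear.homCongr]

/-- The twist functor is the cone of the evaluation map. -/
noncomputable def twistIdentification : TwistIdentification Φ E (Φ.twistFunctor hμ) where
  rep W X := (Φ.twistEquiv hμ W X).toLinearMap ∘ₗ twistClass
  rep_surjective W X := (Φ.twistEquiv hμ W X).surjective.comp twistClass_surjective
  rep_eq_zero_iff {W X} z :=
    (LinearEquiv.map_eq_zero_iff (Φ.twistEquiv hμ W X)).trans (twistClass_eq_zero_iff z)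
  rep_pull {W' W} X g z := by
    obtain ⟨w, hw⟩ := ((hμ X).equiv W (add_zero 0)).surjective (twistClass z)
    rw [IsUniversal.equiv_apply] at hw
    rw [LinearMap.comp_apply, LinearMap.comp_apply, twistClass_pull, ← hw,
      ← HH.comp_assoc (zero_add 0) _ (by omega), ← srcHH_comp]
    refine (Φ.twistEquiv_comp hμ _).trans ?_
    rw [hom₀_comp, Category.assoc]
    exact congrArg (_ ≫ ·) (Φ.twistEquiv_comp hμ w).symm
  rep_push W {X X'} f z := by
    obtain ⟨w, hw⟩ := ((hμ X).equiv W (add_zero 0)).surjective (twistClass z)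
    rw [IsUniversal.equiv_apply] at hw
    rw [LinearMap.comp_apply, LinearMap.comp_apply, twistClass_push, ← hw,
      HH.comp_assoc _ (zero_add 0) (by omega), ← twistMap_comp_univ hμ,
      ← HH.comp_assoc (zero_add 0) _ (by omega), ← srcHH_comp]
    refine (Φ.twistEquiv_comp hμ _).trans ?_
    refine Eq.trans ?_ (congrArg (· ≫ _) (Φ.twistEquiv_comp hμ w)).symm
    rw [← hom₀_mk, twistFunctor_map_hom₀, hom₀_comp]
    simp

lemma linear_twistFunctor : (Φ.twistFunctor hμ).Linear k where
  map_smul f c := by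
    refine (homEquiv (0 : ℤ) rfl).injective (((Φ.twistShifted hμ).mk₀_map₀ _).trans ?_)
    refine Eq.trans ?_ ((congrArg (c • ·) ((Φ.twistShifted hμ).mk₀_map₀ f)).symm.trans
      (mk₀_smul _ _ c).symm)
    rw [mk₀_smul]
    change Φ.hh (twistMap hμ _) = c • Φ.hh (twistMap hμ _)
    rw [LinearEquiv.map_smul, LinearMap.map_smul, LinearEquiv.map_smul]
    rfl

lemma isEquivalence_twistFunctor
    (hbij : ∀ (X Y : C) (n : ℤ), Function.Bijective (twistMap hμ : HH k X Y n → _))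
    (hess : ∀ Y : C, ∃ X : C, Nonempty (HH.Iso k (Z X) Y 0 0)) :
    (Φ.twistFunctor hμ).IsEquivalence := by
  have hmap : ∀ A B : D, Function.Bijective ((Φ.twistFunctor hμ).map : (A ⟶ B) → _) :=
    fun A B ↦ (homEquiv (0 : ℤ) rfl).symm.bijective.comp (Φ.hh.bijective.comp ((hbij _ _ _).comp
      ((Φ.hhCongr (Φ.liftIso A) (Φ.liftIso B) 0).symm.bijective.comp
        (homEquiv (0 : ℤ) rfl).bijective)))
  exact
    { faithful := ⟨fun h ↦ (hmap _ _).1 h⟩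
      full := ⟨fun f ↦ (hmap _ _).2 f⟩
      essSurj := ⟨fun A ↦ by
        obtain ⟨Y, ⟨e⟩⟩ := Φ.essSurj A
        obtain ⟨X, ⟨σ⟩⟩ := hess Y
        exact ⟨Φ.obj X, ⟨(Φ.twistObjIso hμ X).symm ≪≫ Φ.toIso σ ≪≫ e⟩⟩⟩ }

noncomputable instance : (Φ.twistFunctor hμ).CommShift ℤ :=
  inferInstanceAs ((Φ.twistShifted hμ).toFunctor.CommShift ℤ)

lemma twistFunctor_map_commShiftIso {A B : D} {n : ℤ} (f : ShiftedHom A B n) :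
    (Φ.twistFunctor hμ).map f ≫ ((Φ.twistFunctor hμ).commShiftIso n).hom.app B =
      (Φ.twistShifted hμ).map f :=
  (Φ.twistShifted hμ).shiftedHom_map f

lemma isTriangulated_twistFunctor
    (hbij : ∀ (X Y : C) (n : ℤ), Function.Bijective (twistMap hμ : HH k X Y n → _))
    (hess : ∀ Y : C, ∃ X : C, Nonempty (HH.Iso k (Z X) Y 0 0)) :
    (Φ.twistFunctor hμ).IsTriangulated where
  map_distinguished T hT := by
    obtain ⟨X, ⟨e⟩⟩ := Φ.essSurj T.obj₁
    obtain ⟨Y, ⟨e'⟩⟩ := Φ.essSurj T.obj₂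
    obtain ⟨f, hf⟩ := Φ.hom₀.surjective (e.hom ≫ T.mor₁ ≫ e'.inv)
    obtain ⟨f, rfl⟩ := HH.mk_surjective f
    obtain ⟨V, i, p, hc⟩ := Φ.exists_isCone f
    let i' : cocycles k Y V 0 := ⟨i, hc.closed_i⟩
    let p' : cocycles k V X 1 := ⟨p, hc.closed_p⟩
    have hT₀ : Triangle.mk (Φ.hom₀ (HH.mk f)) (Φ.hom₀ (HH.mk i')) (Φ.hh (HH.mk p')) ∈ distTriang D :=
      Φ.distinguished f i' p' hc
    -- A distinguished triangle is determined up to isomorphism by its first morphism, so only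
    -- triangles of dg cones have to be treated.
    have ε := isoTriangleOfIso₁₂ _ _ hT hT₀ e.symm e'.symm
      ((Iso.eq_inv_comp e).2 hf.symm).symm.symm
    refine isomorphic_distinguished _ (Φ.distinguished_twistMap hμ hbij hess (i := i') (p := p') hc) _
      ((Φ.twistFunctor hμ).mapTriangle.mapIso ε ≪≫ Triangle.isoMk _ _ (Φ.twistObjIso hμ X).symm
        (Φ.twistObjIso hμ Y).symm (Φ.twistObjIso hμ V).symm ?_ ?_ ?_)
    · change (Φ.twistFunctor hμ).map (Φ.hom₀ (HH.mk f)) ≫ (Φ.twistObjIso hμ Y).inv =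
        (Φ.twistObjIso hμ X).inv ≫ Φ.hom₀ (twistMap hμ (HH.mk f))
      rw [twistFunctor_map_hom₀]
      simp
    · change (Φ.twistFunctor hμ).map (Φ.hom₀ (HH.mk i')) ≫ (Φ.twistObjIso hμ V).inv =
        (Φ.twistObjIso hμ Y).inv ≫ Φ.hom₀ (twistMap hμ (HH.mk i'))
      rw [twistFunctor_map_hom₀]
      simp
    -- The image of the connecting morphism, followed by the commutation with the shift, is the
    -- degree one action of the twist.
    · refine (congrArg (· ≫ (Φ.twistObjIso hμ X).inv⟦(1 : ℤ)⟧')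
        ((Φ.twistFunctor_map_commShiftIso hμ (Φ.hh (HH.mk p'))).trans
          (Φ.twistShifted_map_hh hμ (HH.mk p')))).trans ?_
      change _ = (Φ.twistObjIso hμ V).inv ≫ Φ.hh (twistMap hμ (HH.mk p'))
      rw [Category.assoc, Category.assoc, ← Functor.map_comp, Iso.hom_inv_id,
        CategoryTheory.Functor.map_id, Category.comp_id]

end

variable (k) in
lemma _root_.IsAutoequivalence.of_iso {T T' : D ⥤ D} (h : IsAutoequivalence k T) (e : T ≅ T') :
    IsAutoequivalence k T' := by
  obtain ⟨h₁, h₂, h₃, h₄⟩ := h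
  let := Functor.CommShift.ofIso e ℤ
  have := Functor.CommShift.ofIso_compatibility e ℤ
  exact ⟨Functor.isEquivalence_of_iso e, Functor.linear_of_iso k e, inferInstance,
    Functor.isTriangulated_of_iso e⟩

end

end DGEnhancement

/-! ### Proof of the theorem -/

open DGCategory TwistGlue

namespace DGEnhancement

lemma hasFiniteSupport {k : Type v} [Field k]
    {D : Type u₁} [Category.{v₁} D] [Preadditive D] [Linear k D] [HasZeroObject D] [HasShift D ℤ]
    [∀ m : ℤ, (shiftFunctor D m).Additive] [∀ m : ℤ, (shiftFunctor D m).Linear k]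
    [Pretriangulated D] {C : Type u₂} [DGCategory.{w} k C] (Φ : DGEnhancement k D C) {ι : Type}
    {E : ι → D} (htot : ∀ (i : ι) (X : D), {m : ℤ | ∃ f : E i ⟶ X⟦m⟧, f ≠ 0}.Finite)
    {E' : ι → C} (e : ∀ i, Φ.obj (E' i) ≅ E i) : HasFiniteSupport k E' := fun i X ↦
  (htot i (Φ.obj X)).subset fun m ⟨f, hf⟩ ↦ ⟨Φ.hhCongr (e i) (Iso.refl _) m f,
    (LinearEquiv.map_ne_zero_iff _).2 hf⟩

/-- Every lift of an exceptional cycle to the dg category has a twist functor, which is an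
autoequivalence. -/
theorem exists_twist {k : Type v} [Field k]
    {D : Type u₁} [Category.{v₁} D] [Preadditive D] [Linear k D] [HasZeroObject D] [HasShift D ℤ]
    [∀ m : ℤ, (shiftFunctor D m).Additive] [∀ m : ℤ, (shiftFunctor D m).Linear k]
    [Pretriangulated D] {C : Type u₂} [DGCategory.{w} k C] (Φ : DGEnhancement k D C)
    (hfin : IsHomFinite k D) (S : SerreFunctor k D)
    {n : ℕ} [NeZero n] (E : Fin n → D) (hE : IsExceptionalCycle S E)
    (htot : ∀ (i : Fin n) (X : D), {m : ℤ | ∃ f : E i ⟶ X⟦m⟧, f ≠ 0}.Finite)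
    (E' : Fin n → C) (e : ∀ i, Φ.obj (E' i) ≅ E i) :
    ∃ T : D ⥤ D, Nonempty (TwistIdentification Φ E' T) ∧ IsAutoequivalence k T := by
  have hE' := Φ.isTwistCycle hfin S hE E' e
  have htot' := Φ.hasFiniteSupport htot e
  choose Z μ hμ using Φ.exists_universal hfin htot'
  have hbij : ∀ (X Y : C) (n : ℤ), Function.Bijective (twistMap hμ : HH k X Y n → _) :=
    fun _ _ _ ↦ Φ.twistMap_bijective hfin S hE' htot' hμ
  have hess := Φ.twist_essSurj hfin S hE' htot' hμ
  exact ⟨Φ.twistFunctor hμ, ⟨Φ.twistIdentification hμ⟩, Φ.isEquivalence_twistFunctor hμ hbij hess,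
    Φ.linear_twistFunctor hμ, inferInstance, Φ.isTriangulated_twistFunctor hμ hbij hess⟩

end DGEnhancement

theorem mainTheorem4 {k : Type v} [Field k] [IsAlgClosed k]
    {D : Type u₁} [Category.{v₁} D] [Preadditive D] [Linear k D] [HasZeroObject D] [HasShift D ℤ]
    [∀ m : ℤ, (shiftFunctor D m).Additive] [∀ m : ℤ, (shiftFunctor D m).Linear k]
    [Pretriangulated D] [IsTriangulated D]
    {C : Type u₂} [DGCategory.{w} k C] (Φ : DGEnhancement k D C)
    (hfin : IsHomFinite k D) (hind : IsIndecomposable D) (S : SerreFunctor k D)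
    {n : ℕ} [NeZero n] (E : Fin n → D) (hE : IsExceptionalCycle S E)
    (htot : ∀ (i : Fin n) (X : D), {m : ℤ | ∃ f : E i ⟶ X⟦m⟧, f ≠ 0}.Finite) :
    (∃ T : D ⥤ D, IsTwistFunctor Φ E T) ∧
      ∀ T : D ⥤ D, IsTwistFunctor Φ E T → IsAutoequivalence k T := by
  refine ⟨?_, ?_⟩
  · choose E' e using fun i ↦ Φ.essSurj (E i)
    obtain ⟨T, hT, -⟩ := Φ.exists_twist hfin S E hE htot E' fun i ↦ (e i).some
    exact ⟨T, E', e, hT⟩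
  -- The lifts of the `E i` are those that come with `T`. The twist is constructed for these same
  -- lifts, and is isomorphic to `T` by uniqueness.
  · rintro T ⟨E', e, ⟨I⟩⟩
    obtain ⟨T', ⟨I'⟩, hT'⟩ := Φ.exists_twist hfin S E hE htot E' fun i ↦ (e i).some
    exact hT'.of_iso k (I'.nonempty_iso I).some
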